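/- Let $\Lambda=\mathbf C[P_1,P_2,\dots]$ be the ring of symmetric functions ($P_k$ the power sums), $\Lambda[P_0]=\mathbf C[P_0,P_1,\dots]$, and identify $\Lambda\otimes\Lambda$ with symmetric functions in two sets of variables $x,y$. For a partition $\mu$ with $m_i$ parts equal to $i$ put $P_\mu=\prod_i P_{\mu_i}$ and $Z_\mu=\prod_i m_i!\,i^{m_i}$; let $S_\lambda$ be the Schur functions. In $\mathbf C[S_n]$ let $C_\mu$ be the sum of all permutations of cycle type $\mu$, let $\mathcal J_b=\sum_{a<b}(a\,b)$ ($1\le b\le n$) be the Jucys–Murphy elements, and for $G\in\Lambda[P_0]$ let $G(\mathcal J)$ be its image under $P_k\mapsto\sum_{b=1}^n\mathcal J_b^k$ (so $P_0\mapsto n$). Let $G(\mathrm{cont}(\lambda))$ be the value of $G$ under $P_k\mapsto\sum_{(i,j)\in\lambda}(j-i)^k$ (so $P_0\mapsto|\lambda|$). Let $\mathrm{ch}:\mathbf C[S_n]\to\Lambda$ be linear with $\mathrm{ch}(g)=P_{\mathrm{cyc}(g)}/n!$, where $\mathrm{cyc}(g)$ is the cycle type of $g$. (1) For every $n\ge 0$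 and $G\in\Lambda[P_0]$ there is exactly one matrix $(G_{\lambda\mu})_{|\lambda|=|\mu|=n}$ with $G(\mathcal J)\,C_\lambda=\sum_\mu G_{\lambda\mu}C_\mu$ for all $\lambda$, and $$(\mathrm{ch}\otimes\mathrm{ch})\Big(\sum_{g\in S_n}n!\;g\otimes\big(G(\mathcal J)g\big)\Big)=\sum_{|\lambda|=|\mu|=n}Z_\mu^{-1}\,G_{\lambda\mu}\,P_\lambda(x)P_\mu(y)=\sum_{|\lambda|=n}G(\mathrm{cont}(\lambda))\,S_\lambda(x)S_\lambda(y).$$ (2) Let $z$ be a (possibly empty or infinite) family of formal parameters and let $G\in\Lambda[P_0][[z]]$, with $G(\mathcal J)$ and $G(\mathrm{cont}(\lambda))$ taken coefficientwise in $z$. Suppose that $G(\mathrm{cont}(\lambda))=\prod_{(i,j)\in\lambda}r_{j-i}$ for all partitions $\lambda$, where $r_j=\rho_j/\rho_{j-1}$ and $\rho_j$ $(j\in\mathbf Z)$ are units of $\mathbf C[[z]]$. Then the formal sum over $n\ge0$ of the elements $(\mathrm{ch}\otimes\mathrm{ch})\big(\sum_{g\in S_n}n!\,g\otimes(G(\mathcal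 J)g)\big)$ is the restriction to $t_i=\frac1iP_i(x)$, $s_i=\frac1iP_i(y)$ $(i\ge1)$ of the hypergeometric-type 2D Toda $\tau$-function $$\tau(N,\mathbf t,\mathbf s)=\langle N|\,e^{\sum_{i\ge1}t_iJ_i}\;\hat C_\rho\;e^{\sum_{i\ge1}s_iJ_{-i}}\,|N\rangle$$ at lattice site $N=0$. Here $\psi_j,\psi_j^\dagger$ $(j\in\mathbf Z)$ are the free fermion creation and annihilation operators on the fermionic Fock space, $|N\rangle$ is the state in which exactly the levels $j<N$ are occupied, $J_i=\sum_{j}{:}\psi_j\psi_{j+i}^\dagger{:}$, and $\hat C_\rho=e^{\sum_jT_j:\psi_j\psi_j^\dagger:}$ with $\rho_j=e^{T_j}$, that is, $\hat C_\rho$ is diagonal in the occupation basis, with eigenvalue the product of $\rho_j$ over the occupied levels $j\ge0$ and of $\rho_j^{-1}$ over the empty levels $j<0$. -/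

import Mathlib

open scoped BigOperators TensorProduct Nat

noncomputable section

namespace TwistedCL

/-! ### Partitions -/

/-- The parts of a partition in weakly decreasing order `λ₁ ≥ λ₂ ≥ …`. -/
def rows {n : ℕ} (lam : n.Partition) : List ℕ :=
  lam.parts.sort (· ≥ ·)

/-- The Young diagram of a partition, with boxes `(i, j)`, `j < λ_i` (rows and columns counted
from `0`; the content `j - i` does not depend on this shift). -/
def diagram {n : ℕ} (lam : n.Partition) : YoungDiagram :=
  YoungDiagram.ofRowLens (rows lam) (Multiset.pairwise_sort lam.parts (· ≥ ·)).sortedGE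

/-- `Z_μ = ∏ i, m_i! i ^ m_i`, where `m_i` is the number of parts of `μ` equal to `i`. -/
def zee {n : ℕ} (mu : n.Partition) : ℂ :=
  ∏ i ∈ mu.parts.toFinset, ((mu.parts.count i)! : ℂ) * (i : ℂ) ^ mu.parts.count i

/-! ### Symmetric functions -/

/-- The ring of symmetric functions `Λ = ℂ[P₁, P₂, …]`; the variable `X k` is `P_k`. -/
abbrev Lam : Type := MvPolynomial ℕ+ ℂ

/-- The ring `Λ[P₀] = ℂ[P₀, P₁, P₂, …]`; the variable `X k` is `P_k`. -/
abbrev LamP0 : Type := MvPolynomial ℕ ℂ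

/-- `Λ ⊗ Λ`, seen as the symmetric functions in two sets of variables `x` and `y`:
`X (Sum.inl k)` is `P_k(x)` and `X (Sum.inr k)` is `P_k(y)`. -/
abbrev LamXY : Type := MvPolynomial (ℕ+ ⊕ ℕ+) ℂ

/-- `f ↦ f(x)`. -/
def inX : Lam →ₐ[ℂ] LamXY := MvPolynomial.rename Sum.inl

/-- `f ↦ f(y)`. -/
def inY : Lam →ₐ[ℂ] LamXY := MvPolynomial.rename Sum.inr

/-- The power sum product `∏ P_k` over a multiset of positive integers. -/
def powProd (s : Multiset ℕ) : Lam :=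
  (s.map fun k => (MvPolynomial.X k.toPNat' : Lam)).prod

/-- The power sum symmetric function `P_μ = P_{μ₁} P_{μ₂} ⋯`. -/
def pPart {n : ℕ} (mu : n.Partition) : Lam := powProd mu.parts

/-- The complete homogeneous symmetric function `h_n = ∑_{|μ| = n} P_μ / Z_μ`, that is, the
coefficient of `z ^ n` in `exp (∑_{k ≥ 1} P_k z ^ k / k)`. -/
def hNat (n : ℕ) : Lam := ∑ mu : n.Partition, (zee mu)⁻¹ • pPart mu

/-- `h_m` for an integer `m`, zero for `m < 0`. -/
def hInt (m : ℤ) : Lam := if m < 0 then 0 else hNat m.toNat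

/-- The Schur function `S_λ = det (h_{λ_i - i + j})`. -/
def schur {n : ℕ} (lam : n.Partition) : Lam :=
  Matrix.det (Matrix.of fun i j : Fin (rows lam).length =>
    hInt (((rows lam).get i : ℤ) - (i : ℤ) + (j : ℤ)))

/-- `G(cont(λ))`: the evaluation of `G ∈ Λ[P₀]` at the multiset of contents of `λ`,
`P_k ↦ ∑_{(i,j) ∈ λ} (j - i) ^ k`; in particular `P₀ ↦ |λ|`. -/
def contEval {n : ℕ} (lam : n.Partition) : LamP0 →+* ℂ :=
  MvPolynomial.eval fun k => ∑ c ∈ (diagram lam).cells, ((c.2 : ℂ) - (c.1 : ℂ)) ^ k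

/-! ### The group algebra of the symmetric group -/

/-- The group algebra `ℂ[S_n]`. -/
abbrev GAlg (n : ℕ) : Type := MonoidAlgebra ℂ (Equiv.Perm (Fin n))

/-- A permutation as an element of the group algebra. -/
def elt {n : ℕ} (g : Equiv.Perm (Fin n)) : GAlg n := MonoidAlgebra.single g 1

/-- The class sum `C_μ`: the sum of all permutations with cycle type `μ` (fixed points
counting as parts equal to `1`). -/
def classSum {n : ℕ} (mu : n.Partition) : GAlg n :=
  ∑ g : Equiv.Perm (Fin n) with g.partition.parts = mu.parts, elt g

/-- The Jucys–Murphy element `𝒥_b = ∑_{a < b} (a b)`. -/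
def jm {n : ℕ} (b : Fin n) : GAlg n :=
  ∑ a : Fin n with a < b, elt (Equiv.swap a b)

theorem elt_mul {n : ℕ} (g h : Equiv.Perm (Fin n)) : elt g * elt h = elt (g * h) := by
  simp [elt, MonoidAlgebra.single_mul_single]

theorem jm_comm_swap {n : ℕ} (b c d : Fin n) (hc : c < b) (hd : d < b) :
    jm b * elt (Equiv.swap c d) = elt (Equiv.swap c d) * jm b := by
  have hb : Equiv.swap c d b = b := Equiv.swap_apply_of_ne_of_ne hc.ne' hd.ne'
  have key : ∀ a : Fin n, a < b → Equiv.swap c d a < b := by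
    intro a ha
    rw [Equiv.swap_apply_def]
    split_ifs <;> assumption
  unfold jm
  rw [Finset.sum_mul, Finset.mul_sum]
  refine Finset.sum_bij' (fun a _ => Equiv.swap c d a) (fun a _ => Equiv.swap c d a) ?_ ?_ ?_ ?_ ?_
  · intro a ha
    simpa using key a (by simpa using ha)
  · intro a ha
    simpa using key a (by simpa using ha)
  · intro a _
    simp
  · intro a _
    simp
  · intro a _
    rw [elt_mul, elt_mul]
    congr 1
    have := Equiv.mul_swap_eq_swap_mul (Equiv.swap c d) (Equiv.swap c d a) b
    rw [this]
    simp [hb]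

theorem jm_comm {n : ℕ} (a b : Fin n) : jm a * jm b = jm b * jm a := by
  have main : ∀ a b : Fin n, a < b → jm a * jm b = jm b * jm a := by
    intro a b hab
    conv_lhs => rw [jm]
    conv_rhs => rw [jm.eq_1 a]
    rw [Finset.sum_mul, Finset.mul_sum]
    refine Finset.sum_congr rfl fun c hc => ?_
    have hc' : c < a := by simpa using hc
    exact (jm_comm_swap b c a (hc'.trans hab) hab).symm
  rcases lt_trichotomy a b with h | h | h
  · exact main a b h
  · rw [h]
  · exact (main b a h).symm

/-- The (commutative) subalgebra of `ℂ[S_n]` generated by the Jucys–Murphy elements. -/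
abbrev jmAlg (n : ℕ) : Subalgebra ℂ (GAlg n) :=
  Algebra.adjoin ℂ (Set.range (jm : Fin n → GAlg n))

instance jmAlgCommRing (n : ℕ) : CommRing (jmAlg n) :=
  { (inferInstance : Ring (jmAlg n)) with
    mul_comm := (Algebra.isMulCommutative_adjoin ℂ (by
      rintro _ ⟨a, rfl⟩ _ ⟨b, rfl⟩
      exact jm_comm a b) : IsMulCommutative (jmAlg n)).is_comm.comm }

/-- The evaluation `G ↦ G(𝒥)`: the algebra homomorphism with `P_k ↦ ∑_b 𝒥_b ^ k`;
in particular `P₀ ↦ n`. -/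
def jmEval (n : ℕ) (G : LamP0) : GAlg n :=
  ((MvPolynomial.aeval
    (fun k : ℕ => (∑ b : Fin n, ⟨jm b, Algebra.subset_adjoin ⟨b, rfl⟩⟩ ^ k : jmAlg n)) G :
      jmAlg n) : GAlg n)

/-- `M` is the matrix of multiplication by `G(𝒥)` in the basis of class sums:
`G(𝒥) C_λ = ∑_μ M_{λμ} C_μ`. -/
def IsClassMatrix (n : ℕ) (G : LamP0) (M : n.Partition → n.Partition → ℂ) : Prop :=
  ∀ lam : n.Partition, jmEval n G * classSum lam = ∑ mu : n.Partition, M lam mu • classSum mu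

/-- Frobenius' characteristic map, extended to `ℂ[S_n]` by `ch(g) = P_{cyc(g)} / n!`. -/
def ch (n : ℕ) : GAlg n →ₗ[ℂ] Lam :=
  Finsupp.linearCombination ℂ
      (fun g : Equiv.Perm (Fin n) => ((n ! : ℂ)⁻¹) • powProd g.partition.parts) ∘ₗ
    (MonoidAlgebra.coeffLinearEquiv ℂ).toLinearMap

/-- `ch ⊗ ch : ℂ[S_n] ⊗ ℂ[S_n] → Λ ⊗ Λ`, `a ⊗ b ↦ ch(a)(x) ch(b)(y)`. -/
def chch (n : ℕ) : GAlg n ⊗[ℂ] GAlg n →ₗ[ℂ] LamXY :=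
  LinearMap.mul' ℂ LamXY ∘ₗ
    TensorProduct.map (inX.toLinearMap ∘ₗ ch n) (inY.toLinearMap ∘ₗ ch n)

/-- The twisted diagonal element `∑_{g ∈ S_n} n! g ⊗ (G(𝒥) g)`. -/
def twistedElt (n : ℕ) (G : LamP0) : GAlg n ⊗[ℂ] GAlg n :=
  ∑ g : Equiv.Perm (Fin n), (n ! : ℂ) • (elt g ⊗ₜ[ℂ] (jmEval n G * elt g))

/-! ### The fermionic Fock space and 2D Toda tau functions -/

/-- The occupied sites of a basis state of the Fock space: a set of integers with finitely many
nonnegative elements that misses only finitely many negative integers. -/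
def Maya : Type :=
  {S : Set ℤ // (S ∩ {j | 0 ≤ j}).Finite ∧ (Sᶜ ∩ {j | j < 0}).Finite}

/-- Occupy the site `j`. -/
def Maya.insert (j : ℤ) (S : Maya) : Maya :=
  ⟨Insert.insert j S.1,
    (S.2.1.insert j).subset (by
      rintro k ⟨h | h, hk⟩
      · exact Or.inl h
      · exact Or.inr ⟨h, hk⟩),
    S.2.2.subset (by
      rintro k ⟨h, hk⟩
      exact ⟨fun h' => h (Or.inr h'), hk⟩)⟩

/-- Empty the site `j`. -/
def Maya.erase (j : ℤ) (S : Maya) : Maya :=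
  ⟨S.1 \ {j},
    S.2.1.subset (by
      rintro k ⟨⟨h, _⟩, hk⟩
      exact ⟨h, hk⟩),
    (S.2.2.insert j).subset (by
      rintro k ⟨h, hk⟩
      by_cases hkj : k = j
      · exact Or.inl hkj
      · exact Or.inr ⟨fun h' => h ⟨h', hkj⟩, hk⟩)⟩

/-- The vacuum of charge `N`: the occupied sites are the `j < N`. -/
def Maya.vac (N : ℤ) : Maya :=
  ⟨{j | j < N},
    (Set.finite_Ico 0 N).subset (fun _ hk => ⟨hk.2, hk.1⟩),
    (Set.finite_Ico N 0).subset (fun _ hk => ⟨not_lt.mp hk.1, hk.2⟩)⟩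

/-- The number of occupied sites above `j`. -/
def Maya.above (j : ℤ) (S : Maya) : ℕ := Set.ncard {k | k ∈ S.1 ∧ j < k}

/-- The fermionic Fock space with coefficients in `R`. -/
abbrev Fock (R : Type*) [CommRing R] : Type _ := Maya →₀ R

section Fermions

variable (R : Type*) [CommRing R]

open Classical in
/-- The creation operator `ψ_j`. -/
def psi (j : ℤ) : Fock R →ₗ[R] Fock R :=
  Finsupp.linearCombination R fun S : Maya =>
    if j ∈ S.1 then 0 else Finsupp.single (S.insert j) ((-1 : R) ^ S.above j)

open Classical in
/-- The annihilation operator `ψ_j†`. -/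
def psiDag (j : ℤ) : Fock R →ₗ[R] Fock R :=
  Finsupp.linearCombination R fun S : Maya =>
    if j ∈ S.1 then Finsupp.single (S.erase j) ((-1 : R) ^ S.above j) else 0

/-- The current `J_i = ∑_j :ψ_j ψ_{j+i}†:` for `i ≠ 0`. Then normal ordering has no effect, and
only finitely many terms of the sum act nontrivially on a given basis state. -/
def current (i : ℤ) : Fock R →ₗ[R] Fock R :=
  Finsupp.linearCombination R fun S : Maya =>
    ∑ᶠ j : ℤ, psi R j (psiDag R (j + i) (Finsupp.single S 1))

variable {R}

/-- The convolution symmetry `Ĉ_ρ = exp (∑_j T_j :ψ_j ψ_j†:)`, `ρ_j = exp T_j`: it is diagonal,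
with eigenvalue `∏_{j ≥ 0 occupied} ρ_j · ∏_{j < 0 empty} ρ_j⁻¹`. -/
def convSymm (rho : ℤ → Rˣ) : Fock R →ₗ[R] Fock R :=
  Finsupp.linearCombination R fun S : Maya =>
    Finsupp.single S
      (((∏ᶠ j ∈ S.1 ∩ {j | 0 ≤ j}, rho j) * (∏ᶠ j ∈ S.1ᶜ ∩ {j | j < 0}, (rho j)⁻¹) : Rˣ) : R)

variable (R) [Algebra ℂ R]

/-- The coefficient of `∏ t_i ^ a_i` in `γ̂_±(t) = exp (∑_{i ≥ 1} t_i J_{±i})`, namely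
`∏ J_{±i} ^ a_i / a_i!`; here `e = ±1`, and the factors commute. -/
def gammaCoeff (e : ℤ) (a : ℕ+ →₀ ℕ) : Module.End R (Fock R) :=
  ((a.support.sort (· ≤ ·)).map fun i =>
    algebraMap ℂ R (((a i)! : ℂ)⁻¹) • (current R (e * (i : ℤ)) : Module.End R (Fock R)) ^ a i).prod

variable {R}

/-- The 2D Toda tau function `τ_g(N, t, s) = ⟨N| γ̂₊(t) ĝ γ̂₋(s) |N⟩`, as a formal power series
in the flow variables `t_i = X (Sum.inl i)` and `s_i = X (Sum.inr i)`. -/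
def tau (g : Fock R →ₗ[R] Fock R) (N : ℤ) : MvPowerSeries (ℕ+ ⊕ ℕ+) R := fun d =>
  (gammaCoeff R 1 (d.comapDomain Sum.inl Sum.inl_injective.injOn)
    (g (gammaCoeff R (-1) (d.comapDomain Sum.inr Sum.inr_injective.injOn)
      (Finsupp.single (Maya.vac N) 1)))) (Maya.vac N)

/-- Restriction of the flow variables to the power sum values `t_i = P_i(x) / i`,
`s_i = P_i(y) / i`; the result is a formal power series in the `P_i(x)` and `P_i(y)`. -/
def restrictToPowerSums : MvPowerSeries (ℕ+ ⊕ ℕ+) R →+* MvPowerSeries (ℕ+ ⊕ ℕ+) R :=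
  MvPowerSeries.rescale fun k =>
    algebraMap ℂ R (Sum.elim (fun i : ℕ+ => ((i : ℕ) : ℂ)⁻¹) (fun i : ℕ+ => ((i : ℕ) : ℂ)⁻¹) k)

end Fermions

/-- For `G ∈ Λ[P₀]⟦z⟧` (formal parameters `z`), the formal sum over `n ≥ 0` of the images
`(ch ⊗ ch) (∑_{g ∈ S_n} n! g ⊗ (G(𝒥) g))`, a formal power series in the `P_i(x)`, `P_i(y)` with
coefficients in `ℂ⟦z⟧`. Each monomial in the `P_i(x)`, `P_i(y)` occurs for at most one `n`. -/
def twistedSeries {σ : Type*} (G : MvPowerSeries σ LamP0) :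
    MvPowerSeries (ℕ+ ⊕ ℕ+) (MvPowerSeries σ ℂ) := fun d k =>
  ∑ᶠ n : ℕ, MvPolynomial.coeff d (chch n (twistedElt n (MvPowerSeries.coeff k G)))

end TwistedCL

end

noncomputable section

namespace TwistedCL

open MvPolynomial

/-! ### Partitions as exponent vectors -/

/-! Everything is expressed through the determinants `hDet l v` = det(h_{l_i + v_j}). With v = (0,
1, …, N-1) and l_p = λ_p - p they are the Schur functions, and `hDet` makes sense for every integer
vector l. The derivation `dP k` = k ∂/∂P_k sends h_m to h_{m-k}, so on `hDet` it lowers one index by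
k, summed over the rows.

Contents enter through the sum of all transpositions, the first power sum of the Jucys–Murphy
elements. Multiplying by a transposition cuts one cycle or joins two (`sum_swap_mul`), so under `ch`
this sum becomes the cut-and-join operator (`ch_jmPow_one_mul`). The Schur functions are its
eigenvectors, with the sum of the contents as eigenvalue (`cutJoin_hDet`); this goes by induction on
the degree, since a polynomial is determined by its constant term and its derivatives `dP k`.

All other power sums P_k(𝒥) follow from this one by going from S_n to S_{n+1} (`ch_jmPow_mul`). Let
x be central in ℂ[S_n] over the Schur function of a diagram m. The last Jucys–Murphy element is the
difference of the sums of transpositions of S_{n+1} and S_n, so on the image of x it acts as a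
polynomial in a central element of ℂ[S_{n+1}]. By Pieri's rule the image of x is a sum of
eigenvectors, one for each box that can be added to m, with distinct eigenvalues; an interpolation
polynomial isolates any one of them, and there the last Jucys–Murphy element acts by the content of
the added box. No representation of S_n is needed: P_k(𝒥) is central, and the effect under `ch` of
multiplication by a central element depends only on the characteristic of the other factor
(`ch_center_mul_congr`).

The expansion of P_μ in Schur functions is completeness for the Hall pairing (`schurSum_monomial`).
The operator f ↦ ∑ ⟨S_λ, f⟩ S_λ commutes with multiplication by P_1, by Pieri's rule and its
adjoint, and with the derivation ∑ P_{j+1} j ∂/∂P_j, which adds boxes weighted by their contents;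
commutators of the two give multiplication by every P_k. Grouping the twisted diagonal element by
cycle types and inserting this expansion of the class sums gives part (1).

For part (2), a current J_k with k > 0 acts on a wedge ψ_{s_0} ψ_{s_1} ⋯ |M⟩ by lowering one index
by k, exactly as `dP k` acts on `hDet`, and the vacuum coefficient of a wedge equals the constant
term of the determinant (`Corresponds.one`, `Corresponds.mul_current`). Hence the matrix elements of
the vertex operators between the vacuum and the Maya diagram of λ are the coefficients of S_λ up to
∏ i ^ a_i, which the restriction to power sums cancels. The currents J_{-k} are the transposes of
the J_k, and the eigenvalue of Ĉ_ρ telescopes along the rows of λ to the content product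
(`convEigen_mayaOf`). -/

/-- The degree of the monomial with exponents `d`, where the variable `P_k` has degree `k`. -/
abbrev wt : (ℕ+ →₀ ℕ) →+ ℕ := Finsupp.weight fun i : ℕ+ => (i : ℕ)

/-- `∏ i, d_i! i ^ d_i`. -/
def zFin (d : ℕ+ →₀ ℕ) : ℂ := d.prod fun i m => (m ! : ℂ) * (i : ℂ) ^ m

/-- The exponent vector of `P_μ`. -/
def exps {n : ℕ} (mu : n.Partition) : ℕ+ →₀ ℕ := Multiset.toFinsupp (mu.parts.map Nat.toPNat')

theorem powProd_eq_monomial (s : Multiset ℕ) :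
    powProd s = monomial (Multiset.toFinsupp (s.map Nat.toPNat')) 1 := by
  unfold powProd
  induction s using Multiset.induction_on with
  | empty => simp
  | cons a s ih =>
    rw [Multiset.map_cons, Multiset.prod_cons, ih, Multiset.map_cons, ← Multiset.singleton_add,
      Multiset.toFinsupp_add, Multiset.toFinsupp_singleton, X, monomial_mul, one_mul]

theorem powProd_add (s t : Multiset ℕ) : powProd (s + t) = powProd s * powProd t := by
  simp [powProd]

theorem pPart_eq_monomial {n : ℕ} (mu : n.Partition) : pPart mu = monomial (exps mu) 1 :=
  powProd_eq_monomial _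

theorem map_toPNat'_map_coe {s : Multiset ℕ} (hs : ∀ i ∈ s, 0 < i) :
    (s.map Nat.toPNat').map (fun i : ℕ+ => (i : ℕ)) = s := by
  rw [Multiset.map_map]
  conv_rhs => rw [← Multiset.map_id s]
  refine Multiset.map_congr rfl fun i hi => ?_
  simp [Nat.toPNat'_coe, hs i hi]

theorem wt_toFinsupp (s : Multiset ℕ+) :
    wt (Multiset.toFinsupp s) = (s.map fun i : ℕ+ => (i : ℕ)).sum := by
  induction s using Multiset.induction_on with
  | empty => simp
  | cons a s ih =>
    rw [← Multiset.singleton_add, Multiset.toFinsupp_add, map_add, ih]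
    simp [Finsupp.weight_single]

theorem wt_exps {n : ℕ} (mu : n.Partition) : wt (exps mu) = n := by
  rw [exps, wt_toFinsupp, map_toPNat'_map_coe fun i hi => mu.parts_pos hi, mu.parts_sum]

theorem exps_injective (n : ℕ) : Function.Injective (exps : n.Partition → ℕ+ →₀ ℕ) := by
  intro mu nu h
  have h2 := Multiset.toFinsupp.injective h
  ext1
  rw [← map_toPNat'_map_coe fun i hi => mu.parts_pos hi, h2,
    map_toPNat'_map_coe fun i hi => nu.parts_pos hi]

theorem exists_exps_eq {n : ℕ} {d : ℕ+ →₀ ℕ} (hd : wt d = n) : ∃ mu : n.Partition, exps mu = d := by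
  refine ⟨⟨(Finsupp.toMultiset d).map fun i : ℕ+ => (i : ℕ), ?_, ?_⟩, ?_⟩
  · intro i hi
    obtain ⟨k, -, rfl⟩ := Multiset.mem_map.1 hi
    exact k.pos
  · rw [← wt_toFinsupp, Finsupp.toMultiset_toFinsupp, hd]
  · simp only [exps, Multiset.map_map]
    have : (Nat.toPNat' ∘ fun i : ℕ+ => (i : ℕ)) = id := by
      funext i
      simp
    rw [this, Multiset.map_id, Finsupp.toMultiset_toFinsupp]

theorem zee_eq_zFin {n : ℕ} (mu : n.Partition) : zee mu = zFin (exps mu) := by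
  classical
  unfold zee zFin Finsupp.prod
  refine Finset.prod_bij' (fun i _ => i.toPNat') (fun k _ => (k : ℕ)) ?_ ?_ ?_ ?_ ?_
  · intro i hi
    rw [exps, Multiset.toFinsupp_support, Multiset.mem_toFinset]
    exact Multiset.mem_map_of_mem _ (Multiset.mem_toFinset.1 hi)
  · intro k hk
    rw [exps, Multiset.toFinsupp_support, Multiset.mem_toFinset] at hk
    obtain ⟨i, hi, rfl⟩ := Multiset.mem_map.1 hk
    simpa [Nat.toPNat'_coe, mu.parts_pos hi] using hi
  · intro i hi
    have := mu.parts_pos (Multiset.mem_toFinset.1 hi)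
    simp [Nat.toPNat'_coe, this]
  · intro k _
    simp
  · intro i hi
    have h0 := mu.parts_pos (Multiset.mem_toFinset.1 hi)
    have h1 : exps mu i.toPNat' = mu.parts.count i := by
      rw [exps, Multiset.toFinsupp_apply]
      conv_rhs => rw [← map_toPNat'_map_coe fun i hi => mu.parts_pos hi]
      rw [← Multiset.count_map_eq_count' _ _ PNat.coe_injective]
      simp [Nat.toPNat'_coe, h0]
    rw [h1]
    simp [Nat.toPNat'_coe, h0]

theorem zFin_ne_zero (d : ℕ+ →₀ ℕ) : zFin d ≠ 0 := by
  refine Finset.prod_ne_zero_iff.2 fun i _ => mul_ne_zero ?_ (pow_ne_zero _ ?_)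
  · exact_mod_cast Nat.factorial_ne_zero _
  · exact_mod_cast i.ne_zero

theorem zee_ne_zero {n : ℕ} (mu : n.Partition) : zee mu ≠ 0 := by
  rw [zee_eq_zFin]
  exact zFin_ne_zero _

/-- The factor k (d_k + 1) is also the one that `dP k` produces on coefficients. This coincidence
gives both the shift rule for h_m and the adjointness of `dP k` and P_k. -/
theorem zFin_add_single (d : ℕ+ →₀ ℕ) (k : ℕ+) :
    zFin (d + Finsupp.single k 1) = zFin d * ((k : ℂ) * (d k + 1)) := by
  classical
  have key : ∀ e : ℕ+ →₀ ℕ, zFin e = ((e k)! : ℂ) * (k : ℂ) ^ e k * zFin (e.erase k) := by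
    intro e
    unfold zFin
    by_cases hk : k ∈ e.support
    · exact (Finsupp.mul_prod_erase e k _ hk).symm
    · rw [Finsupp.notMem_support_iff] at hk
      rw [Finsupp.erase_of_notMem_support (by simpa using hk), hk]
      simp
  rw [key d, key (d + Finsupp.single k 1)]
  have : (d + Finsupp.single k 1).erase k = d.erase k := by
    ext i
    by_cases h : i = k
    · simp [h]
    · simp [Finsupp.erase_ne h]
  rw [this]
  simp only [Finsupp.coe_add, Pi.add_apply, Finsupp.single_eq_same, Nat.factorial_succ]
  push_cast
  ring

theorem wt_add_single (d : ℕ+ →₀ ℕ) (k : ℕ+) : wt (d + Finsupp.single k 1) = wt d + k := by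
  simp [Finsupp.weight_single]

theorem le_wt {d : ℕ+ →₀ ℕ} {k : ℕ+} (h : d k ≠ 0) : (k : ℕ) ≤ wt d := by
  have hk' : Finsupp.single k 1 ≤ d := by
    rw [Finsupp.single_le_iff]
    omega
  obtain ⟨e, rfl⟩ := exists_add_of_le hk'
  rw [add_comm, wt_add_single]
  omega

theorem wt_eq_zero {d : ℕ+ →₀ ℕ} : wt d = 0 ↔ d = 0 := by
  refine ⟨fun h => ?_, fun h => by simp [h]⟩
  by_contra hd
  obtain ⟨k, hk⟩ := Finsupp.ne_iff.1 hd
  have h1 := le_wt hk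
  have h2 := k.pos
  omega

/-! ### Complete homogeneous symmetric functions -/

/-- Partitions of n correspond to exponent vectors of weight n, so at most one summand contributes
to a given monomial. -/
theorem coeff_hNat (n : ℕ) (d : ℕ+ →₀ ℕ) :
    coeff d (hNat n) = if wt d = n then (zFin d)⁻¹ else 0 := by
  classical
  unfold hNat
  simp only [coeff_sum, coeff_smul, pPart_eq_monomial, coeff_monomial, zee_eq_zFin]
  split_ifs with h
  · obtain ⟨mu, rfl⟩ := exists_exps_eq h
    rw [Finset.sum_eq_single mu]
    · simp
    · intro nu _ hnu
      rw [if_neg fun h' => hnu (exps_injective n h'), smul_zero]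
    · simp
  · refine Finset.sum_eq_zero fun mu _ => ?_
    rw [if_neg, smul_zero]
    rintro rfl
    exact h (wt_exps mu)

theorem coeff_hInt (m : ℤ) (d : ℕ+ →₀ ℕ) :
    coeff d (hInt m) = if (wt d : ℤ) = m then (zFin d)⁻¹ else 0 := by
  unfold hInt
  split_ifs with h1 h2 h2
  · omega
  · simp
  · rw [coeff_hNat, if_pos (by omega)]
  · rw [coeff_hNat, if_neg (by omega)]

theorem hInt_neg {m : ℤ} (h : m < 0) : hInt m = 0 := if_pos h

theorem hInt_zero : hInt 0 = 1 := by
  ext d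
  rw [coeff_hInt, coeff_one]
  by_cases h : 0 = d
  · subst h
    simp [zFin]
  · rw [if_neg h, if_neg]
    rw [Nat.cast_eq_zero, wt_eq_zero]
    exact fun h' => h h'.symm

theorem hInt_one : hInt 1 = X 1 := by
  ext d
  rw [coeff_hInt, coeff_X]
  split_ifs with h1 h2 h2
  · subst h2
    have := zFin_add_single 0 1
    rw [zero_add] at this
    rw [this]
    simp [zFin]
  · exfalso
    apply h2
    have hd : wt d = 1 := by exact_mod_cast h1
    have hd0 : d ≠ 0 := by
      rintro rfl
      simp at hd
    obtain ⟨k, hk⟩ := Finsupp.ne_iff.1 hd0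
    have hk' : Finsupp.single k 1 ≤ d := by
      rw [Finsupp.single_le_iff]
      exact Nat.one_le_iff_ne_zero.2 hk
    obtain ⟨e, rfl⟩ := exists_add_of_le hk'
    rw [add_comm, wt_add_single] at hd
    have hkp := k.pos
    have he : wt e = 0 := by omega
    rw [wt_eq_zero] at he
    have hk1 : k = 1 := by
      rw [← PNat.coe_eq_one_iff]
      omega
    rw [he, hk1, add_zero]
  · exfalso
    subst h2
    simp [Finsupp.weight_single] at h1
  · rfl

/-- The derivation `k ∂/∂P_k`, adjoint to multiplication by `P_k`. -/
def dP (k : ℕ+) : Derivation ℂ Lam Lam := (k : ℂ) • pderiv k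

theorem dP_apply (k : ℕ+) (f : Lam) : dP k f = (k : ℂ) • pderiv k f := rfl

theorem coeff_dP (k : ℕ+) (f : Lam) (d : ℕ+ →₀ ℕ) :
    coeff d (dP k f) = k * (d k + 1) * coeff (d + Finsupp.single k 1) f := by
  rw [dP_apply, coeff_smul, coeff_pderiv, smul_eq_mul]
  ring

theorem dP_X (k j : ℕ+) : dP k (X j) = if j = k then C (k : ℂ) else 0 := by
  rw [dP_apply]
  split_ifs with h
  · subst h
    rw [pderiv_X_self, ← C_mul', mul_one]
  · rw [pderiv_X_of_ne h, smul_zero]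

/-- The derivation multiplies the generating series exp(∑ P_k z^k / k) by z^k; here this is read off
coefficientwise. Setting h_m = 0 for m < 0 removes every side condition. -/
theorem dP_hInt (k : ℕ+) (m : ℤ) : dP k (hInt m) = hInt (m - k) := by
  ext d
  rw [coeff_dP, coeff_hInt, coeff_hInt, wt_add_single, zFin_add_single]
  push_cast
  have h1 : (k : ℂ) ≠ 0 := by exact_mod_cast k.ne_zero
  have h2 : (d k + 1 : ℂ) ≠ 0 := by exact_mod_cast Nat.succ_ne_zero (d k)
  have h3 := zFin_ne_zero d
  split_ifs with h h' h'
  · field_simp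
  · omega
  · omega
  · simp

theorem coeff_X_mul_dP (k : ℕ+) (f : Lam) (d : ℕ+ →₀ ℕ) :
    coeff d (X k * dP k f) = k * d k * coeff d f := by
  classical
  rw [coeff_X_mul']
  split_ifs with h
  · rw [Finsupp.mem_support_iff] at h
    have hk : Finsupp.single k 1 ≤ d := by
      rw [Finsupp.single_le_iff]
      omega
    rw [coeff_dP, tsub_add_cancel_of_le hk]
    have : (d - Finsupp.single k 1 : ℕ+ →₀ ℕ) k = d k - 1 := by simp
    rw [this, Nat.cast_sub (by omega)]
    push_cast
    ring
  · rw [Finsupp.notMem_support_iff] at h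
    simp [h]

theorem sum_Icc_eq_wt {d : ℕ+ →₀ ℕ} {M : ℕ+} (h : wt d ≤ M) :
    ∑ k ∈ Finset.Icc 1 M, (k : ℕ) * d k = wt d := by
  rw [Finsupp.weight_apply, Finsupp.sum]
  symm
  rw [Finset.sum_subset (s₂ := Finset.Icc 1 M)]
  · exact Finset.sum_congr rfl fun k _ => by rw [smul_eq_mul, mul_comm]
  · intro k hk
    rw [Finset.mem_Icc]
    exact ⟨one_le, (le_wt (Finsupp.mem_support_iff.1 hk)).trans h⟩
  · intro k _ hk
    rw [Finsupp.notMem_support_iff.1 hk, zero_smul]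

/-- Since h_{m-k} is `dP k` of h_m, the left side is the Euler operator ∑ P_k k ∂/∂P_k, which
multiplies a homogeneous polynomial by its degree. Terms with k > M are absent because no variable
of degree above m occurs. -/
theorem newton_hInt {M : ℕ+} {m : ℤ} (hm : m ≤ M) :
    ∑ k ∈ Finset.Icc 1 M, X k * hInt (m - (k : ℕ)) = (m : ℂ) • hInt m := by
  ext d
  simp only [← dP_hInt, coeff_sum, coeff_X_mul_dP, coeff_smul, coeff_hInt]
  split_ifs with h
  · rw [← Finset.sum_mul, smul_eq_mul, ← h]
    congr 1
    rw [← sum_Icc_eq_wt (d := d) (M := M) (by omega)]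
    push_cast
    rfl
  · simp

/-- The characteristic is zero, so each nonconstant monomial is detected by the derivation in one of
its variables. The eigenvector property of the cut-and-join operator is reduced to lower degree in
this way. -/
theorem eq_C_of_dP_eq_zero {f : Lam} (h : ∀ k, dP k f = 0) : f = C (coeff 0 f) := by
  ext d
  rw [coeff_C]
  split_ifs with hd
  · rw [hd]
  · obtain ⟨k, hk⟩ := Finsupp.ne_iff.1 (Ne.symm hd)
    have hk' : Finsupp.single k 1 ≤ d := by
      rw [Finsupp.single_le_iff]
      exact Nat.one_le_iff_ne_zero.2 hk
    have h1 := congrArg (coeff (d - Finsupp.single k 1)) (h k)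
    rw [coeff_dP, tsub_add_cancel_of_le hk', coeff_zero] at h1
    rcases mul_eq_zero.1 h1 with h2 | h2
    · exfalso
      rcases mul_eq_zero.1 h2 with h3 | h3
      · exact k.ne_zero (by exact_mod_cast h3)
      · exact Nat.succ_ne_zero ((d - Finsupp.single k 1 : ℕ+ →₀ ℕ) k) (by exact_mod_cast h3)
    · exact h2

end TwistedCL

end

noncomputable section

namespace TwistedCL

open MvPolynomial

/-! ### Derivations of determinants -/

theorem derivation_prod {ι : Type*} [DecidableEq ι] (D : Derivation ℂ Lam Lam) (s : Finset ι)
    (f : ι → Lam) :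
    D (∏ i ∈ s, f i) = ∑ p ∈ s, ∏ i ∈ s, Function.update f p (D (f p)) i := by
  induction s using Finset.induction_on with
  | empty => simp
  | insert a s ha ih =>
    rw [Finset.prod_insert ha, D.leibniz, ih, Finset.sum_insert ha, Finset.prod_insert ha,
      Function.update_self, Finset.prod_update_of_notMem ha, smul_eq_mul, smul_eq_mul, add_comm,
      mul_comm (D (f a)), mul_comm (∏ i ∈ s, f i), Finset.mul_sum]
    congr 1
    refine Finset.sum_congr rfl fun p hp => ?_
    rw [Finset.prod_insert ha, Function.update_of_ne]
    rintro rfl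
    exact ha hp

section Determinants

variable {n : Type*} [Fintype n] [DecidableEq n]

theorem det_updateRow_apply (M : Matrix n n Lam) (p : n) (r : n → Lam) :
    (M.updateRow p r).det = ∑ σ : Equiv.Perm n, Equiv.Perm.sign σ •
      ∏ i, Function.update (fun i => M i (σ i)) p (r (σ p)) i := by
  rw [← Matrix.det_transpose, Matrix.det_apply]
  refine Finset.sum_congr rfl fun σ _ => ?_
  congr 1
  refine Finset.prod_congr rfl fun i _ => ?_
  rw [Matrix.transpose_apply, Matrix.updateRow_apply, Function.update_apply]
  split_ifs with h
  · rw [h]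
  · rfl

theorem derivation_det (D : Derivation ℂ Lam Lam) (M : Matrix n n Lam) :
    D M.det = ∑ p, (M.updateRow p fun j => D (M p j)).det := by
  simp only [det_updateRow_apply]
  rw [Finset.sum_comm, ← Matrix.det_transpose, Matrix.det_apply, map_sum]
  refine Finset.sum_congr rfl fun σ _ => ?_
  rw [← Finset.smul_sum]
  simp only [Units.smul_def]
  rw [map_zsmul]
  congr 1
  simp only [Matrix.transpose_apply]
  exact derivation_prod D Finset.univ fun i => M i (σ i)

/-- Replacing in turn every row of `M` by the corresponding row of `K` has the same effect as
replacing in turn every column. -/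
theorem sum_det_updateRow_eq_sum_det_updateCol (M : Matrix n n Lam) (K : n → n → Lam) :
    ∑ p, (M.updateRow p (K p)).det = ∑ c, (M.updateCol c fun i => K i c).det := by
  have h : ∀ c, (M.updateCol c fun i => K i c).det = (M.transpose.updateRow c fun i => K i c).det :=
    fun c => by rw [← Matrix.det_transpose, Matrix.updateRow_transpose]
  simp only [h, det_updateRow_apply]
  rw [Finset.sum_comm, Finset.sum_comm (s := Finset.univ (α := n))]
  -- The term of σ with row p replaced equals the term of σ⁻¹ with column σ p replaced.
  refine Finset.sum_equiv (Equiv.inv _) (by simp) fun σ _ => ?_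
  rw [← Finset.smul_sum, ← Finset.smul_sum, Equiv.inv_apply, Equiv.Perm.sign_inv]
  congr 1
  refine Finset.sum_equiv σ (by simp) fun p _ => ?_
  refine Finset.prod_equiv σ (by simp) fun i _ => ?_
  rw [Function.update_apply, Function.update_apply]
  simp [Matrix.transpose_apply]

end Determinants

/-! ### Determinants of complete homogeneous symmetric functions -/

/-- `det (h_{l_i + v_j})`. -/
def hDet {N : ℕ} (l v : Fin N → ℤ) : Lam := Matrix.det (Matrix.of fun i j => hInt (l i + v j))

section hDet

variable {N : ℕ}

theorem hDet_comm (l v : Fin N → ℤ) : hDet l v = hDet v l := by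
  unfold hDet
  rw [← Matrix.det_transpose]
  congr 1
  ext1 i j
  simp [add_comm]

theorem hDet_eq_zero_of_eq {l v : Fin N → ℤ} {p q : Fin N} (hpq : p ≠ q) (h : l p = l q) :
    hDet l v = 0 :=
  Matrix.det_zero_of_row_eq hpq (by funext j; simp [h])

theorem hDet_comp_perm (l v : Fin N → ℤ) (σ : Equiv.Perm (Fin N)) :
    hDet (l ∘ σ) v = Equiv.Perm.sign σ • hDet l v := by
  have := Matrix.det_permute σ (Matrix.of fun i j => hInt (l i + v j))
  rw [Units.smul_def, zsmul_eq_mul]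
  exact this

/-- The indices in each term of the expansion add up to the same negative total, so some factor has
a negative index. -/
theorem hDet_eq_zero_of_sum_neg {l v : Fin N → ℤ} (h : ∑ p, l p + ∑ p, v p < 0) :
    hDet l v = 0 := by
  unfold hDet
  rw [Matrix.det_apply]
  refine Finset.sum_eq_zero fun σ _ => ?_
  have h1 : ∃ i, l (σ i) + v i < 0 := by
    by_contra! hc
    have := Finset.sum_nonneg fun i (_ : i ∈ Finset.univ) => hc i
    rw [Finset.sum_add_distrib, Equiv.sum_comp σ l] at this
    omega
  obtain ⟨i, hi⟩ := h1
  rw [Finset.prod_eq_zero (Finset.mem_univ i), smul_zero]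
  exact hInt_neg hi

theorem hDet_eq_zero_of_row {l v : Fin N → ℤ} (p : Fin N) (h : ∀ j, l p + v j < 0) :
    hDet l v = 0 :=
  Matrix.det_eq_zero_of_row_eq_zero p fun j => hInt_neg (h j)

theorem hDet_add_single_left (l v : Fin N → ℤ) (p : Fin N) (s : ℤ) :
    hDet (l + Pi.single p s) v =
      ((Matrix.of fun i j => hInt (l i + v j)).updateRow p fun j => hInt (l p + v j + s)).det := by
  unfold hDet
  congr 1
  ext1 i j
  rw [Matrix.updateRow_apply]
  split_ifs with h
  · subst h
    simp only [Matrix.of_apply, Pi.add_apply, Pi.single_eq_same]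
    congr 1
    ring
  · simp [h]

theorem hDet_add_single_right (l v : Fin N → ℤ) (c : Fin N) (s : ℤ) :
    hDet l (v + Pi.single c s) =
      ((Matrix.of fun i j => hInt (l i + v j)).updateCol c fun i => hInt (l i + v c + s)).det := by
  unfold hDet
  congr 1
  ext1 i j
  rw [Matrix.updateCol_apply]
  split_ifs with h
  · subst h
    simp only [Matrix.of_apply, Pi.add_apply, Pi.single_eq_same]
    congr 1
    ring
  · simp [h]

/-- This trades row shifts for column shifts. The columns are usually 0, 1, …, N-1, where a shifted
column tends to coincide with another one. -/
theorem sum_hDet_add_single (l v : Fin N → ℤ) (s : ℤ) :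
    ∑ p, hDet (l + Pi.single p s) v = ∑ c, hDet l (v + Pi.single c s) := by
  simp only [hDet_add_single_left, hDet_add_single_right]
  exact sum_det_updateRow_eq_sum_det_updateCol _ fun i j => hInt (l i + v j + s)

/-- A derivation that acts on the `h_m` by shifts with coefficients affine in `m` acts
on determinants by row and column shifts. -/
theorem derivation_hDet (D : Derivation ℂ Lam Lam) (l v : Fin N → ℤ) (s : ℤ) (a b : ℂ) (g : Lam)
    (hD : ∀ i j, D (hInt (l i + v j)) =
      (a * (l i + v j) + b) • hInt (l i + v j + s) + g * hInt (l i + v j)) :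
    D (hDet l v) = ∑ p, (a * l p + b) • hDet (l + Pi.single p s) v +
      ∑ c, (a * v c) • hDet l (v + Pi.single c s) + (N : ℂ) • (g * hDet l v) := by
  set M : Matrix (Fin N) (Fin N) Lam := Matrix.of fun i j => hInt (l i + v j) with hM
  have h1 : D (hDet l v) = ∑ p, ((a * l p + b) • (M.updateRow p fun j => hInt (l p + v j + s)).det +
      (M.updateRow p fun j => (a * v j) • hInt (l p + v j + s)).det + g * M.det) := by
    rw [hDet, derivation_det]
    refine Finset.sum_congr rfl fun p _ => ?_
    have : (fun j => D ((Matrix.of fun i j => hInt (l i + v j)) p j)) =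
        ((C (a * l p + b) : Lam) • fun j => hInt (l p + v j + s)) +
        (fun j => (a * v j) • hInt (l p + v j + s)) + g • M p := by
      funext j
      rw [Matrix.of_apply, hD]
      simp only [Pi.add_apply, Pi.smul_apply, smul_eq_mul, C_mul', hM, Matrix.of_apply]
      rw [← add_smul]
      congr 2
      ring
    rw [this, Matrix.det_updateRow_add, Matrix.det_updateRow_add, Matrix.det_updateRow_smul,
      Matrix.det_updateRow_smul, C_mul', Matrix.updateRow_eq_self]
  rw [h1, Finset.sum_add_distrib, Finset.sum_add_distrib]
  congr 1
  · congr 1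
    · exact Finset.sum_congr rfl fun p _ => by rw [hDet_add_single_left]
    · rw [sum_det_updateRow_eq_sum_det_updateCol M
        fun i j => (a * v j : ℂ) • hInt (l i + v j + s)]
      refine Finset.sum_congr rfl fun c _ => ?_
      rw [hDet_add_single_right, ← C_mul', ← Matrix.det_updateCol_smul]
      congr 2
      funext i
      simp only [Pi.smul_apply, smul_eq_mul, C_mul']
  · rw [Finset.sum_const, Finset.card_univ, Fintype.card_fin]
    rw [← Nat.cast_smul_eq_nsmul ℂ, hM]
    rfl

theorem dP_hDet (k : ℕ+) (l v : Fin N → ℤ) :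
    dP k (hDet l v) = ∑ p, hDet (l + Pi.single p (-(k : ℤ))) v := by
  rw [derivation_hDet (dP k) l v (-(k : ℤ)) 0 1 0]
  · simp
  · intro i j
    rw [dP_hInt]
    simp [sub_eq_add_neg]

/-! ### Shifts of consecutive columns -/

/-- The column indices `0, 1, …, N - 1`. -/
def idv (N : ℕ) : Fin N → ℤ := fun c => c

theorem hDet_idv_collision (l : Fin N → ℤ) {v : Fin N → ℤ} (d e : Fin N) (hde : e ≠ d)
    (he : v e = e) (hd : v d = e) : hDet l v = 0 := by
  rw [hDet_comm]
  exact hDet_eq_zero_of_eq hde (he.trans hd.symm)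

theorem hDet_update_update_swap (l w : Fin N → ℤ) {c d : Fin N} (hcd : c ≠ d) (a b : ℤ) :
    hDet l (Function.update (Function.update w c a) d b) =
      -hDet l (Function.update (Function.update w c b) d a) := by
  rw [hDet_comm, hDet_comm l]
  have : Function.update (Function.update w c a) d b =
      Function.update (Function.update w c b) d a ∘ Equiv.swap c d := by
    funext e
    rw [Function.comp_apply]
    rcases eq_or_ne e c with rfl | hc
    · rw [Equiv.swap_apply_left]
      simp [hcd]
    rcases eq_or_ne e d with rfl | hd
    · rw [Equiv.swap_apply_right]
      simp [hcd]
    · rw [Equiv.swap_apply_of_ne_of_ne hc hd]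
      simp [hc, hd]
  rw [this, hDet_comp_perm, Equiv.Perm.sign_swap hcd]
  simp

/-- Write f a b for the determinant with a and b as indices of columns c and d; it is antisymmetric,
and it vanishes when c < b < d because b then repeats an untouched column. In the sum over a + b = c
+ d - k with c - k < a < c, the terms with a < d - k vanish for this reason, those with a > d - k
cancel in pairs, and only a = d - k, b = c survives. -/
theorem sum_hDet_two_columns (l : Fin N → ℤ) {c d : Fin N} (hcd : c < d) (k : ℤ) (hk : 0 < k) :
    ∑ x ∈ Finset.Ioo 0 k, hDet l (idv N + Pi.single c (-x) + Pi.single d (-(k - x))) =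
      -hDet l (idv N + Pi.single d (-k)) := by
  have hne : c ≠ d := hcd.ne
  have hcd' : (c : ℤ) < d := by exact_mod_cast hcd
  set f : ℤ → ℤ → Lam := fun a b =>
    hDet l (Function.update (Function.update (idv N) c a) d b) with hf
  have hswap : ∀ a b, f a b = -f b a := fun a b => hDet_update_update_swap l _ hne a b
  have hzero : ∀ a b, (c : ℤ) < b → b < d → f a b = 0 := by
    intro a b h1 h2
    have hN := d.isLt
    have hb : b = ((⟨b.toNat, by omega⟩ : Fin N) : ℕ) := by simp; omega
    generalize (⟨b.toNat, by omega⟩ : Fin N) = e at hb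
    subst hb
    have hec : e ≠ c := by rintro rfl; omega
    have hed : e ≠ d := by rintro rfl; omega
    refine hDet_idv_collision l d e hed ?_ (by simp)
    simp [hec, hed, idv]
  have h1 : ∀ x : ℤ, idv N + Pi.single c (-x) + Pi.single d (-(k - x)) =
      Function.update (Function.update (idv N) c (c - x)) d (d - (k - x)) := by
    intro x
    funext e
    rcases eq_or_ne e d with rfl | hd
    · simp [idv, hne.symm]; ring
    rcases eq_or_ne e c with rfl | hc
    · simp [idv, hne]; ring
    · simp [hc, hd]
  have h2 : hDet l (idv N + Pi.single d (-k)) = f c (d - k) := by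
    have := h1 0
    rw [hf]
    simp only [neg_zero, Pi.single_zero, add_zero, sub_zero] at this
    rw [this]
  have h3 : ∑ x ∈ Finset.Ioo 0 k, hDet l (idv N + Pi.single c (-x) + Pi.single d (-(k - x))) =
      ∑ a ∈ Finset.Ioo ((c : ℤ) - k) c, f a (c + d - k - a) := by
    refine Finset.sum_bij' (fun x _ => c - x) (fun a _ => c - a) ?_ ?_ ?_ ?_ ?_
    · intro x hx
      rw [Finset.mem_Ioo] at hx ⊢
      omega
    · intro x hx
      rw [Finset.mem_Ioo] at hx ⊢
      omega
    · intro x _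
      ring
    · intro x _
      ring
    · intro x _
      rw [h1, hf]
      congr 2
      ring
  rw [h3, h2]
  -- If c ≤ d - k, every term on the left is a collision, and so is the right side, either with an
  -- intermediate column or between the two columns themselves.
  rcases le_or_gt (c : ℤ) (d - k) with hc | hc
  · rw [Finset.sum_eq_zero]
    · rcases hc.eq_or_lt with h | h
      · have := hswap c c
        rw [← h]
        rw [self_eq_neg] at this
        rw [this, neg_zero]
      · rw [hzero _ _ h (by omega), neg_zero]
    · intro a ha
      rw [Finset.mem_Ioo] at ha
      exact hzero _ _ (by omega) (by omega)
  · have h4 : Finset.Ioo ((c : ℤ) - k) c =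
        Finset.Ioo ((c : ℤ) - k) (d - k) ∪ (insert ((d : ℤ) - k) (Finset.Ioo ((d : ℤ) - k) c)) := by
      ext a
      simp only [Finset.mem_Ioo, Finset.mem_union, Finset.mem_insert]
      omega
    rw [h4, Finset.sum_union, Finset.sum_insert (by simp), Finset.sum_eq_zero, zero_add]
    · have h5 : ∑ a ∈ Finset.Ioo ((d : ℤ) - k) c, f a (c + d - k - a) = 0 := by
        have h6 : ∑ a ∈ Finset.Ioo ((d : ℤ) - k) c, f a (c + d - k - a) =
            ∑ a ∈ Finset.Ioo ((d : ℤ) - k) c, -f a (c + d - k - a) := by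
          refine Finset.sum_bij' (fun a _ => c + d - k - a) (fun a _ => c + d - k - a) ?_ ?_ ?_ ?_ ?_
          · intro x hx
            rw [Finset.mem_Ioo] at hx ⊢
            omega
          · intro x hx
            rw [Finset.mem_Ioo] at hx ⊢
            omega
          · intro x _
            ring
          · intro x _
            ring
          · intro x _
            rw [hswap]
            congr 2
            ring
        rw [Finset.sum_neg_distrib, self_eq_neg] at h6
        exact h6
      rw [h5, add_zero, hswap]
      congr 2
      ring
    · intro a ha
      rw [Finset.mem_Ioo] at ha
      exact hzero _ _ (by omega) (by omega)
    · rw [Finset.disjoint_left]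
      intro a ha
      simp only [Finset.mem_Ioo, Finset.mem_insert] at ha ⊢
      omega

/-- Pairs c = d contribute k - 1 equal terms. By `sum_hDet_two_columns`, a pair of distinct columns
contributes minus the full shift of the larger one, and column c is the larger one in 2c ordered
pairs; hence the coefficient k - 1 - 2c. -/
theorem sum_hDet_idv_pairs (l : Fin N → ℤ) (k : ℤ) (hk : 0 < k) :
    ∑ x ∈ Finset.Ioo 0 k, ∑ c, ∑ d,
      hDet l (idv N + Pi.single c (-x) + Pi.single d (-(k - x))) =
    ∑ c : Fin N, ((k : ℂ) - 1 - 2 * (c : ℂ)) • hDet l (idv N + Pi.single c (-k)) := by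
  set U : Fin N → Lam := fun c => hDet l (idv N + Pi.single c (-k)) with hU
  have hT : ∀ c d : Fin N, ∑ x ∈ Finset.Ioo 0 k,
      hDet l (idv N + Pi.single c (-x) + Pi.single d (-(k - x))) =
      (if c = d then (k - 1 : ℂ) • U c else 0) - (if c < d then U d else 0) -
        (if d < c then U c else 0) := by
    intro c d
    rcases lt_trichotomy c d with h | h | h
    · rw [if_neg h.ne, if_pos h, if_neg h.le.not_gt, sum_hDet_two_columns l h k hk]
      simp [hU]
    · subst h
      simp only [lt_irrefl, if_false, if_true, sub_zero]
      have : ∀ x ∈ Finset.Ioo 0 k, hDet l (idv N + Pi.single c (-x) + Pi.single c (-(k - x))) =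
          U c := by
        intro x _
        rw [add_assoc, ← Pi.single_add, ← neg_add, add_sub_cancel]
      rw [Finset.sum_congr rfl this, Finset.sum_const, Int.card_Ioo, ← Nat.cast_smul_eq_nsmul ℂ]
      congr 1
      have : ((k - 0 - 1).toNat : ℤ) = k - 1 := by omega
      exact_mod_cast congrArg (Int.cast : ℤ → ℂ) this
    · rw [if_neg h.ne', if_neg h.le.not_gt, if_pos h, sub_zero, zero_sub,
        ← sum_hDet_two_columns l h k hk]
      refine Finset.sum_bij' (fun x _ => k - x) (fun x _ => k - x) ?_ ?_ ?_ ?_ ?_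
      · intro x hx
        rw [Finset.mem_Ioo] at hx ⊢
        omega
      · intro x hx
        rw [Finset.mem_Ioo] at hx ⊢
        omega
      · intro x _
        ring
      · intro x _
        ring
      · intro x _
        rw [add_right_comm, sub_sub_cancel]
  rw [Finset.sum_comm]
  have h2 : ∀ c : Fin N, ∑ x ∈ Finset.Ioo 0 k, ∑ d,
      hDet l (idv N + Pi.single c (-x) + Pi.single d (-(k - x))) = ∑ d, (
      (if c = d then (k - 1 : ℂ) • U c else 0) - (if c < d then U d else 0) -
        (if d < c then U c else 0)) := by
    intro c
    rw [Finset.sum_comm]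
    exact Finset.sum_congr rfl fun d _ => hT c d
  rw [Finset.sum_congr rfl fun c _ => h2 c]
  simp only [Finset.sum_sub_distrib]
  rw [Finset.sum_comm (f := fun c d => if c < d then U d else 0)]
  have h3 : ∀ c : Fin N, (∑ d : Fin N, if d < c then U c else 0) = (c : ℂ) • U c := by
    intro c
    rw [← Finset.sum_filter, Finset.sum_const, ← Nat.cast_smul_eq_nsmul ℂ]
    congr 2
    have : (Finset.univ.filter fun d : Fin N => d < c) = Finset.Iio c := by ext; simp
    rw [this, Fin.card_Iio]
  rw [Finset.sum_congr rfl fun c _ => h3 c, ← Finset.sum_sub_distrib, ← Finset.sum_sub_distrib]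
  refine Finset.sum_congr rfl fun c _ => ?_
  rw [Finset.sum_ite_eq, if_pos (Finset.mem_univ _), ← sub_smul, ← sub_smul]
  congr 1
  ring

end hDet

end TwistedCL

end

noncomputable section

namespace TwistedCL

open MvPolynomial

/-! ### The cut-and-join operator -/

theorem dP_comm (i j : ℕ+) (f : Lam) : dP i (dP j f) = dP j (dP i f) := by
  ext d
  simp only [coeff_dP]
  rw [add_right_comm d]
  rcases eq_or_ne i j with rfl | h
  · rfl
  · simp only [Finsupp.add_apply, Finsupp.single_eq_of_ne h, Finsupp.single_eq_of_ne h.symm, add_zero]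
    ring

/-- The cut-and-join operator, truncated to the part that acts on degrees at most `M`. -/
def cutJoin (M : ℕ+) : Lam →ₗ[ℂ] Lam :=
  (1 / 2 : ℂ) • ∑ i ∈ Finset.Icc 1 M, ∑ j ∈ Finset.Icc 1 M,
    (LinearMap.mulLeft ℂ (X i * X j) ∘ₗ (dP (i + j)).toLinearMap +
      LinearMap.mulLeft ℂ (X (i + j)) ∘ₗ (dP i).toLinearMap ∘ₗ (dP j).toLinearMap)

theorem cutJoin_apply (M : ℕ+) (f : Lam) :
    cutJoin M f = (1 / 2 : ℂ) • ∑ i ∈ Finset.Icc 1 M, ∑ j ∈ Finset.Icc 1 M,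
      (X i * X j * dP (i + j) f + X (i + j) * dP i (dP j f)) := by
  simp [cutJoin, mul_assoc]

/-- The commutator collects the terms in which `dP k` differentiates a coefficient. The cut terms
with i = k and with j = k agree, which absorbs the factor 1/2; the join terms leave the pairs with i
+ j = k. -/
theorem dP_cutJoin (M k : ℕ+) (f : Lam) :
    dP k (cutJoin M f) = cutJoin M (dP k f) +
      (if k ≤ M then (k : ℂ) • ∑ j ∈ Finset.Icc 1 M, X j * dP (j + k) f else 0) +
      ((k : ℂ) / 2) • ∑ i ∈ Finset.Icc 1 M, ∑ j ∈ Finset.Icc 1 M,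
        if i + j = k then dP i (dP j f) else 0 := by
  have hmem : k ∈ Finset.Icc 1 M ↔ k ≤ M := by
    rw [Finset.mem_Icc]
    exact ⟨fun h => h.2, fun h => ⟨one_le, h⟩⟩
  have h1 : ∀ i j : ℕ+, dP k (X i * X j * dP (i + j) f + X (i + j) * dP i (dP j f)) =
      (X i * X j * dP (i + j) (dP k f) + X (i + j) * dP i (dP j (dP k f))) +
      ((if j = k then (k : ℂ) • (X i * dP (i + k) f) else 0) +
       (if i = k then (k : ℂ) • (X j * dP (j + k) f) else 0)) +
      (k : ℂ) • (if i + j = k then dP i (dP j f) else 0) := by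
    intro i j
    simp only [map_add, Derivation.leibniz, smul_eq_mul, dP_X, smul_eq_C_mul]
    rw [dP_comm k (i + j), dP_comm k i, dP_comm k j]
    have e1 : (if j = k then (C (k : ℂ) : Lam) else 0) * (X i * dP (i + j) f) =
        if j = k then C (k : ℂ) * (X i * dP (i + k) f) else 0 := by
      split_ifs with h
      · rw [h]
      · rw [zero_mul]
    have e2 : (if i = k then (C (k : ℂ) : Lam) else 0) * (X j * dP (i + j) f) =
        if i = k then C (k : ℂ) * (X j * dP (j + k) f) else 0 := by
      split_ifs with h
      · rw [h, add_comm k]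
      · rw [zero_mul]
    rw [← e1, ← e2, mul_ite, mul_zero]
    split_ifs <;> ring
  rw [cutJoin_apply, cutJoin_apply, Derivation.map_smul]
  rw [map_sum]
  simp only [map_sum (dP k), h1]
  simp only [Finset.sum_add_distrib, Finset.sum_ite_eq', Finset.mem_Icc, smul_add]
  simp only [← Finset.smul_sum, smul_smul]
  have h2 : (∑ x ∈ Finset.Icc 1 M, ∑ x_1 ∈ Finset.Icc 1 M,
      if x = k then (k : ℂ) • (X x_1 * dP (x_1 + k) f) else 0) =
      if k ≤ M then (k : ℂ) • ∑ j ∈ Finset.Icc 1 M, X j * dP (j + k) f else 0 := by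
    rw [Finset.sum_comm]
    simp only [Finset.sum_ite_eq', hmem]
    split_ifs
    · rw [Finset.smul_sum]
    · simp
  have h3 : (∑ x ∈ Finset.Icc 1 M, if 1 ≤ k ∧ k ≤ M then (k : ℂ) • (X x * dP (x + k) f) else 0) =
      if k ≤ M then (k : ℂ) • ∑ j ∈ Finset.Icc 1 M, X j * dP (j + k) f else 0 := by
    simp only [one_le, true_and]
    split_ifs
    · rw [Finset.smul_sum]
    · simp
  rw [h2, h3]
  module

theorem constantCoeff_cutJoin (M : ℕ+) (f : Lam) : coeff 0 (cutJoin M f) = 0 := by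
  rw [cutJoin_apply, coeff_smul, ← constantCoeff_eq]
  simp

theorem sum_smul_derivation_apply {ι : Type*} (s : Finset ι) (a : ι → Lam)
    (D : ι → Derivation ℂ Lam Lam) (f : Lam) :
    (∑ j ∈ s, a j • D j) f = ∑ j ∈ s, a j * D j f := by
  classical
  induction s using Finset.induction_on with
  | empty => simp
  | insert j s hj ih =>
    rw [Finset.sum_insert hj, Finset.sum_insert hj, Derivation.add_apply, ih,
      Derivation.smul_apply, smul_eq_mul]

section hDet

variable {N : ℕ}

/-- `∑ (q(l_p) - q(-p))` with `q(x) = x (x - 1) / 2`: the sum of the contents when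
`l_p = λ_p - p`. -/
def contSum (l : Fin N → ℤ) : ℂ :=
  ∑ p, ((l p : ℂ) * (l p - 1) / 2 - (p : ℂ) * (p + 1) / 2)

theorem sum_add_single {A : Type*} [AddCommGroup A] (g : Fin N → ℤ → A) (l : Fin N → ℤ)
    (p : Fin N) (s : ℤ) :
    ∑ q, g q ((l + Pi.single p s : Fin N → ℤ) q) = ∑ q, g q (l q) + (g p (l p + s) - g p (l p)) := by
  rw [← sub_eq_iff_eq_add', ← Finset.sum_sub_distrib, Finset.sum_eq_single p]
  · simp
  · intro q _ hq
    simp [hq]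
  · simp

theorem contSum_add_single (l : Fin N → ℤ) (p : Fin N) (s : ℤ) :
    contSum (l + Pi.single p s) = contSum l + (s * l p + s * (s - 1) / 2) := by
  unfold contSum
  rw [sum_add_single (fun (q : Fin N) (x : ℤ) => (x : ℂ) * (x - 1) / 2 - (q : ℂ) * (q + 1) / 2)]
  push_cast
  ring

/-- A nonzero constant term forces some term of the expansion to consist of factors h_0 only, so l
is a rearrangement of 0, -1, …, -(N-1); then the two parts of `contSum` cancel. -/
theorem contSum_smul_constantCoeff (l : Fin N → ℤ) :
    contSum l * coeff 0 (hDet l (idv N)) = 0 := by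
  rw [mul_eq_zero, or_iff_not_imp_right]
  intro h
  have h1 : ∃ σ : Equiv.Perm (Fin N), ∀ i, l (σ i) + (i : ℤ) = 0 := by
    by_contra! hc
    apply h
    rw [← constantCoeff_eq, hDet, Matrix.det_apply, map_sum]
    refine Finset.sum_eq_zero fun σ _ => ?_
    obtain ⟨i, hi⟩ := hc σ
    rw [Units.smul_def, map_zsmul, map_prod, Finset.prod_eq_zero (Finset.mem_univ i), smul_zero]
    rw [constantCoeff_eq, Matrix.of_apply, coeff_hInt, if_neg]
    simpa [idv] using Ne.symm hi
  obtain ⟨σ, hσ⟩ := h1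
  unfold contSum
  rw [Finset.sum_sub_distrib, ← Equiv.sum_comp σ, ← Finset.sum_sub_distrib]
  refine Finset.sum_eq_zero fun i _ => ?_
  have : l (σ i) = -(i : ℤ) := by linarith [hσ i]
  rw [this]
  push_cast
  ring

theorem dP_hDet_right (k : ℕ+) (l v : Fin N → ℤ) :
    dP k (hDet l v) = ∑ c, hDet l (v + Pi.single c (-(k : ℤ))) := by
  rw [dP_hDet, sum_hDet_add_single]

theorem dP_dP_hDet_eq_zero {M k : ℕ+} {l : Fin N → ℤ} (hk : M < k)
    (hdeg : ∑ p, l p + ∑ p, idv N p ≤ (M : ℕ)) (i j : ℕ+) (hij : i + j = k) :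
    dP i (dP j (hDet l (idv N))) = 0 := by
  have hk' : (M : ℤ) < (k : ℕ) := by exact_mod_cast hk
  have hij' : ((i : ℕ) : ℤ) + (j : ℕ) = (k : ℕ) := by exact_mod_cast congrArg PNat.val hij
  rw [dP_hDet, map_sum]
  refine Finset.sum_eq_zero fun p _ => ?_
  rw [dP_hDet]
  refine Finset.sum_eq_zero fun q _ => hDet_eq_zero_of_sum_neg ?_
  rw [sum_add_single (fun _ x => x), sum_add_single (fun _ x => x)]
  linarith

/-- The second-order part of the commutator, evaluated with column shifts so that
`sum_hDet_idv_pairs` applies. -/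
theorem sum_dP_dP_hDet {M k : ℕ+} (hk : k ≤ M) (l : Fin N → ℤ) :
    (∑ i ∈ Finset.Icc 1 M, ∑ j ∈ Finset.Icc 1 M,
      if i + j = k then dP i (dP j (hDet l (idv N))) else 0) =
    ∑ c : Fin N, ((k : ℂ) - 1 - 2 * (c : ℂ)) • hDet l (idv N + Pi.single c (-(k : ℤ))) := by
  have hkM : (k : ℕ) ≤ M := hk
  have := sum_hDet_idv_pairs l (k : ℤ) (by exact_mod_cast k.pos)
  push_cast at this
  rw [← this, ← Finset.sum_product', ← Finset.sum_filter]
  refine Finset.sum_bij' (fun x _ => ((x.2 : ℕ) : ℤ))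
    (fun x _ => ((k - x).toNat.toPNat', x.toNat.toPNat')) ?_ ?_ ?_ ?_ ?_
  · rintro ⟨i, j⟩ hij
    simp only [Finset.mem_filter, Finset.mem_product] at hij
    have h1 : (i : ℕ) + j = k := by exact_mod_cast congrArg PNat.val hij.2
    have := i.pos
    have := j.pos
    rw [Finset.mem_Ioo]
    constructor
    · exact_mod_cast j.pos
    · dsimp only
      omega
  · intro x hx
    rw [Finset.mem_Ioo] at hx
    have h1 : 0 < (k - x : ℤ).toNat := by omega
    have h2 : 0 < x.toNat := by omega
    simp only [Finset.mem_filter, Finset.mem_product, Finset.mem_Icc, one_le, true_and,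
      ← PNat.coe_le_coe, ← PNat.coe_inj, PNat.add_coe, Nat.toPNat'_coe, h1, h2, if_true]
    omega
  · rintro ⟨i, j⟩ hij
    simp only [Finset.mem_filter, Finset.mem_product] at hij
    have h1 : (i : ℕ) + j = k := by exact_mod_cast congrArg PNat.val hij.2
    have h2 := i.pos
    ext
    · have : (k - ((j : ℕ) : ℤ)).toNat = i := by omega
      simp [this]
    · simp
  · intro x hx
    rw [Finset.mem_Ioo] at hx
    have h2 : 0 < x.toNat := by omega
    simp only [Nat.toPNat'_coe, h2, if_true]
    omega
  · rintro ⟨i, j⟩ hij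
    simp only [Finset.mem_filter, Finset.mem_product] at hij
    have h1 : ((i : ℕ) : ℤ) + (j : ℕ) = (k : ℕ) := by exact_mod_cast congrArg PNat.val hij.2
    dsimp only
    rw [dP_hDet_right, map_sum]
    refine Finset.sum_congr rfl fun c _ => ?_
    rw [dP_hDet_right]
    refine Finset.sum_congr rfl fun d _ => ?_
    rw [← h1]
    simp

/-- By Newton's identity this derivation sends h_m to (m - k) h_{m-k}. With m = l_i + j the
coefficient splits into l_i - k, constant along the row, and j, constant along the column. The bound
`hl` keeps every index within the truncation. -/
theorem sum_X_mul_dP_hDet {M k : ℕ+} (l : Fin N → ℤ) (hl : ∀ p, l p + N ≤ (M : ℕ)) :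
    ∑ j ∈ Finset.Icc 1 M, X j * dP (j + k) (hDet l (idv N)) =
      ∑ p, ((l p : ℂ) - k) • hDet (l + Pi.single p (-(k : ℤ))) (idv N) +
      ∑ c : Fin N, (c : ℂ) • hDet l (idv N + Pi.single c (-(k : ℤ))) := by
  have h := derivation_hDet (∑ j ∈ Finset.Icc 1 M, (X j : Lam) • dP (j + k)) l (idv N)
    (-(k : ℤ)) 1 (-(k : ℂ)) 0 ?_
  · rw [sum_smul_derivation_apply] at h
    rw [h]
    simp [idv, sub_eq_add_neg]
  · intro i c
    have hlast : l i + idv N c - (k : ℕ) ≤ (M : ℕ) := by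
      have h1 := hl i
      have h2 := c.isLt
      have h3 := k.pos
      simp only [idv]
      omega
    have h4 := newton_hInt hlast
    push_cast at h4
    rw [sum_smul_derivation_apply, zero_mul, add_zero, ← sub_eq_add_neg, one_mul,
      ← sub_eq_add_neg, ← h4]
    refine Finset.sum_congr rfl fun j _ => ?_
    rw [dP_hInt]
    congr 2
    push_cast
    ring

/-- The cut-and-join operator acts on `det (h_{l_i + j})` by the sum of the contents. -/
theorem cutJoin_hDet {M : ℕ+} (l : Fin N → ℤ) (hl : ∀ p, l p + N ≤ (M : ℕ))
    (hdeg : ∑ p, l p + ∑ p, idv N p ≤ (M : ℕ)) :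
    cutJoin M (hDet l (idv N)) = contSum l • hDet l (idv N) := by
  -- The induction bounds the degree and runs over all integer vectors l, since lowering an entry
  -- can destroy strict monotonicity.
  have main : ∀ (n : ℕ) (l : Fin N → ℤ), (∀ p, l p + N ≤ (M : ℕ)) →
      ∑ p, l p + ∑ p, idv N p ≤ (M : ℕ) → ∑ p, l p + ∑ p, idv N p < n →
      cutJoin M (hDet l (idv N)) = contSum l • hDet l (idv N) := by
    intro n
    induction n with
    | zero =>
      intro l _ _ h
      rw [hDet_eq_zero_of_sum_neg (by simpa using h), map_zero, smul_zero]
    | succ n ih =>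
      intro l hl hdeg hn
      have hsum : ∀ (k : ℕ+) (p : Fin N), ∑ q, (l + Pi.single p (-(k : ℤ)) : Fin N → ℤ) q =
          ∑ q, l q - (k : ℕ) := by
        intro k p
        rw [sum_add_single (fun _ x => x)]
        ring
      rw [← sub_eq_zero, eq_C_of_dP_eq_zero (f := _ - _)]
      · rw [coeff_sub, constantCoeff_cutJoin, coeff_smul, smul_eq_mul, contSum_smul_constantCoeff]
        simp
      intro k
      have hk0 := k.pos
      rw [map_sub, dP_cutJoin, Derivation.map_smul, dP_hDet, map_sum, sub_eq_zero]
      have hstep : ∀ p, cutJoin M (hDet (l + Pi.single p (-(k : ℤ))) (idv N)) =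
          contSum (l + Pi.single p (-(k : ℤ))) • hDet (l + Pi.single p (-(k : ℤ))) (idv N) := by
        intro p
        apply ih
        · intro q
          have := hl q
          rcases eq_or_ne q p with rfl | hq
          · simp only [Pi.add_apply, Pi.single_eq_same]
            omega
          · simpa [hq] using this
        · rw [hsum]
          omega
        · rw [hsum]
          omega
      rw [Finset.sum_congr rfl fun p _ => hstep p]
      split_ifs with hk
      · rw [sum_dP_dP_hDet hk, sum_X_mul_dP_hDet l hl]
        have h1 : ∀ p : Fin N, contSum (l + Pi.single p (-(k : ℤ))) •
            hDet (l + Pi.single p (-(k : ℤ))) (idv N) =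
            contSum l • hDet (l + Pi.single p (-(k : ℤ))) (idv N) +
            (-(k : ℂ)) • (((l p : ℂ) - k) • hDet (l + Pi.single p (-(k : ℤ))) (idv N)) +
            (-((k : ℂ) * (k - 1) / 2)) • hDet (l + Pi.single p (-(k : ℤ))) (idv N) := by
          intro p
          rw [contSum_add_single, smul_smul, ← add_smul, ← add_smul]
          congr 1
          push_cast
          ring
        have h2 : ∀ c : Fin N, ((k : ℂ) - 1 - 2 * (c : ℂ)) •
            hDet l (idv N + Pi.single c (-(k : ℤ))) =
            ((k : ℂ) - 1) • hDet l (idv N + Pi.single c (-(k : ℤ))) +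
            (-2 : ℂ) • ((c : ℂ) • hDet l (idv N + Pi.single c (-(k : ℤ)))) := by
          intro c
          rw [smul_smul, ← add_smul]
          congr 1
          ring
        simp only [h1, h2, Finset.sum_add_distrib]
        simp only [← Finset.smul_sum]
        -- The column sums weighted by c have already cancelled in the coefficients. What is left
        -- are unweighted row and column sums with the opposite coefficients ∓k(k-1)/2, and these
        -- sums are equal.
        rw [← sum_hDet_add_single]
        module
      -- For k > M the degree is smaller than k, and everything in sight vanishes.
      · have hz : ∀ p, hDet (l + Pi.single p (-(k : ℤ))) (idv N) = 0 := by
          intro p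
          apply hDet_eq_zero_of_sum_neg
          rw [hsum]
          have : (M : ℤ) < (k : ℕ) := by exact_mod_cast not_le.1 hk
          omega
        rw [Finset.sum_eq_zero (f := fun i => ∑ j ∈ Finset.Icc 1 M, _)]
        · simp [hz]
        · intro i _
          refine Finset.sum_eq_zero fun j _ => ?_
          split_ifs with hij
          · exact dP_dP_hDet_eq_zero (not_le.1 hk) hdeg i j hij
          · rfl
  exact main ((∑ p, l p + ∑ p, idv N p).toNat + 1) l hl hdeg (by omega)

end hDet

end TwistedCL

end

noncomputable section

namespace TwistedCL

open MvPolynomial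

/-! ### Adding and removing boxes -/

section hDet

variable {N : ℕ}

/-- The entry l_N = -N encodes an empty last row of the diagram: in the last row of the matrix all
indices but the corner one are negative. The case s = 0 removes an empty row, and s = 1 gives
Pieri's rule. -/
theorem hDet_of_last {l : Fin (N + 1) → ℤ} (hl : l (Fin.last N) = -(N : ℤ)) (s : ℕ) :
    hDet l (idv (N + 1) + Pi.single (Fin.last N) (s : ℤ)) =
      hInt s * hDet (l ∘ Fin.castSucc) (idv N) := by
  unfold hDet
  rw [Matrix.det_succ_row _ (Fin.last N), Fin.sum_univ_castSucc, Finset.sum_eq_zero, zero_add]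
  · simp only [Matrix.of_apply, hl, Pi.add_apply, Pi.single_eq_same, idv, Fin.val_last]
    rw [← two_mul, pow_mul]
    have : -(N : ℤ) + (N + s) = s := by ring
    rw [this]
    simp only [even_two, Even.neg_pow, one_pow, one_mul]
    congr 2
    ext1 i j
    simp [(Fin.castSucc_lt_last j).ne]
  · intro j _
    rw [Matrix.of_apply, hl, hInt_neg, mul_zero, zero_mul]
    simp [idv, (Fin.castSucc_lt_last j).ne]

theorem hDet_succ {l : Fin (N + 1) → ℤ} (hl : l (Fin.last N) = -(N : ℤ)) :
    hDet l (idv (N + 1)) = hDet (l ∘ Fin.castSucc) (idv N) := by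
  have := hDet_of_last hl 0
  simpa [hInt_zero] using this

theorem hDet_idv_add_castSucc (l : Fin (N + 1) → ℤ) (c : Fin N) :
    hDet l (idv (N + 1) + Pi.single c.castSucc 1) = 0 := by
  refine hDet_idv_collision l c.castSucc c.succ ?_ ?_ ?_
  · exact (Fin.castSucc_lt_succ).ne'
  · simp [idv, (Fin.castSucc_lt_succ (i := c)).ne']
  · simp [idv]

theorem hDet_idv_add_last {l : Fin (N + 1) → ℤ} (hl : l (Fin.last N) = -(N : ℤ)) :
    hDet l (idv (N + 1) + Pi.single (Fin.last N) 1) = X 1 * hDet l (idv (N + 1)) := by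
  have := hDet_of_last hl 1
  rw [hDet_succ hl, ← hInt_one]
  simpa using this

/-- Pieri's rule for multiplication by `P₁`. -/
theorem X_one_mul_hDet {l : Fin (N + 1) → ℤ} (hl : l (Fin.last N) = -(N : ℤ)) :
    X 1 * hDet l (idv (N + 1)) = ∑ p, hDet (l + Pi.single p 1) (idv (N + 1)) := by
  rw [sum_hDet_add_single, Fin.sum_univ_castSucc, hDet_idv_add_last hl, Finset.sum_eq_zero, zero_add]
  exact fun c _ => hDet_idv_add_castSucc l c

/-! ### Derivations that remove and add boxes weighted by contents. -/

/-- The derivation `∑ P_j (j + 1) ∂/∂P_{j+1}`. -/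
def lowerDer (M : ℕ+) : Derivation ℂ Lam Lam :=
  ∑ j ∈ Finset.Icc 1 M, (X j : Lam) • dP (j + 1)

/-- The derivation `∑ P_{j+1} j ∂/∂P_j`. -/
def raiseDer (M : ℕ+) : Derivation ℂ Lam Lam :=
  ∑ j ∈ Finset.Icc 1 M, (X (j + 1) : Lam) • dP j

theorem lowerDer_apply (M : ℕ+) (f : Lam) :
    lowerDer M f = ∑ j ∈ Finset.Icc 1 M, X j * dP (j + 1) f :=
  sum_smul_derivation_apply _ _ _ f

theorem raiseDer_apply (M : ℕ+) (f : Lam) :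
    raiseDer M f = ∑ j ∈ Finset.Icc 1 M, X (j + 1) * dP j f :=
  sum_smul_derivation_apply _ _ _ f

/-- The column terms disappear: column c shifted down by one repeats column c - 1, and column 0 has
weight 0. -/
theorem lowerDer_hDet {M : ℕ+} (l : Fin N → ℤ) (hl : ∀ p, l p + N ≤ (M : ℕ)) :
    lowerDer M (hDet l (idv N)) =
      ∑ p, ((l p : ℂ) - 1) • hDet (l + Pi.single p (-1)) (idv N) := by
  rw [lowerDer_apply, sum_X_mul_dP_hDet l hl]
  simp only [PNat.one_coe, Nat.cast_one]
  rw [add_eq_left]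
  refine Finset.sum_eq_zero fun c _ => ?_
  rcases c with ⟨_ | c, hc⟩
  · simp
  · rw [hDet_idv_collision l ⟨c + 1, hc⟩ ⟨c, by omega⟩, smul_zero]
    · simp
    · simp [idv]
    · simp [idv]

/-- By Newton's identity the derivation sends h_m to (m + 1) h_{m+1} - P_1 h_m. The correction
contributes -(N + 1) P_1 times the determinant; it is cancelled by N P_1 from the last column, the
only column shift without a collision, and by one P_1 from Pieri's rule. -/
theorem raiseDer_hDet {M : ℕ+} {l : Fin (N + 1) → ℤ} (hl : ∀ p, l p + (N + 1) ≤ (M : ℕ))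
    (hlast : l (Fin.last N) = -(N : ℤ)) :
    raiseDer M (hDet l (idv (N + 1))) =
      ∑ p, (l p : ℂ) • hDet (l + Pi.single p 1) (idv (N + 1)) := by
  rw [derivation_hDet (raiseDer M) l _ 1 1 1 (-X 1)]
  · have h1 : ∑ c : Fin (N + 1), ((1 : ℂ) * idv (N + 1) c) •
        hDet l (idv (N + 1) + Pi.single c 1) = (N : ℂ) • (X 1 * hDet l (idv (N + 1))) := by
      rw [Fin.sum_univ_castSucc, hDet_idv_add_last hlast, Finset.sum_eq_zero, zero_add]
      · simp [idv]
      · intro c _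
        rw [hDet_idv_add_castSucc, smul_zero]
    have h2 : ∑ p : Fin (N + 1), ((1 : ℂ) * l p + 1) • hDet (l + Pi.single p 1) (idv (N + 1)) =
        ∑ p, (l p : ℂ) • hDet (l + Pi.single p 1) (idv (N + 1)) +
          X 1 * hDet l (idv (N + 1)) := by
      rw [X_one_mul_hDet hlast, ← Finset.sum_add_distrib]
      refine Finset.sum_congr rfl fun p _ => ?_
      rw [one_mul, add_smul, one_smul]
    rw [h1, h2]
    push_cast
    rw [neg_mul]
    module
  · intro i j
    rw [raiseDer_apply]
    have h1 : l i + idv (N + 1) j + 1 ≤ ((M + 1 : ℕ+) : ℕ) := by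
      have h1 := hl i
      have h2 := j.isLt
      simp only [idv, PNat.add_coe]
      push_cast
      omega
    have h2 := newton_hInt h1
    -- Newton's identity is used up to M + 1; its k = 1 term is P_1 h_m, and the others, reindexed
    -- by k + 1, form the derivation.
    have h3 : Finset.Icc 1 (M + 1) = insert 1 ((Finset.Icc 1 M).image (· + 1)) := by
      ext k
      simp only [Finset.mem_Icc, Finset.mem_insert, Finset.mem_image, one_le, true_and]
      constructor
      · intro h
        rcases eq_or_ne k 1 with rfl | hk
        · exact Or.inl rfl
        · right
          obtain ⟨j, rfl⟩ := PNat.exists_eq_succ_of_ne_one hk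
          exact ⟨j, by simpa using h, rfl⟩
      · rintro (rfl | ⟨j, hj, rfl⟩)
        · exact one_le
        · simpa using hj
    rw [h3, Finset.sum_insert, Finset.sum_image] at h2
    · have h4 : ∀ k ∈ Finset.Icc 1 M, (X (k + 1) : Lam) * dP k (hInt (l i + idv (N + 1) j)) =
          X (k + 1) * hInt (l i + idv (N + 1) j + 1 - ((k + 1 : ℕ+) : ℕ)) := by
        intro k _
        rw [dP_hInt]
        congr 2
        push_cast
        ring
      rw [Finset.sum_congr rfl h4, ← sub_eq_iff_eq_add'.2 h2.symm]
      push_cast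
      rw [add_sub_cancel_right, one_mul, neg_mul, sub_eq_add_neg]
    · intro a _ b _ hab
      exact add_right_cancel hab
    · simp only [Finset.mem_image, not_exists, not_and]
      intro k _ hk
      have h5 := congrArg PNat.val hk
      have h6 := k.pos
      simp only [PNat.add_coe, PNat.val_ofNat] at h5
      omega

/-! ### The index set of Schur functions of a given degree -/

/-- The sequences `l_p = λ_p - p`, `p < N`, for partitions `λ` of `n` with at most `N` parts. -/
def rowSet (N n : ℕ) : Finset (Fin N → ℤ) :=
  open Classical in
  (Fintype.piFinset fun p : Fin N => Finset.Icc (-(p : ℤ)) n).filter fun l =>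
    StrictAnti l ∧ ∑ p, l p + ∑ p, idv N p = n

/-- The upper bound n in the definition only serves finiteness; it follows from the sum of the row
lengths. -/
theorem mem_rowSet {n : ℕ} {l : Fin N → ℤ} : l ∈ rowSet N n ↔
    StrictAnti l ∧ (∀ p : Fin N, -((p : ℕ) : ℤ) ≤ l p) ∧ ∑ p, l p + ∑ p, idv N p = n := by
  unfold rowSet
  simp only [Finset.mem_filter, Fintype.mem_piFinset, Finset.mem_Icc]
  constructor
  · rintro ⟨h1, h2, h3⟩
    exact ⟨h2, fun p => (h1 p).1, h3⟩
  · rintro ⟨h1, h2, h3⟩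
    refine ⟨fun p => ⟨h2 p, ?_⟩, h1, h3⟩
    rw [← Finset.sum_add_distrib] at h3
    have := Finset.single_le_sum (f := fun p : Fin N => l p + idv N p) (s := Finset.univ)
      (fun q _ => by have := h2 q; simp only [idv]; omega) (Finset.mem_univ p)
    rw [h3] at this
    simp only [idv] at this
    omega

theorem le_of_mem_rowSet {n : ℕ} {l : Fin N → ℤ} (h : l ∈ rowSet N n) (p : Fin N) : l p ≤ n := by
  unfold rowSet at h
  simp only [Finset.mem_filter, Fintype.mem_piFinset, Finset.mem_Icc] at h
  exact (h.1 p).2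

/-- Otherwise all N + 1 row lengths would be positive, with sum above n. One spare empty row is what
Pieri's rule for `hDet` requires. -/
theorem last_of_mem_rowSet {n : ℕ} {l : Fin (N + 1) → ℤ} (h : l ∈ rowSet (N + 1) n) (hn : n ≤ N) :
    l (Fin.last N) = -(N : ℤ) := by
  obtain ⟨h1, h2, h3⟩ := mem_rowSet.1 h
  by_contra hc
  have h4 : -(N : ℤ) < l (Fin.last N) := lt_of_le_of_ne (by simpa using h2 (Fin.last N)) (Ne.symm hc)
  have h5 : ∀ p : Fin (N + 1), 1 ≤ l p + idv (N + 1) p := by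
    intro p
    induction p using Fin.reverseInduction with
    | last => simp only [idv, Fin.val_last]; omega
    | cast i ih =>
      have := h1 (Fin.castSucc_lt_succ (i := i))
      simp only [idv, Fin.val_succ, Fin.val_castSucc] at ih ⊢
      push_cast at ih
      omega
  have h6 := Finset.sum_le_sum fun p (_ : p ∈ Finset.univ) => h5 p
  rw [Finset.sum_add_distrib, h3] at h6
  simp at h6
  omega

/-- A unit step in one entry of a strictly decreasing integer sequence can break the order only by
making two entries equal, and then two rows of the determinant agree. -/
theorem strictAnti_add_single {l : Fin N → ℤ} (hl : StrictAnti l) {p : Fin N} {s : ℤ}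
    (hs : s = 1 ∨ s = -1) (h : hDet (l + Pi.single p s) (idv N) ≠ 0) :
    StrictAnti (l + Pi.single p s) := by
  intro a b hab
  have h1 := hl hab
  have h2 : (l + Pi.single p s : Fin N → ℤ) a ≠ (l + Pi.single p s : Fin N → ℤ) b := fun hc =>
    h (hDet_eq_zero_of_eq hab.ne hc)
  simp only [Pi.add_apply, Pi.single_apply] at h2 ⊢
  have hne := hab.ne
  split_ifs at h2 ⊢ with h3 h4 h4
  · exact absurd (h4.trans h3.symm) hne
  all_goals omega

theorem sum_add_single_id (l : Fin N → ℤ) (p : Fin N) (s : ℤ) :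
    ∑ q, (l + Pi.single p s : Fin N → ℤ) q = ∑ q, l q + s := by
  rw [sum_add_single (fun _ x => x)]
  ring

theorem add_single_mem_rowSet {n : ℕ} {l : Fin N → ℤ} (hl : l ∈ rowSet N n) {p : Fin N}
    (h : hDet (l + Pi.single p 1) (idv N) ≠ 0) : l + Pi.single p 1 ∈ rowSet N (n + 1) := by
  obtain ⟨h1, h2, h3⟩ := mem_rowSet.1 hl
  refine mem_rowSet.2 ⟨strictAnti_add_single h1 (Or.inl rfl) h, fun q => ?_, ?_⟩
  · have := h2 q
    simp only [Pi.add_apply, Pi.single_apply]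
    split_ifs <;> omega
  · rw [sum_add_single_id]
    push_cast
    omega

theorem sub_single_mem_rowSet {n : ℕ} {l : Fin N → ℤ} (hl : l ∈ rowSet N (n + 1)) {p : Fin N}
    (h : hDet (l + Pi.single p (-1)) (idv N) ≠ 0) : l + Pi.single p (-1) ∈ rowSet N n := by
  obtain ⟨h1, h2, h3⟩ := mem_rowSet.1 hl
  have h4 := strictAnti_add_single h1 (Or.inr rfl) h
  refine mem_rowSet.2 ⟨h4, fun q => ?_, ?_⟩
  · by_contra! hc
    have hqp : q = p := by
      by_contra hqp
      have := h2 q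
      simp [hqp] at hc
      omega
    subst hqp
    obtain ⟨N, rfl⟩ : ∃ N', N = N' + 1 := ⟨N - 1, by have := q.isLt; omega⟩
    rcases Fin.eq_castSucc_or_eq_last q with ⟨i, rfl⟩ | rfl
    · have h5 := h4 (Fin.castSucc_lt_succ (i := i))
      have h6 := h2 i.succ
      simp [(Fin.castSucc_lt_succ (i := i)).ne'] at h5 hc h6
      omega
    -- Removing a box from an empty last row makes all indices in that row negative.
    · refine h (hDet_eq_zero_of_row (Fin.last N) fun j => ?_)
      have := j.isLt
      simp only [Fin.val_last] at hc
      simp only [idv]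
      omega
  · rw [sum_add_single_id]
    push_cast at h3
    omega

/-- Removing a box from a diagram of size n + 1 and adding one to a diagram of size n are the same
pairs of diagrams. Moves that do not lead to a diagram have a vanishing determinant, so `h1` and
`h2` discard them. -/
theorem sum_rowSet_reindex {A : Type*} [AddCommMonoid A] (n : ℕ)
    (F : (Fin N → ℤ) → (Fin N → ℤ) → Fin N → A)
    (h1 : ∀ a b p, hDet a (idv N) = 0 → F a b p = 0)
    (h2 : ∀ a b p, hDet b (idv N) = 0 → F a b p = 0) :
    ∑ l ∈ rowSet N (n + 1), ∑ p, F (l + Pi.single p (-1)) l p =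
      ∑ l ∈ rowSet N n, ∑ p, F l (l + Pi.single p 1) p := by
  have hc1 : ∀ (l : Fin N → ℤ) (p : Fin N), l + Pi.single p (-1) + Pi.single p 1 = l := by
    intro l p
    rw [add_assoc, ← Pi.single_add]
    simp
  have hc2 : ∀ (l : Fin N → ℤ) (p : Fin N), l + Pi.single p 1 + Pi.single p (-1) = l := by
    intro l p
    rw [add_assoc, ← Pi.single_add]
    simp
  rw [← Finset.sum_product', ← Finset.sum_product']
  refine Finset.sum_bij_ne_zero (fun x _ _ => (x.1 + Pi.single x.2 (-1), x.2)) ?_ ?_ ?_ ?_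
  · rintro ⟨l, p⟩ hx hF
    rw [Finset.mem_product] at hx ⊢
    exact ⟨sub_single_mem_rowSet hx.1 fun h => hF (h1 _ _ _ h), Finset.mem_univ _⟩
  · rintro ⟨l, p⟩ _ _ ⟨m, q⟩ _ _ h
    simp only [Prod.mk.injEq] at h
    obtain ⟨h, rfl⟩ := h
    rw [add_right_cancel h]
  · rintro ⟨l, p⟩ hx hF
    rw [Finset.mem_product] at hx
    refine ⟨(l + Pi.single p 1, p), ?_, ?_, ?_⟩
    · rw [Finset.mem_product]
      exact ⟨add_single_mem_rowSet hx.1 fun h => hF (h2 _ _ _ h), Finset.mem_univ _⟩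
    · dsimp only
      rw [hc2]
      exact hF
    · rw [hc2]
  · rintro ⟨l, p⟩ _ _
    dsimp only
    rw [hc1]

end hDet

/-! ### The Hall pairing and completeness of the Schur functions -/

/-- The Hall pairing `⟨P_λ, P_μ⟩ = Z_λ δ_{λμ}`. -/
def hall : Lam →ₗ[ℂ] Lam →ₗ[ℂ] ℂ :=
  ((basisMonomials ℕ+ ℂ).constr ℂ).toLinearMap ∘ₗ
    LinearMap.pi fun d => zFin d • lcoeff ℂ d

theorem hall_monomial (f : Lam) (d : ℕ+ →₀ ℕ) : hall f (monomial d 1) = zFin d * coeff d f := by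
  have := (basisMonomials ℕ+ ℂ).constr_basis ℂ (fun d => zFin d * coeff d f) d
  rw [coe_basisMonomials] at this
  exact this

theorem lam_ext {A : Type*} [AddCommMonoid A] [Module ℂ A] {F G : Lam →ₗ[ℂ] A}
    (h : ∀ d, F (monomial d 1) = G (monomial d 1)) : F = G :=
  (basisMonomials ℕ+ ℂ).ext fun d => by rw [coe_basisMonomials]; exact h d

theorem hall_X_mul (k : ℕ+) (f g : Lam) : hall f (X k * g) = hall (dP k f) g := by
  have : hall f ∘ₗ LinearMap.mulLeft ℂ (X k) = hall (dP k f) := by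
    refine lam_ext fun d => ?_
    rw [LinearMap.comp_apply, LinearMap.mulLeft_apply, X, monomial_mul, one_mul, add_comm,
      hall_monomial, hall_monomial, zFin_add_single, coeff_dP]
    ring
  exact LinearMap.congr_fun this g

theorem hall_dP (k : ℕ+) (f g : Lam) : hall f (dP k g) = hall (X k * f) g := by
  have : hall f ∘ₗ (dP k).toLinearMap = hall (X k * f) := by
    refine lam_ext fun d => ?_
    rw [LinearMap.comp_apply, hall_monomial]
    have h0 : (dP k).toLinearMap (monomial d 1) =
        ((k : ℂ) * d k) • monomial (d - Finsupp.single k 1) (1 : ℂ) := by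
      change dP k (monomial d 1) = _
      rw [dP_apply, pderiv_monomial, smul_monomial, smul_monomial]
      simp
    rw [h0, map_smul, hall_monomial, smul_eq_mul]
    by_cases hd : d k = 0
    · rw [coeff_X_mul', if_neg (by simpa using hd), hd]
      simp
    · have hk : Finsupp.single k 1 ≤ d := by
        rw [Finsupp.single_le_iff]
        omega
      obtain ⟨e, rfl⟩ := exists_add_of_le hk
      rw [add_comm (Finsupp.single k 1) e, add_tsub_cancel_right, add_comm e, coeff_X_mul,
        add_comm _ e, zFin_add_single]
      simp
      ring
  exact LinearMap.congr_fun this g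

theorem hall_raiseDer (M : ℕ+) (f g : Lam) : hall f (raiseDer M g) = hall (lowerDer M f) g := by
  rw [raiseDer_apply, lowerDer_apply, map_sum, map_sum, LinearMap.sum_apply]
  refine Finset.sum_congr rfl fun j _ => ?_
  rw [hall_X_mul, hall_dP]

section Completeness

variable {N : ℕ}

/-- `f ↦ ∑ ⟨S_λ, f⟩ S_λ`, the sum over the partitions `λ` of `n`. -/
def schurSum (N n : ℕ) : Lam →ₗ[ℂ] Lam :=
  ∑ l ∈ rowSet N n, (hall (hDet l (idv N))).smulRight (hDet l (idv N))

theorem schurSum_apply (n : ℕ) (f : Lam) :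
    schurSum N n f = ∑ l ∈ rowSet N n, hall (hDet l (idv N)) f • hDet l (idv N) := by
  simp [schurSum]

/-- On the left P_1 is moved across the Hall pairing and removes a box; on the right Pieri's rule
adds one. Both are the same sum over pairs of diagrams differing by one box. -/
theorem schurSum_X_one_mul {n : ℕ} (hn : n ≤ N) (f : Lam) :
    schurSum (N + 1) (n + 1) (X 1 * f) = X 1 * schurSum (N + 1) n f := by
  rw [schurSum_apply, schurSum_apply, Finset.mul_sum]
  have h1 : ∀ l ∈ rowSet (N + 1) (n + 1),
      hall (hDet l (idv (N + 1))) (X 1 * f) • hDet l (idv (N + 1)) =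
      ∑ p, hall (hDet (l + Pi.single p (-1)) (idv (N + 1))) f • hDet l (idv (N + 1)) := by
    intro l _
    rw [hall_X_mul, dP_hDet, map_sum, LinearMap.sum_apply, Finset.sum_smul]
    rfl
  have h2 : ∀ l ∈ rowSet (N + 1) n,
      X 1 * hall (hDet l (idv (N + 1))) f • hDet l (idv (N + 1)) =
      ∑ p, hall (hDet l (idv (N + 1))) f • hDet (l + Pi.single p 1) (idv (N + 1)) := by
    intro l hl
    rw [mul_smul_comm, X_one_mul_hDet (last_of_mem_rowSet hl hn), Finset.smul_sum]
  rw [Finset.sum_congr rfl h1, Finset.sum_congr rfl h2]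
  refine sum_rowSet_reindex n
    (fun a b _ => hall (hDet a (idv (N + 1))) f • hDet b (idv (N + 1))) ?_ ?_
  · intro a b p h
    simp [h]
  · intro a b p h
    simp [h]

/-- The argument for P_1 with weights: adding a box to row p of l has weight l_p, and removing it
again has weight (l_p + 1) - 1, the same content. -/
theorem schurSum_raiseDer {M : ℕ+} (hM : 2 * N + 2 ≤ (M : ℕ)) {n : ℕ} (hn : n ≤ N) (f : Lam) :
    schurSum (N + 1) (n + 1) (raiseDer M f) = raiseDer M (schurSum (N + 1) n f) := by
  rw [schurSum_apply, schurSum_apply, map_sum]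
  have h1 : ∀ l ∈ rowSet (N + 1) (n + 1),
      hall (hDet l (idv (N + 1))) (raiseDer M f) • hDet l (idv (N + 1)) =
      ∑ p, ((((l + Pi.single p (-1) : Fin (N + 1) → ℤ) p : ℤ) : ℂ) *
        hall (hDet (l + Pi.single p (-1)) (idv (N + 1))) f) • hDet l (idv (N + 1)) := by
    intro l hl
    rw [hall_raiseDer, lowerDer_hDet, map_sum, LinearMap.sum_apply, Finset.sum_smul]
    · refine Finset.sum_congr rfl fun p _ => ?_
      simp [sub_eq_add_neg]
    · intro p
      have := le_of_mem_rowSet hl p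
      push_cast at this ⊢
      omega
  have h2 : ∀ l ∈ rowSet (N + 1) n,
      raiseDer M (hall (hDet l (idv (N + 1))) f • hDet l (idv (N + 1))) =
      ∑ p, ((l p : ℂ) * hall (hDet l (idv (N + 1))) f) •
        hDet (l + Pi.single p 1) (idv (N + 1)) := by
    intro l hl
    rw [Derivation.map_smul, raiseDer_hDet _ (last_of_mem_rowSet hl hn), Finset.smul_sum]
    · refine Finset.sum_congr rfl fun p _ => ?_
      rw [smul_smul, mul_comm]
    · intro p
      have := le_of_mem_rowSet hl p
      omega
  rw [Finset.sum_congr rfl h1, Finset.sum_congr rfl h2]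
  refine sum_rowSet_reindex n
    (fun a b p => ((a p : ℂ) * hall (hDet a (idv (N + 1))) f) • hDet b (idv (N + 1))) ?_ ?_
  · intro a b p h
    simp [h]
  · intro a b p h
    simp [h]

theorem raiseDer_X {M k : ℕ+} (hk : k ≤ M) : raiseDer M (X k) = (k : ℂ) • X (k + 1) := by
  rw [raiseDer_apply, Finset.sum_eq_single k]
  · rw [dP_X, if_pos rfl, mul_comm, C_mul']
  · intro j _ hj
    rw [dP_X, if_neg hj.symm, mul_zero]
  · intro h
    exact absurd (Finset.mem_Icc.2 ⟨one_le, hk⟩) h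

theorem schurSum_X_mul {M : ℕ+} (hM : 2 * N + 2 ≤ (M : ℕ)) (k : ℕ+) :
    ∀ {n : ℕ}, n + k ≤ N + 1 → ∀ f : Lam,
      schurSum (N + 1) (n + k) (X k * f) = X k * schurSum (N + 1) n f := by
  induction k using PNat.recOn with
  | one =>
    intro n hn f
    simp only [PNat.one_coe] at hn ⊢
    exact schurSum_X_one_mul (by omega) f
  | succ k ih =>
    intro n hn f
    rw [PNat.add_coe, PNat.one_coe] at hn ⊢
    have hk : k ≤ M := by
      rw [← PNat.coe_le_coe]
      omega
    have hk0 : (k : ℂ) ≠ 0 := by exact_mod_cast k.ne_zero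
    -- Multiplication by k P_{k+1} is the commutator of the raising derivation with multiplication
    -- by P_k.
    have key : ∀ g : Lam, (k : ℂ) • (X (k + 1) * g) =
        raiseDer M (X k * g) - X k * raiseDer M g := by
      intro g
      rw [Derivation.leibniz, raiseDer_X hk]
      simp only [smul_eq_mul]
      rw [add_sub_cancel_left, mul_smul_comm, mul_comm]
    have h1 := key (schurSum (N + 1) n f)
    have h2 := congrArg (schurSum (N + 1) (n + (k + 1))) (key f)
    rw [map_smul, map_sub, ← add_assoc, schurSum_raiseDer hM (by omega), ih (by omega),
      add_right_comm, ih (by omega), schurSum_raiseDer hM (by omega), ← h1] at h2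
    rw [← add_assoc, add_right_comm]
    exact smul_right_injective _ hk0 h2

theorem idv_neg_mem : (-idv N) ∈ rowSet N 0 := by
  refine mem_rowSet.2 ⟨fun a b hab => ?_, fun p => ?_, ?_⟩
  · have : (a : ℕ) < b := hab
    simp only [idv, Pi.neg_apply]
    omega
  · simp [idv]
  · simp

theorem rowSet_zero : rowSet N 0 = {-idv N} := by
  ext l
  rw [Finset.mem_singleton]
  constructor
  · intro h
    obtain ⟨h1, h2, h3⟩ := mem_rowSet.1 h
    rw [← Finset.sum_add_distrib, Nat.cast_zero, Finset.sum_eq_zero_iff_of_nonneg] at h3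
    · funext p
      have := h3 p (Finset.mem_univ p)
      rw [Pi.neg_apply]
      omega
    · intro p _
      have := h2 p
      simp only [idv]
      omega
  · rintro rfl
    exact idv_neg_mem

theorem hDet_neg_idv : hDet (-idv N) (idv N) = 1 := by
  induction N with
  | zero => simp [hDet]
  | succ N ih =>
    rw [hDet_succ (by simp [idv])]
    rw [← ih]
    congr 1

/-- Completeness of the Schur functions of degree `n` with respect to the Hall pairing. -/
theorem schurSum_monomial (N : ℕ) {n : ℕ} (hn : n ≤ N) {d : ℕ+ →₀ ℕ} (hd : wt d = n) :
    schurSum (N + 1) n (monomial d 1) = monomial d 1 := by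
  induction n using Nat.strong_induction_on generalizing d with
  | _ n ih =>
    by_cases hd0 : d = 0
    · subst hd0
      obtain rfl : n = 0 := by simpa using hd.symm
      have h1 := hall_monomial 1 0
      rw [monomial_zero', C_1] at h1 ⊢
      rw [schurSum_apply, rowSet_zero, Finset.sum_singleton, hDet_neg_idv, h1]
      simp [zFin]
    · obtain ⟨k, hk⟩ := Finsupp.ne_iff.1 hd0
      have hk' : Finsupp.single k 1 ≤ d := by
        rw [Finsupp.single_le_iff]
        exact Nat.one_le_iff_ne_zero.2 hk
      obtain ⟨e, rfl⟩ := exists_add_of_le hk'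
      rw [add_comm, wt_add_single] at hd
      have hk0 := k.pos
      have h1 := ih (wt e) (by omega) (by omega) rfl
      have h2 : (monomial (Finsupp.single k 1 + e) 1 : Lam) = X k * monomial e 1 := by
        rw [X, monomial_mul, one_mul]
      subst hd
      -- Entries of l are at most N + 1 here and there are N + 1 rows, so truncation at 2N + 2 loses
      -- nothing.
      rw [h2, schurSum_X_mul (M := ⟨2 * N + 2, by omega⟩) (by simp) k (by omega), h1]

end Completeness

end TwistedCL

end

noncomputable section

namespace TwistedCL

open MvPolynomial

/-! ### Partitions as row sequences -/

section Rows

variable {n : ℕ}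

/-- The sequence `l_p = λ_p - p`, `p < N`. -/
def toRows (N : ℕ) (lam : n.Partition) : Fin N → ℤ := fun p => ((rows lam).getD p 0 : ℤ) - p

theorem mem_rows {lam : n.Partition} {i : ℕ} : i ∈ rows lam ↔ i ∈ lam.parts :=
  Multiset.mem_sort _

theorem rows_sorted (lam : n.Partition) : (rows lam).SortedGE :=
  (Multiset.pairwise_sort lam.parts (· ≥ ·)).sortedGE

theorem rows_sum (lam : n.Partition) : (rows lam).sum = n := by
  rw [← Multiset.sum_coe, rows, Multiset.sort_eq, lam.parts_sum]

theorem rows_length_le (lam : n.Partition) : (rows lam).length ≤ n := by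
  conv_rhs => rw [← rows_sum lam]
  exact List.length_le_sum_of_one_le _ fun i hi => lam.parts_pos (mem_rows.1 hi)

theorem sum_getD_eq_sum (w : List ℕ) {N : ℕ} (h : w.length ≤ N) :
    ∑ p : Fin N, w.getD p 0 = w.sum := by
  rw [Fin.sum_univ_eq_sum_range (fun p => w.getD p 0)]
  induction w generalizing N with
  | nil => simp
  | cons a w ih =>
    obtain ⟨N, rfl⟩ : ∃ N', N = N' + 1 := ⟨N - 1, by simp at h; omega⟩
    rw [Finset.sum_range_succ', List.sum_cons, ← ih (by simpa using h), add_comm]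
    simp

theorem getD_antitone {w : List ℕ} (hw : w.SortedGE) : Antitone fun p => w.getD p 0 := by
  intro a b hab
  dsimp only
  rcases lt_or_ge b w.length with hb | hb
  · rw [List.getD_eq_getElem _ _ hb, List.getD_eq_getElem _ _ (hab.trans_lt hb)]
    exact hw.getElem_ge_getElem_of_le hab
  · rw [List.getD_eq_default _ _ hb]
    exact Nat.zero_le _

theorem toRows_mem_rowSet {N : ℕ} (lam : n.Partition) (h : (rows lam).length ≤ N) :
    toRows N lam ∈ rowSet N n := by
  refine mem_rowSet.2 ⟨fun a b hab => ?_, fun p => ?_, ?_⟩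
  · have h1 := getD_antitone (rows_sorted lam) (Fin.le_def.1 hab.le)
    have h2 := Fin.lt_def.1 hab
    simp only [toRows]
    dsimp only at h1
    omega
  · simp [toRows]
  · rw [← Finset.sum_add_distrib]
    simp only [toRows, idv, sub_add_cancel]
    exact_mod_cast (sum_getD_eq_sum _ h).trans (rows_sum lam)

/-- With positive entries the length is visible in the zero-padded sequence, as the place of its
first zero. -/
theorem rows_eq_of_getD {w w' : List ℕ} (hw : ∀ i ∈ w, 0 < i) (hw' : ∀ i ∈ w', 0 < i)
    (h : ∀ p, w.getD p 0 = w'.getD p 0) : w = w' := by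
  have key : ∀ {u : List ℕ}, (∀ i ∈ u, 0 < i) → ∀ p, p < u.length ↔ 0 < u.getD p 0 := by
    intro u hu p
    constructor
    · intro hp
      rw [List.getD_eq_getElem _ _ hp]
      exact hu _ (List.getElem_mem hp)
    · intro hp
      by_contra hc
      rw [List.getD_eq_default _ _ (not_lt.1 hc)] at hp
      exact lt_irrefl _ hp
  have hlen : w.length = w'.length :=
    Nat.le_antisymm
      (le_of_not_gt fun hc => lt_irrefl _ ((key hw' _).2 (h _ ▸ (key hw _).1 hc)))
      (le_of_not_gt fun hc => lt_irrefl _ ((key hw _).2 (h _ ▸ (key hw' _).1 hc)))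
  refine List.ext_getElem hlen fun p h1 h2 => ?_
  have := h p
  rwa [List.getD_eq_getElem _ _ h1, List.getD_eq_getElem _ _ h2] at this

theorem toRows_injective {N : ℕ} (hN : n ≤ N) :
    Function.Injective (toRows N : n.Partition → Fin N → ℤ) := by
  intro lam mu h
  ext1
  rw [← Multiset.sort_eq lam.parts (· ≥ ·), ← Multiset.sort_eq mu.parts (· ≥ ·)]
  congr 1
  refine rows_eq_of_getD (fun i hi => lam.parts_pos (mem_rows.1 hi))
    (fun i hi => mu.parts_pos (mem_rows.1 hi)) fun p => ?_
  rcases lt_or_ge p N with hp | hp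
  · have := congrFun h ⟨p, hp⟩
    simp only [toRows] at this
    have h2 : (((rows lam).getD p 0 : ℕ) : ℤ) = ((rows mu).getD p 0 : ℕ) := by linarith
    exact_mod_cast h2
  · have h1 := rows_length_le lam
    have h2 := rows_length_le mu
    change (rows lam).getD p 0 = (rows mu).getD p 0
    rw [List.getD_eq_default _ _ (by omega), List.getD_eq_default _ _ (by omega)]

theorem exists_toRows_eq {N : ℕ} {l : Fin N → ℤ} (hl : l ∈ rowSet N n) :
    ∃ lam : n.Partition, toRows N lam = l ∧ (rows lam).length ≤ N := by
  obtain ⟨h1, h2, h3⟩ := mem_rowSet.1 hl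
  set a : ℕ → ℕ := fun p => if h : p < N then (l ⟨p, h⟩ + p).toNat else 0 with ha
  have haF : ∀ p : Fin N, ((a p : ℕ) : ℤ) = l p + p := by
    intro p
    have := h2 p
    simp only [ha, p.isLt, dite_true, Fin.eta]
    omega
  have ha0 : ∀ p, N ≤ p → a p = 0 := fun p hp => dif_neg (not_lt.2 hp)
  have hanti : Antitone a := by
    refine antitone_nat_of_succ_le fun p => ?_
    rcases lt_or_ge (p + 1) N with hp | hp
    · have e1 := haF ⟨p, by omega⟩
      have e2 := haF ⟨p + 1, hp⟩
      have e3 : l ⟨p + 1, hp⟩ < l ⟨p, by omega⟩ := h1 (by simp [Fin.lt_def])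
      dsimp only at e1 e2
      push_cast at e2
      omega
    · rw [ha0 _ hp]
      exact Nat.zero_le _
  -- The partition is obtained as the list of row lengths of an explicit Young diagram, which is
  -- already sorted and positive.
  let mu : YoungDiagram :=
    { cells := (Finset.range N).sigma (fun p => Finset.range (a p)) |>.map
        (Equiv.sigmaEquivProd ℕ ℕ).toEmbedding
      isLowerSet := by
        rintro ⟨i, j⟩ ⟨i', j'⟩ hle hij
        rw [Prod.mk_le_mk] at hle
        simp only [Finset.coe_map, Set.mem_image, Finset.mem_coe, Finset.mem_sigma,
          Finset.mem_range] at hij ⊢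
        obtain ⟨⟨x, y⟩, ⟨hx, hy⟩, hxy⟩ := hij
        simp only [Equiv.coe_toEmbedding, Equiv.sigmaEquivProd_apply, Prod.mk.injEq] at hxy hx hy
        obtain ⟨rfl, rfl⟩ := hxy
        exact ⟨⟨i', j'⟩, ⟨lt_of_le_of_lt hle.1 hx,
          lt_of_le_of_lt hle.2 (lt_of_lt_of_le hy (hanti hle.1))⟩, rfl⟩ }
  have hmem : ∀ i j, (i, j) ∈ mu ↔ j < a i := by
    intro i j
    rw [← YoungDiagram.mem_cells]
    simp only [mu, Finset.mem_map, Finset.mem_sigma, Finset.mem_range]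
    constructor
    · rintro ⟨⟨x, y⟩, ⟨hx, hy⟩, hxy⟩
      simp only [Equiv.coe_toEmbedding, Equiv.sigmaEquivProd_apply, Prod.mk.injEq] at hxy hx hy
      obtain ⟨rfl, rfl⟩ := hxy
      exact hy
    · intro hj
      refine ⟨⟨i, j⟩, ⟨?_, hj⟩, rfl⟩
      by_contra hc
      rw [ha0 i (not_lt.1 hc)] at hj
      omega
  have hrow : ∀ p, mu.rowLen p = a p := fun p =>
    eq_of_forall_lt_iff fun j => by rw [← YoungDiagram.mem_iff_lt_rowLen, hmem]
  have hlen : mu.rowLens.length ≤ N := by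
    rw [YoungDiagram.length_rowLens]
    by_contra! hc
    have h5 := (YoungDiagram.mem_iff_lt_colLen (i := N) (j := 0)).2 hc
    rw [hmem, ha0 N le_rfl] at h5
    omega
  have hget : ∀ p, mu.rowLens.getD p 0 = a p := by
    intro p
    rcases lt_or_ge p mu.rowLens.length with hp | hp
    · rw [List.getD_eq_getElem _ _ hp, YoungDiagram.get_rowLens, hrow]
    · rw [List.getD_eq_default _ _ hp]
      rw [YoungDiagram.length_rowLens] at hp
      by_contra hc
      have h5 : (p, 0) ∈ mu := (hmem p 0).2 (Nat.pos_of_ne_zero (Ne.symm hc))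
      rw [YoungDiagram.mem_iff_lt_colLen] at h5
      omega
  have hsum : mu.rowLens.sum = n := by
    rw [← sum_getD_eq_sum _ hlen]
    simp only [hget]
    have : ((∑ p : Fin N, a p : ℕ) : ℤ) = n := by
      rw [← h3, ← Finset.sum_add_distrib]
      push_cast
      exact Finset.sum_congr rfl fun p _ => haF p
    exact_mod_cast this
  refine ⟨⟨mu.rowLens, fun {i} hi => YoungDiagram.pos_of_mem_rowLens mu i (by simpa using hi),
    by simpa using hsum⟩, ?_⟩
  have hrows : rows (⟨mu.rowLens, fun {i} hi =>
      YoungDiagram.pos_of_mem_rowLens mu i (by simpa using hi),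
      by simpa using hsum⟩ : n.Partition) = mu.rowLens := by
    unfold rows
    rw [Multiset.coe_sort]
    exact List.mergeSort_eq_self _ (by
      simpa using mu.rowLens_sorted.pairwise)
  rw [hrows]
  refine ⟨?_, hlen⟩
  funext p
  rw [toRows, hrows, hget, haF]
  ring

theorem sum_partition_eq_sum_rowSet {A : Type*} [AddCommMonoid A] {N : ℕ} (hN : n ≤ N)
    (F : (Fin N → ℤ) → A) : ∑ lam : n.Partition, F (toRows N lam) = ∑ l ∈ rowSet N n, F l := by
  refine Finset.sum_bij (fun lam _ => toRows N lam) ?_ ?_ ?_ ?_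
  · exact fun lam _ => toRows_mem_rowSet lam ((rows_length_le lam).trans hN)
  · exact fun a _ b _ h => toRows_injective hN h
  · intro l hl
    obtain ⟨lam, h, -⟩ := exists_toRows_eq hl
    exact ⟨lam, Finset.mem_univ _, h⟩
  · exact fun _ _ => rfl

theorem schur_eq_hDet (lam : n.Partition) {N : ℕ} (h : (rows lam).length ≤ N) :
    schur lam = hDet (toRows N lam) (idv N) := by
  induction N, h using Nat.le_induction with
  | base =>
    unfold schur hDet
    congr 1
    ext1 i j
    simp [toRows, idv]
  | succ N hN ih =>
    rw [hDet_succ, ih]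
    · congr 1
    · simp only [toRows, Fin.val_last]
      rw [List.getD_eq_default _ _ hN]
      simp

theorem mem_diagram {lam : n.Partition} {c : ℕ × ℕ} :
    c ∈ (diagram lam).cells ↔ c.2 < (rows lam).getD c.1 0 := by
  refine YoungDiagram.mem_ofRowLens.trans ?_
  constructor
  · rintro ⟨h, h'⟩
    rwa [List.getD_eq_getElem _ _ h]
  · intro h
    have h1 : c.1 < (rows lam).length := by
      by_contra hc
      rw [List.getD_eq_default _ _ (not_lt.1 hc)] at h
      omega
    exact ⟨h1, by rwa [List.getD_eq_getElem _ _ h1] at h⟩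

theorem prod_diagram {A : Type*} [CommMonoid A] (lam : n.Partition) {N : ℕ}
    (h : (rows lam).length ≤ N) (f : ℕ × ℕ → A) :
    ∏ c ∈ (diagram lam).cells, f c =
      ∏ p : Fin N, ∏ j ∈ Finset.range (toRows N lam p + p).toNat, f (p, j) := by
  rw [Finset.prod_finset_product (diagram lam).cells (Finset.range N)
    (fun i => Finset.range ((rows lam).getD i 0)),
    ← Fin.prod_univ_eq_prod_range (fun i => ∏ j ∈ Finset.range ((rows lam).getD i 0), f (i, j))]
  · simp [toRows]
  · intro c
    rw [mem_diagram, Finset.mem_range, Finset.mem_range, iff_and_self]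
    intro hc
    by_contra hc'
    rw [List.getD_eq_default _ _ (by omega)] at hc
    omega

theorem sum_diagram {A : Type*} [AddCommMonoid A] (lam : n.Partition) {N : ℕ}
    (h : (rows lam).length ≤ N) (f : ℕ × ℕ → A) :
    ∑ c ∈ (diagram lam).cells, f c =
      ∑ p : Fin N, ∑ j ∈ Finset.range (toRows N lam p + p).toNat, f (p, j) :=
  prod_diagram (A := Multiplicative A) lam h f

/-- The sum of the `k`-th powers of the contents. -/
def contPow {N : ℕ} (k : ℕ) (l : Fin N → ℤ) : ℂ :=
  ∑ p : Fin N, ∑ j ∈ Finset.range (l p + p).toNat, ((j : ℂ) - (p : ℂ)) ^ k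

theorem contEval_X (lam : n.Partition) {N : ℕ} (h : (rows lam).length ≤ N) (k : ℕ) :
    contEval lam (X k) = contPow k (toRows N lam) := by
  rw [contEval, eval_X, sum_diagram lam h]
  rfl

/-- The box added to row p lies in column l_p + p, counted from 0, so its content is l_p. The
hypothesis keeps `toNat` from truncating. -/
theorem contPow_add_single {N : ℕ} (k : ℕ) (l : Fin N → ℤ) (p : Fin N)
    (hp : -((p : ℕ) : ℤ) ≤ l p) :
    contPow k (l + Pi.single p 1) = contPow k l + (l p : ℂ) ^ k := by
  unfold contPow
  rw [sum_add_single
    (fun (q : Fin N) (x : ℤ) => ∑ j ∈ Finset.range (x + q).toNat, ((j : ℂ) - (q : ℂ)) ^ k)]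
  congr 1
  have h1 : (l p + 1 + p).toNat = (l p + p).toNat + 1 := by omega
  rw [h1, Finset.sum_range_succ, add_sub_cancel_left]
  congr 1
  have h2 : (((l p + p).toNat : ℤ) : ℂ) = ((l p + p : ℤ) : ℂ) := by
    rw [Int.toNat_of_nonneg (by omega)]
  push_cast at h2
  rw [h2]
  ring

end Rows

end TwistedCL

end

noncomputable section

namespace TwistedCL

/-! ### Cycle types of products with a transposition -/

section Cycles

open Function Equiv

variable {α : Type*}

/-- The points `u 0, …, u (n - 1)` are distinct and are permuted cyclically by `h`. -/
structure IsCyc (h : Perm α) (u : ℕ → α) (n : ℕ) : Prop where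
  pos : 0 < n
  step : ∀ i, i + 1 < n → h (u i) = u (i + 1)
  last : h (u (n - 1)) = u 0
  inj : Set.InjOn u (Set.Iio n)

theorem IsCyc.iterate {h : Perm α} {u : ℕ → α} {n : ℕ} (H : IsCyc h u n) {i : ℕ} (hi : i < n) :
    h^[i] (u 0) = u i := by
  induction i with
  | zero => rfl
  | succ i ih => rw [iterate_succ_apply', ih (by omega), H.step i hi]

theorem IsCyc.minimalPeriod {h : Perm α} {u : ℕ → α} {n : ℕ} (H : IsCyc h u n) {i : ℕ}
    (hi : i < n) : minimalPeriod h (u i) = n := by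
  have hper : IsPeriodicPt h n (u 0) := by
    have h1 := H.pos
    obtain ⟨m, rfl⟩ : ∃ m, n = m + 1 := ⟨n - 1, by omega⟩
    have := H.last
    rw [IsPeriodicPt, IsFixedPt, iterate_succ_apply', H.iterate (Nat.lt_succ_self m)]
    exact this
  rw [← H.iterate hi, minimalPeriod_apply_iterate ⟨n, H.pos, hper⟩]
  refine le_antisymm (hper.minimalPeriod_le H.pos) (le_of_not_gt fun hlt => ?_)
  have h2 : u (Function.minimalPeriod h (u 0)) = u 0 := by
    rw [← H.iterate hlt, iterate_minimalPeriod]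
  have h3 := H.inj hlt H.pos h2
  have h4 := hper.minimalPeriod_pos H.pos
  omega

theorem IsCyc.preimage {h : Perm α} {u : ℕ → α} {n : ℕ} (H : IsCyc h u n) {x : α}
    (hx : ∃ i < n, h x = u i) : ∃ i < n, x = u i := by
  obtain ⟨i, hi, h1⟩ := hx
  rcases i with _ | i
  · exact ⟨n - 1, by omega, h.injective (h1.trans H.last.symm)⟩
  · exact ⟨i, by omega, h.injective (h1.trans (H.step i hi).symm)⟩

theorem IsCyc.sum_image [DecidableEq α] {A : Type*} [AddCommMonoid A] {h : Perm α} {u : ℕ → α}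
    {n : ℕ} (H : IsCyc h u n) (F : ℕ → A) :
    ∑ x ∈ (Finset.range n).image u, F (Function.minimalPeriod h x) = n • F n := by
  rw [Finset.sum_image, Finset.sum_congr rfl (g := fun _ => F n), Finset.sum_const,
    Finset.card_range]
  · intro i hi
    rw [H.minimalPeriod (Finset.mem_range.1 hi)]
  · intro i hi j hj hij
    exact H.inj (Finset.mem_range.1 hi) (Finset.mem_range.1 hj) hij

variable [Fintype α]

theorem mem_periodicPts_perm (g : Perm α) (x : α) : x ∈ periodicPts g := by
  refine ⟨orderOf g, orderOf_pos g, ?_⟩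
  rw [IsPeriodicPt, IsFixedPt, ← Perm.coe_pow, pow_orderOf_eq_one, Perm.one_apply]

theorem minimalPeriod_perm_pos (g : Perm α) (x : α) : 0 < minimalPeriod g x :=
  minimalPeriod_pos_of_mem_periodicPts (mem_periodicPts_perm g x)

theorem isCyc_orbit (g : Perm α) (a : α) : IsCyc g (fun i => g^[i] a) (minimalPeriod g a) where
  pos := minimalPeriod_perm_pos g a
  step i _ := (iterate_succ_apply' g i a).symm
  last := by
    have h1 := minimalPeriod_perm_pos g a
    obtain ⟨m, hm⟩ : ∃ m, minimalPeriod g a = m + 1 := ⟨minimalPeriod g a - 1, by omega⟩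
    have h2 := iterate_minimalPeriod (f := g) (x := a)
    rw [hm, iterate_succ_apply'] at h2
    rw [hm]
    exact h2
  inj := iterate_injOn_Iio_minimalPeriod

variable [DecidableEq α]

theorem minimalPeriod_eq_card_support_cycleOf (g : Perm α) {x : α} (hx : g x ≠ x) :
    minimalPeriod g x = (g.cycleOf x).support.card := by
  have hc := Perm.isCycle_cycleOf g hx
  rw [← hc.orderOf]
  have key : ∀ n, minimalPeriod g x ∣ n ↔ orderOf (g.cycleOf x) ∣ n := by
    intro n
    rw [← isPeriodicPt_iff_minimalPeriod_dvd, orderOf_dvd_iff_pow_eq_one, hc.pow_eq_one_iff,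
      IsPeriodicPt, IsFixedPt, ← Perm.coe_pow]
    constructor
    · intro h
      refine ⟨x, ?_, ?_⟩
      · rwa [Perm.cycleOf_apply_self]
      · rwa [Perm.cycleOf_pow_apply_self]
    · rintro ⟨y, hy, h⟩
      have h1 : (g.cycleOf x) ^ n = 1 := hc.pow_eq_one_iff.2 ⟨y, hy, h⟩
      rw [← Perm.cycleOf_pow_apply_self, h1, Perm.one_apply]
  exact Nat.dvd_antisymm ((key _).2 dvd_rfl) ((key _).1 dvd_rfl)

/-- A cycle of length k has k points, each of minimal period k. Cycle types can thus be compared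
through sums over points. -/
theorem sum_minimalPeriod {A : Type*} [AddCommMonoid A] (g : Perm α) (F : ℕ → A) :
    ∑ x, F (minimalPeriod g x) = (g.partition.parts.map fun k => k • F k).sum := by
  rw [Perm.parts_partition, Multiset.map_add, Multiset.sum_add, Multiset.map_replicate,
    Multiset.sum_replicate, one_smul, ← Finset.sum_add_sum_compl g.support]
  congr 1
  · rw [Perm.cycleType_def, Multiset.map_map]
    change _ = ∑ c ∈ g.cycleFactorsFinset, _
    have hU : g.support = g.cycleFactorsFinset.biUnion Perm.support := by
      ext x
      rw [Finset.mem_biUnion]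
      constructor
      · intro hx
        exact ⟨g.cycleOf x, Perm.cycleOf_mem_cycleFactorsFinset_iff.2 hx,
          Perm.mem_support_cycleOf_iff.2 ⟨Perm.SameCycle.refl _ _, hx⟩⟩
      · rintro ⟨c, hc, hx⟩
        exact Perm.mem_cycleFactorsFinset_support_le hc hx
    rw [hU, Finset.sum_biUnion]
    · refine Finset.sum_congr rfl fun c hc => ?_
      rw [Finset.sum_congr rfl (g := fun _ => F c.support.card), Finset.sum_const]
      · rfl
      · intro x hx
        have h1 : g x ≠ x := Perm.mem_support.1 (Perm.mem_cycleFactorsFinset_support_le hc hx)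
        rw [minimalPeriod_eq_card_support_cycleOf g h1, ← Perm.cycle_is_cycleOf hx hc]
    · intro c hc d hd hcd
      exact (Perm.cycleFactorsFinset_pairwise_disjoint g hc hd hcd).disjoint_support
  · rw [Finset.sum_congr rfl (g := fun _ => F 1), Finset.sum_const, Finset.card_compl]
    intro x hx
    rw [Finset.mem_compl, Perm.notMem_support] at hx
    rw [minimalPeriod_eq_one_iff_isFixedPt.2 hx]

theorem sum_map_ite_eq {A : Type*} [AddCommMonoid A] (s : Multiset ℕ) (k : ℕ) (f : ℕ → A) :
    (s.map fun m => if m = k then f m else 0).sum = s.count k • f k := by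
  induction s using Multiset.induction_on with
  | empty => simp
  | cons a s ih =>
    rw [Multiset.map_cons, Multiset.sum_cons, ih, Multiset.count_cons]
    rcases eq_or_ne a k with rfl | h
    · rw [if_pos rfl, if_pos rfl, add_smul, one_smul, add_comm]
    · rw [if_neg h, if_neg h.symm, zero_add, add_zero]

/-- Indicator functions F recover k times the multiplicity of k, which is why 0 must be excluded. -/
theorem multiset_eq_of_weighted_sums {s t : Multiset ℕ} (hs : 0 ∉ s) (ht : 0 ∉ t)
    (h : ∀ F : ℕ → ℕ, (s.map fun k => k • F k).sum = (t.map fun k => k • F k).sum) : s = t := by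
  ext k
  rcases Nat.eq_zero_or_pos k with rfl | hk
  · rw [Multiset.count_eq_zero_of_notMem hs, Multiset.count_eq_zero_of_notMem ht]
  · have h1 := h fun m => if m = k then 1 else 0
    have h2 : ∀ m : ℕ, (m • if m = k then 1 else 0) = if m = k then m else 0 := by
      intro m
      split_ifs <;> simp
    simp only [h2] at h1
    rw [sum_map_ite_eq s k fun m => m, sum_map_ite_eq t k fun m => m] at h1
    exact Nat.eq_of_mul_eq_mul_right hk (by simpa using h1)

theorem minimalPeriod_mem_parts (g : Perm α) (a : α) : minimalPeriod g a ∈ g.partition.parts := by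
  by_contra hc
  have h1 := sum_minimalPeriod g fun m => if m = minimalPeriod g a then 1 else 0
  rw [Multiset.map_congr rfl (g := fun _ => 0), Multiset.map_const', Multiset.sum_replicate,
    smul_zero, Finset.sum_eq_zero_iff] at h1
  · simpa using h1 a (Finset.mem_univ a)
  · intro m hm
    rw [if_neg, smul_zero]
    rintro rfl
    exact hc hm

theorem zero_notMem_parts (g : Perm α) : 0 ∉ g.partition.parts :=
  fun h => lt_irrefl _ (g.partition.parts_pos h)

/-- Two permutations that agree off a set `O` invariant under one of them. -/
theorem sum_minimalPeriod_add_sum {A : Type*} [AddCommMonoid A] {g h : Perm α} {O : Finset α}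
    (H : ∀ x, x ∉ O → g x ∉ O ∧ h x = g x) (F : ℕ → A) :
    ∑ x, F (minimalPeriod h x) + ∑ x ∈ O, F (minimalPeriod g x) =
      ∑ x, F (minimalPeriod g x) + ∑ x ∈ O, F (minimalPeriod h x) := by
  have h1 : ∀ x ∈ Oᶜ, F (minimalPeriod h x) = F (minimalPeriod g x) := by
    intro x hx
    congr 1
    have h2 : ∀ n, h^[n] x = g^[n] x ∧ g^[n] x ∉ O := by
      intro n
      induction n with
      | zero => exact ⟨rfl, Finset.mem_compl.1 hx⟩
      | succ n ih =>
        rw [iterate_succ_apply', iterate_succ_apply', ih.1]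
        exact (H _ ih.2).symm
    rw [minimalPeriod_eq_minimalPeriod_iff]
    intro n
    rw [IsPeriodicPt, IsFixedPt, (h2 n).1]
    rfl
  rw [← Finset.sum_add_sum_compl O, ← Finset.sum_add_sum_compl O fun x => F (minimalPeriod g x),
    Finset.sum_congr rfl h1]
  abel

/-- Multiplication by a transposition of two points of one cycle cuts that cycle. -/
theorem parts_swap_mul_cut (g : Perm α) (a : α) {j : ℕ} (hj : 0 < j)
    (hjk : j < minimalPeriod g a) :
    (swap a (g^[j] a) * g).partition.parts + {minimalPeriod g a} =
      g.partition.parts + {j, minimalPeriod g a - j} := by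
  set k := minimalPeriod g a with hk
  set u : ℕ → α := fun i => g^[i] a with hu
  set h := swap a (g^[j] a) * g with hh
  have H : IsCyc g u k := isCyc_orbit g a
  have hu0 : u 0 = a := rfl
  have hne : ∀ {i i'}, i < k → i' < k → i ≠ i' → u i ≠ u i' :=
    fun hi hi' hii' h => hii' (H.inj hi hi' h)
  have hstep : ∀ i, i + 1 < k → i + 1 ≠ j → h (u i) = u (i + 1) := by
    intro i hi hij
    rw [hh, Perm.mul_apply, H.step i hi, swap_apply_of_ne_of_ne]
    · exact hne hi (by omega) (Nat.succ_ne_zero i)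
    · exact hne hi hjk hij
  have hj1 : h (u (j - 1)) = u 0 := by
    rw [hh, Perm.mul_apply, H.step _ (by omega), Nat.sub_add_cancel hj]
    exact swap_apply_right _ _
  have hk1 : h (u (k - 1)) = u j := by
    rw [hh, Perm.mul_apply, H.last]
    exact swap_apply_left _ _
  -- The cycle u_0, …, u_{k-1} of a falls apart into u_0, …, u_{j-1} and u_j, …, u_{k-1}.
  have H1 : IsCyc h u j :=
    ⟨hj, fun i hi => hstep i (by omega) (by omega), hj1, H.inj.mono (Set.Iio_subset_Iio hjk.le)⟩
  have H2 : IsCyc h (fun i => u (j + i)) (k - j) := by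
    refine ⟨by omega, fun i hi => hstep (j + i) (by omega) (by omega), ?_, ?_⟩
    · have : j + (k - j - 1) = k - 1 := by omega
      rw [this, hk1, add_zero]
    · intro x hx y hy hxy
      rw [Set.mem_Iio] at hx hy
      have := H.inj (Set.mem_Iio.2 (by omega : j + x < k)) (Set.mem_Iio.2 (by omega : j + y < k)) hxy
      omega
  have hO : (Finset.range k).image u =
      (Finset.range j).image u ∪ (Finset.range (k - j)).image fun i => u (j + i) := by
    ext x
    simp only [Finset.mem_image, Finset.mem_union, Finset.mem_range]
    constructor
    · rintro ⟨i, hi, rfl⟩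
      rcases lt_or_ge i j with hij | hij
      · exact Or.inl ⟨i, hij, rfl⟩
      · exact Or.inr ⟨i - j, by omega, by rw [Nat.add_sub_cancel' hij]⟩
    · rintro (⟨i, hi, rfl⟩ | ⟨i, hi, rfl⟩)
      · exact ⟨i, by omega, rfl⟩
      · exact ⟨j + i, by omega, rfl⟩
  have hdis : Disjoint ((Finset.range j).image u)
      ((Finset.range (k - j)).image fun i => u (j + i)) := by
    rw [Finset.disjoint_left]
    simp only [Finset.mem_image, Finset.mem_range]
    rintro x ⟨i, hi, rfl⟩ ⟨i', hi', h'⟩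
    exact hne (by omega) (by omega) (by omega) h'
  have hoff : ∀ x, x ∉ (Finset.range k).image u → g x ∉ (Finset.range k).image u ∧ h x = g x := by
    intro x hx
    have h1 : g x ∉ (Finset.range k).image u := by
      intro h2
      apply hx
      simp only [Finset.mem_image, Finset.mem_range] at h2 ⊢
      obtain ⟨i, hi, h2⟩ := h2
      obtain ⟨i', hi', h3⟩ := H.preimage ⟨i, hi, h2.symm⟩
      exact ⟨i', hi', h3.symm⟩
    refine ⟨h1, ?_⟩
    rw [hh, Perm.mul_apply, swap_apply_of_ne_of_ne]
    · rintro h2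
      exact h1 (Finset.mem_image.2 ⟨0, Finset.mem_range.2 H.pos, by rw [h2]; rfl⟩)
    · rintro h2
      exact h1 (Finset.mem_image.2 ⟨j, Finset.mem_range.2 hjk, by rw [h2]⟩)
  refine multiset_eq_of_weighted_sums ?_ ?_ fun F => ?_
  · simp only [Multiset.mem_add, Multiset.mem_singleton, not_or]
    exact ⟨zero_notMem_parts _, by omega⟩
  · simp only [Multiset.mem_add, Multiset.insert_eq_cons, Multiset.mem_cons,
      Multiset.mem_singleton, not_or]
    exact ⟨zero_notMem_parts _, by omega, by omega⟩
  · have h1 := sum_minimalPeriod_add_sum hoff F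
    rw [H.sum_image, hO, Finset.sum_union hdis, H1.sum_image, H2.sum_image,
      sum_minimalPeriod, sum_minimalPeriod] at h1
    simpa [add_assoc, add_left_comm] using h1

/-- Multiplication by a transposition of points of two distinct cycles joins these cycles. -/
theorem parts_swap_mul_join (g : Perm α) (a b : α) (hb : ∀ i, b ≠ g^[i] a) :
    (swap a b * g).partition.parts + {minimalPeriod g a, minimalPeriod g b} =
      g.partition.parts + {minimalPeriod g a + minimalPeriod g b} := by
  set k := minimalPeriod g a with hk
  set m := minimalPeriod g b with hm
  set u : ℕ → α := fun i => g^[i] a with hu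
  set v : ℕ → α := fun i => g^[i] b with hv
  set h := swap a b * g with hh
  have H : IsCyc g u k := isCyc_orbit g a
  have K : IsCyc g v m := isCyc_orbit g b
  have hk0 := H.pos
  have hm0 := K.pos
  -- A common point of the orbits could be iterated until the orbit of b closes up at b, placing b
  -- on the orbit of a; m(i' + 1) is a multiple of the period that is at least i'.
  have hnu : ∀ i i', u i ≠ v i' := by
    intro i i' hii
    have h1 : v (i' + m * (i' + 1) - i') = u (i + (m * (i' + 1) - i')) := by
      have h2 : i' ≤ m * (i' + 1) := by nlinarith
      have : i' + m * (i' + 1) - i' = (m * (i' + 1) - i') + i' := by omega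
      rw [this, add_comm i]
      simp only [hu, hv, iterate_add_apply] at hii ⊢
      rw [hii]
    have h3 : v (i' + m * (i' + 1) - i') = b := by
      rw [Nat.add_sub_cancel_left]
      have : IsPeriodicPt g (m * (i' + 1)) b :=
        (isPeriodicPt_minimalPeriod g b).mul_const _
      exact this
    exact hb _ (h3.symm.trans h1)
  have hstepu : ∀ i, i + 1 < k → h (u i) = u (i + 1) := by
    intro i hi
    rw [hh, Perm.mul_apply, H.step i hi, swap_apply_of_ne_of_ne]
    · exact fun h' => Nat.succ_ne_zero i (H.inj hi hk0 h')
    · exact hnu _ 0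
  have hstepv : ∀ i, i + 1 < m → h (v i) = v (i + 1) := by
    intro i hi
    rw [hh, Perm.mul_apply, K.step i hi, swap_apply_of_ne_of_ne]
    · exact (hnu 0 _).symm
    · exact fun h' => Nat.succ_ne_zero i (K.inj hi hm0 h')
  have hlastu : h (u (k - 1)) = v 0 := by
    rw [hh, Perm.mul_apply, H.last]
    exact swap_apply_left _ _
  have hlastv : h (v (m - 1)) = u 0 := by
    rw [hh, Perm.mul_apply, K.last]
    exact swap_apply_right _ _
  -- The joined cycle runs through the orbit of a and then through that of b.
  set w : ℕ → α := fun i => if i < k then u i else v (i - k) with hw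
  have hwu : ∀ i, i < k → w i = u i := fun i hi => if_pos hi
  have hwv : ∀ i, w (k + i) = v i := fun i => by
    simp only [hw]
    rw [if_neg (by omega), Nat.add_sub_cancel_left]
  have HW : IsCyc h w (k + m) := by
    refine ⟨by omega, fun i hi => ?_, ?_, ?_⟩
    · rcases lt_or_ge (i + 1) k with h1 | h1
      · rw [hwu _ h1, hwu _ (by omega), hstepu i h1]
      · rcases lt_or_ge i k with h2 | h2
        · have h3 : i = k - 1 := by omega
          have h4 : i + 1 = k + 0 := by omega
          rw [hwu _ h2, h4, hwv, h3, hlastu]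
        · obtain ⟨i, rfl⟩ := Nat.exists_eq_add_of_le h2
          rw [hwv, add_assoc, hwv, hstepv i (by omega)]
    · have h1 : k + m - 1 = k + (m - 1) := by omega
      rw [h1, hwv, hlastv, hwu 0 hk0]
    · intro x hx y hy hxy
      rw [Set.mem_Iio] at hx hy
      rcases lt_or_ge x k with h1 | h1 <;> rcases lt_or_ge y k with h2 | h2
      · rw [hwu _ h1, hwu _ h2] at hxy
        exact H.inj h1 h2 hxy
      · obtain ⟨y, rfl⟩ := Nat.exists_eq_add_of_le h2
        rw [hwu _ h1, hwv] at hxy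
        exact absurd hxy (hnu _ _)
      · obtain ⟨x, rfl⟩ := Nat.exists_eq_add_of_le h1
        rw [hwu _ h2, hwv] at hxy
        exact absurd hxy.symm (hnu _ _)
      · obtain ⟨x, rfl⟩ := Nat.exists_eq_add_of_le h1
        obtain ⟨y, rfl⟩ := Nat.exists_eq_add_of_le h2
        rw [hwv, hwv] at hxy
        rw [K.inj (Set.mem_Iio.2 (by omega)) (Set.mem_Iio.2 (by omega)) hxy]
  have hO : (Finset.range (k + m)).image w = (Finset.range k).image u ∪ (Finset.range m).image v := by
    ext x
    simp only [Finset.mem_image, Finset.mem_union, Finset.mem_range]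
    constructor
    · rintro ⟨i, hi, rfl⟩
      rcases lt_or_ge i k with hij | hij
      · exact Or.inl ⟨i, hij, (hwu i hij).symm⟩
      · obtain ⟨i, rfl⟩ := Nat.exists_eq_add_of_le hij
        exact Or.inr ⟨i, by omega, (hwv i).symm⟩
    · rintro (⟨i, hi, rfl⟩ | ⟨i, hi, rfl⟩)
      · exact ⟨i, by omega, hwu i hi⟩
      · exact ⟨k + i, by omega, hwv i⟩
  have hdis : Disjoint ((Finset.range k).image u) ((Finset.range m).image v) := by
    rw [Finset.disjoint_left]
    simp only [Finset.mem_image, Finset.mem_range]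
    rintro x ⟨i, hi, rfl⟩ ⟨i', hi', h'⟩
    exact hnu _ _ h'.symm
  have hoff : ∀ x, x ∉ (Finset.range (k + m)).image w →
      g x ∉ (Finset.range (k + m)).image w ∧ h x = g x := by
    intro x hx
    rw [hO] at hx ⊢
    have h1 : g x ∉ (Finset.range k).image u ∪ (Finset.range m).image v := by
      intro h2
      apply hx
      simp only [Finset.mem_union, Finset.mem_image, Finset.mem_range] at h2 ⊢
      rcases h2 with ⟨i, hi, h2⟩ | ⟨i, hi, h2⟩
      · obtain ⟨i', hi', h3⟩ := H.preimage ⟨i, hi, h2.symm⟩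
        exact Or.inl ⟨i', hi', h3.symm⟩
      · obtain ⟨i', hi', h3⟩ := K.preimage ⟨i, hi, h2.symm⟩
        exact Or.inr ⟨i', hi', h3.symm⟩
    refine ⟨h1, ?_⟩
    rw [hh, Perm.mul_apply, swap_apply_of_ne_of_ne]
    · rintro h2
      exact h1 (Finset.mem_union_left _
        (Finset.mem_image.2 ⟨0, Finset.mem_range.2 hk0, by rw [h2]; rfl⟩))
    · rintro h2
      exact h1 (Finset.mem_union_right _
        (Finset.mem_image.2 ⟨0, Finset.mem_range.2 hm0, by rw [h2]; rfl⟩))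
  refine multiset_eq_of_weighted_sums ?_ ?_ fun F => ?_
  · simp only [Multiset.mem_add, Multiset.insert_eq_cons, Multiset.mem_cons,
      Multiset.mem_singleton, not_or]
    exact ⟨zero_notMem_parts _, by omega, by omega⟩
  · simp only [Multiset.mem_add, Multiset.mem_singleton, not_or]
    exact ⟨zero_notMem_parts _, by omega⟩
  · have h1 := sum_minimalPeriod_add_sum hoff F
    rw [HW.sum_image, hO, Finset.sum_union hdis, H.sum_image, K.sum_image,
      sum_minimalPeriod, sum_minimalPeriod] at h1
    simpa [add_assoc, add_left_comm] using h1

/-- The cycle types of the products of `g` with all transpositions. -/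
theorem sum_swap_mul {A : Type*} [AddCommGroup A] (g : Perm α) (F : Multiset ℕ → A) :
    ∑ a, ∑ b with b ≠ a, F (Equiv.swap a b * g).partition.parts =
      (g.partition.parts.map fun k =>
        k • (∑ j ∈ Finset.Ioo 0 k, F (g.partition.parts.erase k + {j, k - j}) +
          ((g.partition.parts.erase k).map fun m =>
            m • F ((g.partition.parts.erase k).erase m + {k + m})).sum)).sum := by
  set s := g.partition.parts with hs
  rw [← sum_minimalPeriod g fun k => ∑ j ∈ Finset.Ioo 0 k, F (s.erase k + {j, k - j}) +
          ((s.erase k).map fun m => m • F ((s.erase k).erase m + {k + m})).sum]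
  refine Finset.sum_congr rfl fun a _ => ?_
  set k := minimalPeriod g a with hk
  have hks : k ∈ s := minimalPeriod_mem_parts g a
  have H : IsCyc g (fun i => g^[i] a) k := isCyc_orbit g a
  set O := (Finset.range k).image fun i => g^[i] a with hO
  -- Either b lies on the cycle of a, at distance j, and the cycle is cut, or it lies on another
  -- cycle and the two are joined.
  have hsplit : (Finset.univ.filter fun b => b ≠ a) =
      ((Finset.Ioo 0 k).image fun i => g^[i] a) ∪ Oᶜ := by
    ext b
    simp only [hO, Finset.mem_filter, Finset.mem_univ, true_and, Finset.mem_union,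
      Finset.mem_compl, Finset.mem_image, Finset.mem_range, Finset.mem_Ioo]
    constructor
    · intro hba
      by_cases hb : ∃ i < k, g^[i] a = b
      · obtain ⟨i, hi, rfl⟩ := hb
        refine Or.inl ⟨i, ⟨Nat.pos_of_ne_zero ?_, hi⟩, rfl⟩
        rintro rfl
        exact hba rfl
      · exact Or.inr hb
    · rintro (⟨i, ⟨hi0, hi⟩, rfl⟩ | hb) h
      · exact hi0.ne' (H.inj hi H.pos h)
      · exact hb ⟨0, H.pos, h.symm⟩
  rw [hsplit, Finset.sum_union, Finset.sum_image]
  · congr 1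
    · refine Finset.sum_congr rfl fun j hj => ?_
      rw [Finset.mem_Ioo] at hj
      have h1 := parts_swap_mul_cut g a hj.1 hj.2
      rw [← hs, ← hk, ← Multiset.cons_erase hks] at h1
      congr 1
      rw [add_comm, Multiset.singleton_add, Multiset.cons_add, Multiset.cons_inj_right] at h1
      exact h1
    · have h2 : ∀ b ∈ Oᶜ, F (Equiv.swap a b * g).partition.parts =
          F ((s.erase k).erase (minimalPeriod g b) + {k + minimalPeriod g b}) := by
        intro b hb
        set m := minimalPeriod g b with hm
        have hk0 : 0 < k := H.pos
        have hm0 : 0 < m := minimalPeriod_perm_pos g b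
        have hb' : ∀ i, b ≠ g^[i] a := by
          rintro i rfl
          apply Finset.mem_compl.1 hb
          refine Finset.mem_image.2 ⟨i % k, Finset.mem_range.2 (Nat.mod_lt _ hk0), ?_⟩
          exact iterate_mod_minimalPeriod_eq
        have h1 := parts_swap_mul_join g a b hb'
        rw [← hs, ← hk, ← hm] at h1
        -- Comparing multiplicities in `h1` shows this except for the new part k + m, which is
        -- neither k nor m as both are positive.
        have h3 : ({k, m} : Multiset ℕ) ≤ s := by
          rw [Multiset.le_iff_count]
          intro c
          rcases eq_or_ne c (k + m) with rfl | hc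
          · rw [Multiset.count_eq_zero_of_notMem]
            · exact Nat.zero_le _
            · simp only [Multiset.insert_eq_cons, Multiset.mem_cons, Multiset.mem_singleton]
              omega
          · have h4 := congrArg (Multiset.count c) h1
            rw [Multiset.count_add, Multiset.count_add,
              Multiset.count_eq_zero_of_notMem (s := {k + m}) (by simpa using hc)] at h4
            omega
        obtain ⟨t, ht⟩ := Multiset.le_iff_exists_add.1 h3
        have h5 : s = k ::ₘ m ::ₘ t := by
          rw [ht, Multiset.insert_eq_cons, Multiset.cons_add, Multiset.singleton_add]
        have h6 : (Equiv.swap a b * g).partition.parts = t + {k + m} := by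
          refine add_right_cancel (b := ({k, m} : Multiset ℕ)) ?_
          rw [h1, ht]
          abel
        rw [h5, Multiset.erase_cons_head, Multiset.erase_cons_head, h6]
      rw [Finset.sum_congr rfl h2]
      -- The sum over points off the cycle of a is the sum over all points minus the k points of
      -- that cycle, so one part k is erased from s.
      have h3 := sum_minimalPeriod g fun m => F ((s.erase k).erase m + {k + m})
      have h4 := H.sum_image fun m => F ((s.erase k).erase m + {k + m})
      rw [← hO] at h4
      rw [← Finset.sum_add_sum_compl O, h4, ← hs] at h3
      have h5 : ∀ f : ℕ → A, (s.map f).sum = f k + ((s.erase k).map f).sum := by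
        intro f
        conv_lhs => rw [← Multiset.cons_erase hks, Multiset.map_cons, Multiset.sum_cons]
      rw [h5] at h3
      exact add_left_cancel h3
  · intro i hi j hj hij
    exact H.inj (Finset.mem_Ioo.1 hi).2 (Finset.mem_Ioo.1 hj).2 hij
  · rw [Finset.disjoint_left]
    intro x hx
    rw [Finset.mem_compl, not_not]
    obtain ⟨i, hi, rfl⟩ := Finset.mem_image.1 hx
    exact Finset.mem_image.2 ⟨i, Finset.mem_range.2 (Finset.mem_Ioo.1 hi).2, rfl⟩

end Cycles

end TwistedCL

end

noncomputable section

namespace TwistedCL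

open MvPolynomial

/-! ### The characteristic map and the center of the group algebra -/

section Group

variable {n : ℕ}

/-- The cycle type of a permutation of `Fin n` as a partition of `n`. -/
def prt (g : Equiv.Perm (Fin n)) : n.Partition :=
  ⟨g.partition.parts, g.partition.parts_pos, by rw [g.partition.parts_sum, Fintype.card_fin]⟩

theorem prt_eq_iff {g : Equiv.Perm (Fin n)} {mu : n.Partition} :
    prt g = mu ↔ g.partition.parts = mu.parts :=
  ⟨fun h => h ▸ rfl, fun h => Nat.Partition.ext h⟩

theorem prt_eq_iff_isConj {g h : Equiv.Perm (Fin n)} : prt g = prt h ↔ IsConj g h := by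
  rw [Equiv.Perm.partition_eq_of_isConj, prt_eq_iff, Nat.Partition.ext_iff]
  rfl

theorem gAlg_eq_sum (x : GAlg n) : x = ∑ g, x.coeff g • elt g := by
  refine MonoidAlgebra.coeff_injective ?_
  ext g
  simp [elt, MonoidAlgebra.coeff_sum]

theorem gAlg_hom_ext {A : Type*} [AddCommMonoid A] [Module ℂ A] {F G : GAlg n →ₗ[ℂ] A}
    (h : ∀ g, F (elt g) = G (elt g)) : F = G := by
  refine LinearMap.ext fun x => ?_
  rw [gAlg_eq_sum x, map_sum, map_sum]
  exact Finset.sum_congr rfl fun g _ => by rw [map_smul, map_smul, h]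

theorem coeff_elt_mul (h : Equiv.Perm (Fin n)) (x : GAlg n) (g : Equiv.Perm (Fin n)) :
    (elt h * x).coeff (h * g) = x.coeff g := by
  unfold elt
  rw [MonoidAlgebra.coeff_single_mul_eq_mul_coeff g (by simp), one_mul]

theorem coeff_mul_elt (h : Equiv.Perm (Fin n)) (x : GAlg n) (g : Equiv.Perm (Fin n)) :
    (x * elt h).coeff (g * h) = x.coeff g := by
  unfold elt
  rw [MonoidAlgebra.coeff_mul_single_eq_coeff_mul g (by simp), mul_one]

theorem mem_center_iff {z : GAlg n} :
    z ∈ Subalgebra.center ℂ (GAlg n) ↔ ∀ h, elt h * z = z * elt h := by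
  rw [Subalgebra.mem_center_iff]
  refine ⟨fun h g => h _, fun h x => ?_⟩
  rw [gAlg_eq_sum x, Finset.sum_mul, Finset.mul_sum]
  exact Finset.sum_congr rfl fun g _ => by rw [smul_mul_assoc, mul_smul_comm, h]

theorem coeff_eq_of_mem_center {z : GAlg n} (hz : z ∈ Subalgebra.center ℂ (GAlg n))
    {g g' : Equiv.Perm (Fin n)} (h : prt g = prt g') : z.coeff g = z.coeff g' := by
  obtain ⟨c, hc⟩ := isConj_iff.1 (prt_eq_iff_isConj.1 h)
  rw [← coeff_elt_mul c z g, mem_center_iff.1 hz c, ← hc]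
  conv_lhs => rw [← inv_mul_cancel_right (c * g) c]
  rw [coeff_mul_elt]

theorem ch_elt (g : Equiv.Perm (Fin n)) : ch n (elt g) = (n ! : ℂ)⁻¹ • pPart (prt g) := by
  simp [ch, elt, pPart, prt, MonoidAlgebra.coeffLinearEquiv]

theorem ch_apply (x : GAlg n) :
    ch n x = ∑ g, ((n ! : ℂ)⁻¹ * x.coeff g) • monomial (exps (prt g)) 1 := by
  conv_lhs => rw [gAlg_eq_sum x]
  rw [map_sum]
  refine Finset.sum_congr rfl fun g _ => ?_
  rw [map_smul, ch_elt, pPart_eq_monomial, smul_smul, mul_comm]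

theorem factorial_inv_ne_zero : ((n ! : ℂ)⁻¹) ≠ 0 :=
  inv_ne_zero (Nat.cast_ne_zero.2 (Nat.factorial_ne_zero n))

/-- A central element is constant on conjugacy classes, and distinct classes are sent to distinct
monomials, so each coefficient of the image is a nonzero multiple of one coefficient of z. -/
theorem ch_injOn_center {z : GAlg n} (hz : z ∈ Subalgebra.center ℂ (GAlg n)) (h : ch n z = 0) :
    z = 0 := by
  refine MonoidAlgebra.coeff_injective ?_
  ext g
  have h1 := congrArg (coeff (exps (prt g))) h
  rw [ch_apply, coeff_sum, coeff_zero] at h1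
  have h2 : ∀ g' : Equiv.Perm (Fin n),
      coeff (exps (prt g)) (((n ! : ℂ)⁻¹ * z.coeff g') • monomial (exps (prt g')) (1 : ℂ)) =
      if prt g' = prt g then (n ! : ℂ)⁻¹ * z.coeff g else 0 := by
    intro g'
    rw [coeff_smul, coeff_monomial, smul_eq_mul]
    by_cases h3 : prt g' = prt g
    · rw [if_pos (by rw [h3]), if_pos h3, mul_one, coeff_eq_of_mem_center hz h3]
    · rw [if_neg fun h4 => h3 (exps_injective n h4), if_neg h3, mul_zero]
  rw [Finset.sum_congr rfl fun g' _ => h2 g', ← Finset.sum_filter, Finset.sum_const, smul_eq_zero,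
    mul_eq_zero] at h1
  rcases h1 with h1 | h1 | h1
  · exact absurd h1 (Finset.card_ne_zero_of_mem (a := g) (by simp))
  · exact absurd h1 factorial_inv_ne_zero
  · exact h1

theorem eq_of_ch_eq {z w : GAlg n} (hz : z ∈ Subalgebra.center ℂ (GAlg n))
    (hw : w ∈ Subalgebra.center ℂ (GAlg n)) (h : ch n z = ch n w) : z = w :=
  sub_eq_zero.1 (ch_injOn_center (sub_mem hz hw) (by rw [map_sub, h, sub_self]))

theorem ch_conj (h : Equiv.Perm (Fin n)) (x : GAlg n) : ch n (elt h * x * elt h⁻¹) = ch n x := by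
  have : ch n ∘ₗ LinearMap.mulRight ℂ (elt h⁻¹) ∘ₗ LinearMap.mulLeft ℂ (elt h) = ch n := by
    refine gAlg_hom_ext fun g => ?_
    simp only [LinearMap.comp_apply, LinearMap.mulLeft_apply, LinearMap.mulRight_apply, elt_mul]
    rw [ch_elt, ch_elt, prt_eq_iff_isConj.2 (isConj_iff.2 ⟨h, rfl⟩ : IsConj g (h * g * h⁻¹))]
  exact LinearMap.congr_fun this x

theorem elt_inv_mul (h : Equiv.Perm (Fin n)) : elt h⁻¹ * elt h = 1 := by
  rw [elt_mul, inv_mul_cancel]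
  rfl

/-- The sum of the conjugates of an element of the group algebra. -/
def conjSum (x : GAlg n) : GAlg n := ∑ h : Equiv.Perm (Fin n), elt h * x * elt h⁻¹

theorem conjSum_mem_center (x : GAlg n) : conjSum x ∈ Subalgebra.center ℂ (GAlg n) := by
  refine mem_center_iff.2 fun g => ?_
  unfold conjSum
  rw [Finset.mul_sum, Finset.sum_mul]
  refine Fintype.sum_equiv (Equiv.mulLeft g) _ _ fun h => ?_
  rw [Equiv.coe_mulLeft, mul_inv_rev, ← elt_mul, ← elt_mul]
  rw [mul_assoc _ (_ * _) (elt g), mul_assoc (elt h⁻¹), elt_inv_mul, mul_one]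
  simp only [mul_assoc]

theorem ch_conjSum (x : GAlg n) : ch n (conjSum x) = (n ! : ℂ) • ch n x := by
  unfold conjSum
  rw [map_sum, Finset.sum_congr rfl fun h _ => ch_conj h x, Finset.sum_const, Finset.card_univ,
    Fintype.card_perm, Fintype.card_fin, Nat.cast_smul_eq_nsmul]

/-- Summing over conjugates commutes with multiplication by z and multiplies `ch` by n!. If ch(x) =
0, the conjugation sum of x is central with zero characteristic, hence zero. -/
theorem ch_center_mul_eq_zero {z x : GAlg n} (hz : z ∈ Subalgebra.center ℂ (GAlg n))
    (hx : ch n x = 0) : ch n (z * x) = 0 := by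
  have h1 : conjSum (z * x) = z * conjSum x := by
    unfold conjSum
    rw [Finset.mul_sum]
    refine Finset.sum_congr rfl fun h _ => ?_
    rw [← mul_assoc, mem_center_iff.1 hz h]
    simp only [mul_assoc]
  have h2 : conjSum x = 0 :=
    ch_injOn_center (conjSum_mem_center x) (by rw [ch_conjSum, hx, smul_zero])
  have h3 := ch_conjSum (z * x)
  rw [h1, h2, mul_zero, map_zero] at h3
  exact (smul_eq_zero.1 h3.symm).resolve_left (Nat.cast_ne_zero.2 (Nat.factorial_ne_zero n))

theorem ch_center_mul_congr {z x y : GAlg n} (hz : z ∈ Subalgebra.center ℂ (GAlg n))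
    (hx : ch n x = ch n y) : ch n (z * x) = ch n (z * y) := by
  rw [← sub_eq_zero, ← map_sub, ← mul_sub]
  exact ch_center_mul_eq_zero hz (by rw [map_sub, hx, sub_self])

theorem classSum_eq (mu : n.Partition) :
    classSum mu = ∑ g : Equiv.Perm (Fin n) with prt g = mu, elt g := by
  simp only [classSum, prt_eq_iff]

theorem classSum_mem_center (mu : n.Partition) : classSum mu ∈ Subalgebra.center ℂ (GAlg n) := by
  refine mem_center_iff.2 fun h => ?_
  rw [classSum_eq, Finset.sum_mul, Finset.mul_sum]
  refine Finset.sum_equiv (MulAut.conj h).toEquiv (fun g => ?_) fun g _ => ?_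
  · simp only [Finset.mem_filter, Finset.mem_univ, true_and]
    rw [prt_eq_iff_isConj.2 (isConj_iff.2 ⟨h, rfl⟩ : IsConj g ((MulAut.conj h).toEquiv g))]
  · rw [elt_mul, elt_mul]
    simp

/-- The class-size formula for `cycleType` ignores fixed points, so the parts equal to 1 are split
off; they contribute the factor c! to Z_μ. -/
theorem card_mul_zee (mu : n.Partition) :
    ((Finset.univ.filter fun g : Equiv.Perm (Fin n) => prt g = mu).card : ℂ) * zee mu = n ! := by
  set m : Multiset ℕ := mu.parts.filter fun i => 2 ≤ i with hm
  set c := mu.parts.count 1 with hc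
  have h1 : mu.parts = m + Multiset.replicate c 1 := by
    ext i
    rw [Multiset.count_add, Multiset.count_replicate, hm, Multiset.count_filter]
    rcases lt_trichotomy i 1 with h | rfl | h
    · obtain rfl : i = 0 := by omega
      rw [Multiset.count_eq_zero_of_notMem fun h0 => (mu.parts_pos h0).false]
      simp
    · simp [hc]
    · rw [if_pos (by omega), if_neg (by omega), add_zero]
  have h2 : m.sum + c = n := by
    have := mu.parts_sum
    rw [h1] at this
    simpa using this
  have h3 : (Finset.univ.filter fun g : Equiv.Perm (Fin n) => prt g = mu) =
      Finset.univ.filter fun g : Equiv.Perm (Fin n) => g.cycleType = m := by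
    ext g
    simp only [Finset.mem_filter, Finset.mem_univ, true_and, prt_eq_iff]
    constructor
    · intro h
      rw [← Equiv.Perm.filter_parts_partition_eq_cycleType, h]
    · intro h
      rw [Equiv.Perm.parts_partition, h, h1, ← Equiv.Perm.sum_cycleType, h, Fintype.card_fin]
      congr 2
      omega
  have h4 := Equiv.Perm.card_of_cycleType_mul_eq (α := Fin n) m
  rw [if_pos ⟨by rw [Fintype.card_fin]; omega, fun a ha => (Multiset.mem_filter.1 ha).2⟩,
    Fintype.card_fin, ← h3, show n - m.sum = c by omega] at h4
  have h5 : zee mu = ∏ i ∈ insert 1 m.toFinset,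
      ((mu.parts.count i)! : ℂ) * (i : ℂ) ^ mu.parts.count i := by
    refine Finset.prod_subset (fun i hi => ?_) fun i _ hi => ?_
    · rw [Multiset.mem_toFinset, h1, Multiset.mem_add] at hi
      rcases hi with hi | hi
      · exact Finset.mem_insert_of_mem (Multiset.mem_toFinset.2 hi)
      · rw [Multiset.eq_of_mem_replicate hi]
        exact Finset.mem_insert_self _ _
    · rw [Multiset.count_eq_zero_of_notMem (by simpa using hi)]
      simp
  have h6 : (1 : ℕ) ∉ m.toFinset := by simp [hm]
  have h7 : ∀ i ∈ m.toFinset, mu.parts.count i = m.count i := by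
    intro i hi
    rw [hm, Multiset.count_filter, if_pos]
    exact (Multiset.mem_filter.1 (Multiset.mem_toFinset.1 hi)).2
  have h8 : (m.prod : ℂ) = ∏ i ∈ m.toFinset, (i : ℂ) ^ m.count i := by
    rw [Finset.prod_multiset_count, Nat.cast_prod]
    exact Finset.prod_congr rfl fun i _ => Nat.cast_pow _ _
  have h9 : ∏ i ∈ m.toFinset, (((mu.parts.count i)! : ℂ) * (i : ℂ) ^ mu.parts.count i) =
      ∏ i ∈ m.toFinset, (((m.count i)! : ℂ) * (i : ℂ) ^ m.count i) :=
    Finset.prod_congr rfl fun i hi => by rw [h7 i hi]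
  rw [h5, Finset.prod_insert h6, h9, Finset.prod_mul_distrib, ← hc, ← h4]
  simp only [Nat.cast_mul, Nat.cast_prod, h8, Nat.cast_one, one_pow]
  ring

theorem ch_classSum (mu : n.Partition) : ch n (classSum mu) = (zee mu)⁻¹ • pPart mu := by
  rw [classSum_eq, map_sum, Finset.sum_congr rfl fun g hg => by
    rw [ch_elt, (Finset.mem_filter.1 hg).2], Finset.sum_const, ← Nat.cast_smul_eq_nsmul ℂ, smul_smul,
    ← card_mul_zee mu]
  congr 1
  have h1 := zee_ne_zero mu
  have h2 : ((Finset.univ.filter fun g : Equiv.Perm (Fin n) => prt g = mu).card : ℂ) ≠ 0 := by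
    intro h
    have h3 := card_mul_zee mu
    rw [h, zero_mul] at h3
    exact Nat.cast_ne_zero.2 (Nat.factorial_ne_zero n) h3.symm
  field_simp

theorem eq_sum_pPart {f : Lam} (hf : ∀ d, coeff d f ≠ 0 → wt d = n) :
    f = ∑ mu : n.Partition, coeff (exps mu) f • pPart mu := by
  ext d
  simp only [coeff_sum, coeff_smul, pPart_eq_monomial, coeff_monomial, smul_eq_mul, mul_ite, mul_one,
    mul_zero]
  by_cases hd : wt d = n
  · obtain ⟨mu, rfl⟩ := exists_exps_eq hd
    rw [Finset.sum_eq_single mu]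
    · rw [if_pos rfl]
    · exact fun nu _ h => if_neg fun h' => h (exps_injective n h')
    · exact fun h => absurd (Finset.mem_univ _) h
  · rw [Finset.sum_eq_zero]
    · by_contra h
      exact hd (hf d h)
    · rintro mu -
      rw [if_neg]
      rintro rfl
      exact hd (wt_exps mu)

/-- The class sums map to Z_μ⁻¹ P_μ, so a homogeneous f lifts by rescaling its coefficients. -/
theorem exists_center_ch_eq {f : Lam} (hf : ∀ d, coeff d f ≠ 0 → wt d = n) :
    ∃ x ∈ Subalgebra.center ℂ (GAlg n), ch n x = f := by
  refine ⟨∑ mu : n.Partition, (coeff (exps mu) f * zee mu) • classSum mu,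
    sum_mem fun mu _ => Subalgebra.smul_mem _ (classSum_mem_center mu) _, ?_⟩
  conv_rhs => rw [eq_sum_pPart hf]
  rw [map_sum]
  refine Finset.sum_congr rfl fun mu _ => ?_
  rw [map_smul, ch_classSum, smul_smul, mul_assoc, mul_inv_cancel₀ (zee_ne_zero mu), mul_one]

theorem sum_classSum_eq_zero {a : n.Partition → ℂ} (h : ∑ mu, a mu • classSum mu = 0)
    (mu : n.Partition) : a mu = 0 := by
  have h1 := congrArg (fun x => coeff (exps mu) (ch n x)) h
  simp only [map_sum, map_smul, ch_classSum, coeff_sum, coeff_smul, map_zero, coeff_zero,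
    pPart_eq_monomial, coeff_monomial] at h1
  rw [Finset.sum_eq_single mu] at h1
  · simpa [zee_ne_zero mu] using h1
  · intro nu _ hnu
    rw [if_neg fun h' => hnu (exps_injective n h')]
    simp
  · exact fun h => absurd (Finset.mem_univ _) h

theorem center_eq_sum_classSum {z : GAlg n} (hz : z ∈ Subalgebra.center ℂ (GAlg n)) :
    ∃ a : n.Partition → ℂ, z = ∑ mu, a mu • classSum mu := by
  have h1 : ∀ d, coeff d (ch n z) ≠ 0 → wt d = n := by
    intro d hd
    rw [ch_apply, coeff_sum] at hd
    obtain ⟨g, -, hg⟩ := Finset.exists_ne_zero_of_sum_ne_zero hd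
    rw [coeff_smul, coeff_monomial] at hg
    split_ifs at hg with h2
    · rw [← h2, wt_exps]
    · simp at hg
  refine ⟨fun mu => coeff (exps mu) (ch n z) * zee mu, eq_of_ch_eq hz
    (sum_mem fun mu _ => Subalgebra.smul_mem _ (classSum_mem_center mu) _) ?_⟩
  conv_lhs => rw [eq_sum_pPart h1]
  rw [map_sum]
  refine Finset.sum_congr rfl fun mu _ => ?_
  rw [map_smul, ch_classSum, smul_smul, mul_assoc, mul_inv_cancel₀ (zee_ne_zero mu), mul_one]

end Group

end TwistedCL

end

noncomputable section

namespace TwistedCL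

open MvPolynomial

/-! ### Symmetric polynomials in the Jucys–Murphy elements are central -/

/-- Power sums of two commuting elements are polynomials in their sum and product, through the
recursion `h3`. -/
theorem commute_pow_add_pow {A : Type*} [Ring A] {s u v : A} (huv : u * v = v * u)
    (h1 : Commute s (u + v)) (h2 : Commute s (u * v)) (k : ℕ) : Commute s (u ^ k + v ^ k) := by
  induction k using Nat.strong_induction_on with
  | _ k ih =>
    match k with
    | 0 => simp only [pow_zero]; exact (Commute.one_right s).add_right (Commute.one_right s)
    | 1 => simpa using h1
    | k + 2 =>
      have h3 : u ^ (k + 2) + v ^ (k + 2) =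
          (u + v) * (u ^ (k + 1) + v ^ (k + 1)) - u * v * (u ^ k + v ^ k) := by
        have h4 : u * v * u ^ k = v * u ^ (k + 1) := by
          rw [huv, pow_succ', mul_assoc]
        have h5 : u * v * v ^ k = u * v ^ (k + 1) := by
          rw [pow_succ', mul_assoc]
        rw [mul_add, mul_add, h4, h5, pow_succ' u (k + 1), pow_succ' v (k + 1)]
        noncomm_ring
      rw [h3]
      exact (h1.mul_right (ih (k + 1) (by omega))).sub_right (h2.mul_right (ih k (by omega)))

section JucysMurphy

variable {n : ℕ}

/-- The power sums of the Jucys–Murphy elements. -/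
def jmPow (n k : ℕ) : GAlg n := ∑ b : Fin n, jm b ^ k

theorem elt_one : (elt 1 : GAlg n) = 1 := rfl

theorem jm_commute_of_gt {i : ℕ} (hi : i + 1 < n) (b : Fin n) (hb : i + 1 < (b : ℕ)) :
    Commute (elt (Equiv.swap ⟨i, by omega⟩ ⟨i + 1, hi⟩)) (jm b) :=
  (jm_comm_swap b _ _ (Fin.lt_def.2 (by simpa using by omega)) (Fin.lt_def.2 (by simpa using hb))).symm

theorem jm_commute_of_lt {i : ℕ} (hi : i + 1 < n) (b : Fin n) (hb : (b : ℕ) < i) :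
    Commute (elt (Equiv.swap ⟨i, by omega⟩ ⟨i + 1, hi⟩)) (jm b) := by
  unfold jm
  refine Commute.sum_right _ _ _ fun a ha => ?_
  have ha' : (a : ℕ) < b := Fin.lt_def.1 (Finset.mem_filter.1 ha).2
  unfold Commute SemiconjBy
  rw [elt_mul, elt_mul, Equiv.swap_mul_eq_mul_swap]
  congr 3
  · rw [Equiv.swap_inv, Equiv.swap_apply_of_ne_of_ne] <;> simp [Fin.ext_iff] <;> omega
  · rw [Equiv.swap_inv, Equiv.swap_apply_of_ne_of_ne] <;> simp [Fin.ext_iff] <;> omega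

/-- Conjugation by the adjacent transposition s carries the transpositions in 𝒥_i to those in
𝒥_{i+1} other than s itself; that one contributes s² = 1. This is the relation of the degenerate
affine Hecke algebra. -/
theorem swap_mul_jm {i : ℕ} (hi : i + 1 < n) :
    elt (Equiv.swap (⟨i, by omega⟩ : Fin n) ⟨i + 1, hi⟩) * jm ⟨i, by omega⟩ =
      jm ⟨i + 1, hi⟩ * elt (Equiv.swap (⟨i, by omega⟩ : Fin n) ⟨i + 1, hi⟩) - 1 := by
  set a : Fin n := ⟨i, by omega⟩
  set b : Fin n := ⟨i + 1, hi⟩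
  have hab : a < b := Fin.lt_def.2 (Nat.lt_succ_self i)
  have h1 : (Finset.univ.filter fun c : Fin n => c < b) =
      insert a (Finset.univ.filter fun c : Fin n => c < a) := by
    ext c
    simp only [Finset.mem_filter, Finset.mem_univ, true_and, Finset.mem_insert, Fin.lt_def,
      Fin.ext_iff, a, b]
    omega
  unfold jm
  rw [h1, Finset.sum_insert (by simp), add_mul, elt_mul, Equiv.swap_mul_self, elt_one,
    add_sub_cancel_left, Finset.mul_sum, Finset.sum_mul]
  refine Finset.sum_congr rfl fun c hc => ?_
  have hc' : c < a := (Finset.mem_filter.1 hc).2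
  rw [elt_mul, elt_mul, Equiv.mul_swap_eq_swap_mul, Equiv.swap_apply_left,
    Equiv.swap_apply_of_ne_of_ne hc'.ne (hc'.trans hab).ne]

/-- The transposition commutes with the sum and the product of its two neighbouring Jucys–Murphy
elements and with each of the others individually. -/
theorem swap_commute_jmPow {i : ℕ} (hi : i + 1 < n) (k : ℕ) :
    Commute (elt (Equiv.swap (⟨i, by omega⟩ : Fin n) ⟨i + 1, hi⟩)) (jmPow n k) := by
  set a : Fin n := ⟨i, by omega⟩ with ha
  set b : Fin n := ⟨i + 1, hi⟩ with hb
  set s := elt (Equiv.swap a b)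
  have hab : a ≠ b := by simp [ha, hb]
  have hss : s * s = 1 := by rw [elt_mul, Equiv.swap_mul_self, elt_one]
  have h1 : s * jm a = jm b * s - 1 := swap_mul_jm hi
  -- The relation `h1` multiplied by s on both sides.
  have h2 : jm a * s = s * jm b - 1 := by
    have h3 : s * (s * jm a) * s = s * (jm b * s - 1) * s := by rw [h1]
    rw [← mul_assoc s s, hss, one_mul] at h3
    rw [h3, mul_sub, sub_mul, mul_one, hss, ← mul_assoc, mul_assoc, hss, mul_one]
  have h3 : Commute s (jm a + jm b) := by
    unfold Commute SemiconjBy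
    rw [mul_add, add_mul, h1, h2]
    abel
  have h4 : Commute s (jm a * jm b) := by
    unfold Commute SemiconjBy
    rw [← mul_assoc, h1, sub_mul, one_mul, mul_assoc, eq_add_of_sub_eq h2.symm, mul_add, mul_one,
      add_sub_cancel_right, ← mul_assoc, jm_comm]
  unfold jmPow
  rw [← Finset.sum_filter_add_sum_filter_not Finset.univ fun c => c = a ∨ c = b]
  refine Commute.add_right ?_ (Commute.sum_right _ _ _ fun c hc => Commute.pow_right ?_ k)
  · have h5 : (Finset.univ.filter fun c => c = a ∨ c = b) = {a, b} := by
      ext c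
      simp
    rw [h5, Finset.sum_pair hab]
    exact commute_pow_add_pow (jm_comm a b) h3 h4 k
  · have h5 := (Finset.mem_filter.1 hc).2
    rw [not_or, Fin.ext_iff, Fin.ext_iff] at h5
    simp only [ha, hb] at h5
    rcases lt_or_ge (c : ℕ) i with h6 | h6
    · exact jm_commute_of_lt hi c h6
    · exact jm_commute_of_gt hi c (by omega)

theorem jmPow_mem_center (n k : ℕ) : jmPow n k ∈ Subalgebra.center ℂ (GAlg n) := by
  refine mem_center_iff.2 fun g => ?_
  rcases n with _ | n
  · rw [Subsingleton.elim g 1, elt_one, one_mul, mul_one]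
  · have h1 : g ∈ Submonoid.closure
        (Set.range fun i : Fin n => Equiv.swap i.castSucc i.succ) := by
      rw [Equiv.Perm.mclosure_swap_castSucc_succ]
      exact Submonoid.mem_top g
    induction h1 using Submonoid.closure_induction with
    | mem x hx =>
      obtain ⟨i, rfl⟩ := hx
      exact swap_commute_jmPow (i := i) (by omega) k
    | one => rw [elt_one, one_mul, mul_one]
    | mul x y _ _ hx hy => rw [← elt_mul, mul_assoc, hy, ← mul_assoc, hx, mul_assoc]

/-- The evaluation at the Jucys–Murphy elements as an algebra homomorphism. -/
def jmHom (n : ℕ) : LamP0 →ₐ[ℂ] GAlg n :=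
  (jmAlg n).val.comp (MvPolynomial.aeval
    (fun k : ℕ => (∑ b : Fin n, ⟨jm b, Algebra.subset_adjoin ⟨b, rfl⟩⟩ ^ k : jmAlg n)))

theorem jmEval_eq (n : ℕ) (G : LamP0) : jmEval n G = jmHom n G := rfl

theorem jmEval_add (G H : LamP0) : jmEval n (G + H) = jmEval n G + jmEval n H := by
  simp only [jmEval_eq, map_add]

theorem jmEval_mul (G H : LamP0) : jmEval n (G * H) = jmEval n G * jmEval n H := by
  simp only [jmEval_eq, map_mul]

theorem jmEval_C (c : ℂ) : jmEval n (C c) = c • 1 := by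
  rw [jmEval_eq, ← algebraMap_eq, AlgHom.commutes, Algebra.algebraMap_eq_smul_one]

theorem jmEval_X (k : ℕ) : jmEval n (X k) = jmPow n k := by
  unfold jmEval jmPow
  rw [aeval_X]
  simp

theorem jmEval_mem_center (G : LamP0) : jmEval n G ∈ Subalgebra.center ℂ (GAlg n) := by
  induction G using MvPolynomial.induction_on with
  | C a => rw [jmEval_C]; exact Subalgebra.smul_mem _ (one_mem _) _
  | add p q hp hq => rw [jmEval_add]; exact add_mem hp hq
  | mul_X p k hp => rw [jmEval_mul, jmEval_X]; exact mul_mem hp (jmPow_mem_center n k)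

end JucysMurphy

end TwistedCL

end

noncomputable section

namespace TwistedCL

open MvPolynomial

/-! ### Multiplication by the sum of transpositions -/

theorem powProd_cons (a : ℕ) (s : Multiset ℕ) : powProd (a ::ₘ s) = X a.toPNat' * powProd s := by
  simp [powProd]

theorem powProd_pair (a b : ℕ) : powProd {a, b} = X a.toPNat' * X b.toPNat' := by
  simp [powProd]

theorem derivation_powProd (D : Derivation ℂ Lam Lam) (s : Multiset ℕ) :
    D (powProd s) = (s.map fun m => powProd (s.erase m) * D (X m.toPNat')).sum := by
  induction s using Multiset.induction_on with
  | empty => simp [powProd]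
  | cons a s ih =>
    rw [powProd_cons, Derivation.leibniz, ih, Multiset.map_cons, Multiset.sum_cons,
      Multiset.erase_cons_head, smul_eq_mul, smul_eq_mul, add_comm, ← Multiset.sum_map_mul_left]
    congr 2
    refine Multiset.map_congr rfl fun m hm => ?_
    rw [← mul_assoc, ← powProd_cons]
    congr 2
    rcases eq_or_ne m a with rfl | h
    · rw [Multiset.erase_cons_head, Multiset.cons_erase hm]
    · rw [Multiset.erase_cons_tail _ h.symm]

theorem coe_toPNat' {m : ℕ} (hm : 0 < m) : ((m.toPNat' : ℕ+) : ℕ) = m := by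
  rw [Nat.toPNat'_coe, if_pos hm]

theorem sum_Icc_ite {A : Type*} [AddCommMonoid A] {M : ℕ+} {m : ℕ} (hm : 0 < m) (hM : m ≤ M)
    (F : ℕ+ → A) : ∑ i ∈ Finset.Icc 1 M, (if m.toPNat' = i then F i else 0) = F m.toPNat' := by
  rw [Finset.sum_ite_eq, if_pos]
  rw [Finset.mem_Icc]
  refine ⟨one_le, ?_⟩
  rw [← PNat.coe_le_coe, coe_toPNat' hm]
  exact hM

theorem sum_Icc_add_eq {A : Type*} [AddCommMonoid A] {M : ℕ+} {m : ℕ} (hm : 0 < m) (hM : m ≤ M)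
    (F : ℕ+ → ℕ+ → A) :
    ∑ i ∈ Finset.Icc 1 M, ∑ j ∈ Finset.Icc 1 M, (if m.toPNat' = i + j then F i j else 0) =
      ∑ j ∈ Finset.Ioo 0 m, F j.toPNat' (m - j).toPNat' := by
  rw [← Finset.sum_product', ← Finset.sum_filter]
  refine Finset.sum_bij' (fun x _ => (x.1 : ℕ)) (fun j _ => (j.toPNat', (m - j).toPNat'))
    ?_ ?_ ?_ ?_ ?_
  · rintro ⟨i, j⟩ h
    have h1 := congrArg PNat.val (Finset.mem_filter.1 h).2
    have hi := i.pos
    have hj := j.pos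
    change ((m.toPNat' : ℕ+) : ℕ) = ((i + j : ℕ+) : ℕ) at h1
    rw [coe_toPNat' hm, PNat.add_coe] at h1
    rw [Finset.mem_Ioo]
    change 0 < (i : ℕ) ∧ (i : ℕ) < m
    omega
  · intro j h
    obtain ⟨h1, h2⟩ := Finset.mem_Ioo.1 h
    rw [Finset.mem_filter, Finset.mem_product, Finset.mem_Icc, Finset.mem_Icc]
    refine ⟨⟨⟨one_le, ?_⟩, ⟨one_le, ?_⟩⟩, ?_⟩
    · change ((j.toPNat' : ℕ+) : ℕ) ≤ M
      rw [coe_toPNat' h1]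
      omega
    · change (((m - j).toPNat' : ℕ+) : ℕ) ≤ M
      rw [coe_toPNat' (by omega)]
      omega
    · refine PNat.eq ?_
      rw [PNat.add_coe, coe_toPNat' hm]
      change m = ((j.toPNat' : ℕ+) : ℕ) + (((m - j).toPNat' : ℕ+) : ℕ)
      rw [coe_toPNat' h1, coe_toPNat' (by omega)]
      omega
  · rintro ⟨i, j⟩ h
    have h1 := congrArg PNat.val (Finset.mem_filter.1 h).2
    have hi := i.pos
    have hj := j.pos
    change ((m.toPNat' : ℕ+) : ℕ) = ((i + j : ℕ+) : ℕ) at h1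
    rw [coe_toPNat' hm, PNat.add_coe] at h1
    refine Prod.ext (PNat.eq ?_) (PNat.eq ?_)
    · change ((((i : ℕ)).toPNat' : ℕ+) : ℕ) = i
      rw [coe_toPNat' hi]
    · change (((m - (i : ℕ)).toPNat' : ℕ+) : ℕ) = j
      rw [coe_toPNat' (by omega)]
      omega
  · intro j h
    obtain ⟨h1, h2⟩ := Finset.mem_Ioo.1 h
    exact coe_toPNat' h1
  · rintro ⟨i, j⟩ h
    have h1 := congrArg PNat.val (Finset.mem_filter.1 h).2
    have hi := i.pos
    have hj := j.pos
    change ((m.toPNat' : ℕ+) : ℕ) = ((i + j : ℕ+) : ℕ) at h1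
    rw [coe_toPNat' hm, PNat.add_coe] at h1
    change F i j = F ((i : ℕ).toPNat') ((m - (i : ℕ)).toPNat')
    congr 1
    · refine PNat.eq ?_
      rw [coe_toPNat' hi]
    · refine PNat.eq ?_
      rw [coe_toPNat' (by omega)]
      omega

theorem toPNat'_add {a b : ℕ} (ha : 0 < a) (hb : 0 < b) :
    (a + b).toPNat' = a.toPNat' + b.toPNat' := by
  refine PNat.eq ?_
  rw [PNat.add_coe, coe_toPNat' ha, coe_toPNat' hb, coe_toPNat' (by omega)]

/-- The right side has the shape of `sum_swap_mul`. The first-order terms replace a part k by a pair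
j, k - j, and the second-order terms replace two parts k, m by k + m; derivatives supply the
multiplicities k and m. -/
theorem two_cutJoin_powProd {M : ℕ+} {s : Multiset ℕ} (hs : ∀ m ∈ s, 0 < m ∧ m ≤ M) :
    (2 : ℂ) • cutJoin M (powProd s) = (s.map fun k => k •
      (∑ j ∈ Finset.Ioo 0 k, powProd (s.erase k + {j, k - j}) +
        ((s.erase k).map fun m => m • powProd ((s.erase k).erase m + {k + m})).sum)).sum := by
  have hcut : ∑ i ∈ Finset.Icc 1 M, ∑ j ∈ Finset.Icc 1 M, X i * X j * dP (i + j) (powProd s) =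
      (s.map fun k => k • ∑ j ∈ Finset.Ioo 0 k, powProd (s.erase k + {j, k - j})).sum := by
    rw [← Finset.sum_product', ← sum_smul_derivation_apply (Finset.Icc 1 M ×ˢ Finset.Icc 1 M)
      (fun x => X x.1 * X x.2) (fun x => dP (x.1 + x.2)), derivation_powProd]
    congr 1
    refine Multiset.map_congr rfl fun k hk => ?_
    obtain ⟨hk0, hkM⟩ := hs k hk
    rw [sum_smul_derivation_apply, Finset.sum_product (f := fun x : ℕ+ × ℕ+ =>
      (X x.1 * X x.2 : Lam) * dP (x.1 + x.2) (X k.toPNat'))]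
    have h1 : ∀ i j : ℕ+, (X i * X j : Lam) * dP (i + j) (X k.toPNat') =
        if k.toPNat' = i + j then (k : ℂ) • (X i * X j : Lam) else 0 := by
      intro i j
      rw [dP_X]
      split_ifs with h
      · rw [← h, coe_toPNat' hk0, mul_comm, C_mul']
      · rw [mul_zero]
    simp only [h1]
    rw [sum_Icc_add_eq hk0 hkM fun i j => (k : ℂ) • (X i * X j : Lam), Finset.mul_sum,
      Finset.smul_sum]
    refine Finset.sum_congr rfl fun j _ => ?_
    rw [mul_smul_comm, powProd_add, powProd_pair, Nat.cast_smul_eq_nsmul]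
  have hjoin : ∑ i ∈ Finset.Icc 1 M, ∑ j ∈ Finset.Icc 1 M, X (i + j) * dP i (dP j (powProd s)) =
      (s.map fun k => k •
        ((s.erase k).map fun m => m • powProd ((s.erase k).erase m + {k + m})).sum).sum := by
    rw [Finset.sum_comm]
    have h1 : ∀ j, ∑ i ∈ Finset.Icc 1 M, X (i + j) * dP i (dP j (powProd s)) =
        (s.map fun k : ℕ => if k.toPNat' = j then (k : ℂ) •
          ((∑ i ∈ Finset.Icc 1 M, (X (i + j) : Lam) • dP i) (powProd (s.erase k))) else 0).sum := by
      intro j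
      rw [← sum_smul_derivation_apply, derivation_powProd, map_multiset_sum, Multiset.map_map]
      congr 1
      refine Multiset.map_congr rfl fun k hk => ?_
      rw [Function.comp_apply, dP_X]
      split_ifs with h
      · rw [← h, coe_toPNat' (hs k hk).1, mul_comm, C_mul', Derivation.map_smul]
      · rw [mul_zero, map_zero]
    rw [Finset.sum_congr rfl fun j _ => h1 j]
    refine (Multiset.sum_map_sum_map _ _).trans ?_
    congr 1
    refine Multiset.map_congr rfl fun k hk => ?_
    obtain ⟨hk0, hkM⟩ := hs k hk
    refine (sum_Icc_ite hk0 hkM fun j => (k : ℂ) •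
      ((∑ i ∈ Finset.Icc 1 M, (X (i + j) : Lam) • dP i) (powProd (s.erase k)))).trans ?_
    rw [Nat.cast_smul_eq_nsmul, derivation_powProd]
    congr 2
    refine Multiset.map_congr rfl fun m hm => ?_
    obtain ⟨hm0, hmM⟩ := hs m (Multiset.mem_of_mem_erase hm)
    rw [sum_smul_derivation_apply]
    have h2 : ∀ i : ℕ+, (X (i + k.toPNat') : Lam) * dP i (X m.toPNat') =
        if m.toPNat' = i then (m : ℂ) • (X (i + k.toPNat') : Lam) else 0 := by
      intro i
      rw [dP_X]
      split_ifs with h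
      · rw [← h, coe_toPNat' hm0, mul_comm, C_mul']
      · rw [mul_zero]
    rw [Finset.sum_congr rfl fun i _ => h2 i,
      sum_Icc_ite hm0 hmM fun i => (m : ℂ) • (X (i + k.toPNat') : Lam), mul_smul_comm, powProd_add,
      ← toPNat'_add hm0 hk0, Nat.cast_smul_eq_nsmul, add_comm m k]
    simp [powProd]
  rw [cutJoin_apply, smul_smul]
  rw [mul_one_div_cancel two_ne_zero, one_smul]
  simp only [Finset.sum_add_distrib, smul_add]
  rw [hcut, hjoin, Multiset.sum_map_add]

section JucysMurphySum

variable {n : ℕ}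

theorem sum_jm_eq : jmPow n 1 = ∑ b : Fin n, ∑ a : Fin n with a < b, elt (Equiv.swap a b) := by
  simp only [jmPow, pow_one]
  rfl

theorem two_jmPow_one :
    (2 : ℂ) • jmPow n 1 = ∑ a : Fin n, ∑ b : Fin n with b ≠ a, elt (Equiv.swap a b) := by
  have h1 : ∀ a : Fin n, ∑ b : Fin n with b ≠ a, elt (Equiv.swap a b) =
      ∑ b : Fin n with b < a, elt (Equiv.swap b a) + ∑ b : Fin n with a < b, elt (Equiv.swap a b) := by
    intro a
    have h2 : (Finset.univ.filter fun b : Fin n => b ≠ a) =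
        Finset.univ.filter (fun b => b < a) ∪ Finset.univ.filter fun b => a < b := by
      ext b
      simp only [Finset.mem_filter, Finset.mem_univ, true_and, Finset.mem_union]
      exact ne_iff_lt_or_gt
    rw [h2, Finset.sum_union]
    · simp only [Equiv.swap_comm]
    · rw [Finset.disjoint_filter]
      exact fun b _ h => h.asymm
  rw [Finset.sum_congr rfl fun a _ => h1 a, Finset.sum_add_distrib, two_smul]
  congr 1
  · exact sum_jm_eq
  · rw [sum_jm_eq]
    simp only [Finset.sum_filter]
    rw [Finset.sum_comm]

/-- On a single permutation both sides, doubled, are the same sum over ordered pairs of distinct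
points. No part exceeds n, so truncation at M ≥ n is harmless. -/
theorem ch_jmPow_one_mul {M : ℕ+} (hM : n ≤ M) (x : GAlg n) :
    ch n (jmPow n 1 * x) = cutJoin M (ch n x) := by
  have : ch n ∘ₗ LinearMap.mulLeft ℂ (jmPow n 1) = cutJoin M ∘ₗ ch n := by
    refine gAlg_hom_ext fun g => ?_
    refine smul_right_injective Lam (two_ne_zero : (2 : ℂ) ≠ 0) ?_
    change (2 : ℂ) • ch n (jmPow n 1 * elt g) = (2 : ℂ) • cutJoin M (ch n (elt g))
    have h1 : ∀ m ∈ g.partition.parts, 0 < m ∧ m ≤ (M : ℕ) := by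
      intro m hm
      refine ⟨g.partition.parts_pos hm, (Multiset.le_sum_of_mem hm).trans ?_⟩
      rw [g.partition.parts_sum, Fintype.card_fin]
      exact hM
    rw [← map_smul, ← smul_mul_assoc, two_jmPow_one, ch_elt, map_smul, smul_comm (2 : ℂ), pPart]
    change _ = _ • (2 : ℂ) • cutJoin M (powProd g.partition.parts)
    rw [two_cutJoin_powProd h1, ← sum_swap_mul g powProd, Finset.sum_mul, map_sum, Finset.smul_sum]
    refine Finset.sum_congr rfl fun a _ => ?_
    rw [Finset.sum_mul, map_sum, Finset.smul_sum]
    refine Finset.sum_congr rfl fun b _ => ?_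
    rw [elt_mul, ch_elt]
    rfl
  exact LinearMap.congr_fun this x

end JucysMurphySum

/-! ### The inclusion of group algebras -/

section Inclusion

variable {n : ℕ}

/-- The inclusion `ℂ[S_n] → ℂ[S_{n+1}]`. -/
def incl (n : ℕ) : GAlg n →ₐ[ℂ] GAlg (n + 1) :=
  MonoidAlgebra.mapDomainAlgHom ℂ ℂ (Equiv.Perm.viaEmbeddingHom Fin.castSuccEmb)

theorem incl_elt (g : Equiv.Perm (Fin n)) :
    incl n (elt g) = elt (g.viaEmbedding Fin.castSuccEmb) := by
  exact MonoidAlgebra.mapDomain_single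

theorem viaEmbedding_castSucc (g : Equiv.Perm (Fin n)) (a : Fin n) :
    g.viaEmbedding Fin.castSuccEmb a.castSucc = (g a).castSucc :=
  Equiv.Perm.viaEmbedding_apply g Fin.castSuccEmb a

theorem viaEmbedding_last (g : Equiv.Perm (Fin n)) :
    g.viaEmbedding Fin.castSuccEmb (Fin.last n) = Fin.last n := by
  refine Equiv.Perm.viaEmbedding_apply_of_notMem g _ _ ?_
  rintro ⟨a, ha⟩
  exact (Fin.castSucc_lt_last a).ne ha

theorem viaEmbedding_swap (a b : Fin n) :
    (Equiv.swap a b).viaEmbedding Fin.castSuccEmb =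
      Equiv.swap a.castSucc b.castSucc := by
  ext1 c
  induction c using Fin.lastCases with
  | last =>
    rw [viaEmbedding_last, Equiv.swap_apply_of_ne_of_ne (Fin.castSucc_lt_last a).ne'
      (Fin.castSucc_lt_last b).ne']
  | cast c =>
    rw [viaEmbedding_castSucc, Equiv.swap_apply_def, Equiv.swap_apply_def]
    simp only [Fin.castSucc_inj]
    split_ifs <;> rfl

theorem incl_jm (b : Fin n) : incl n (jm b) = jm b.castSucc := by
  unfold jm
  rw [map_sum, Finset.sum_congr rfl fun a _ => by rw [incl_elt, viaEmbedding_swap],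
    Finset.sum_filter, Finset.sum_filter, Fin.sum_univ_castSucc, if_neg (Fin.le_last _).not_gt,
    add_zero]
  simp only [Fin.castSucc_lt_castSucc_iff]

theorem jmPow_succ (k : ℕ) : jmPow (n + 1) k = incl n (jmPow n k) + jm (Fin.last n) ^ k := by
  unfold jmPow
  rw [Fin.sum_univ_castSucc, map_sum]
  simp only [map_pow, incl_jm]

theorem parts_viaEmbedding (g : Equiv.Perm (Fin n)) :
    (g.viaEmbedding Fin.castSuccEmb).partition.parts = 1 ::ₘ g.partition.parts := by
  classical
  have h1 : (g.viaEmbedding Fin.castSuccEmb).cycleType = g.cycleType := by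
    unfold Equiv.Perm.viaEmbedding
    convert Equiv.Perm.cycleType_extendDomain
      (Equiv.ofInjective _ Fin.castSuccEmb.injective) <;> rfl
  rw [Equiv.Perm.parts_partition, Equiv.Perm.parts_partition, ← Equiv.Perm.sum_cycleType,
    ← Equiv.Perm.sum_cycleType, h1, Fintype.card_fin, Fintype.card_fin, ← Multiset.add_cons,
    ← Multiset.replicate_succ]
  congr 2
  have h2 := g.sum_cycleType
  have h3 := g.support.card_le_univ
  rw [Fintype.card_fin] at h3
  omega

/-- The inclusion adds a fixed point, a factor P_1, and the normalisation changes from n! to (n +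
1)!. -/
theorem ch_incl (x : GAlg n) : ch (n + 1) (incl n x) = ((n + 1 : ℕ) : ℂ)⁻¹ • (X 1 * ch n x) := by
  have : ch (n + 1) ∘ₗ (incl n).toLinearMap =
      ((n + 1 : ℕ) : ℂ)⁻¹ • (LinearMap.mulLeft ℂ (X 1) ∘ₗ ch n) := by
    refine gAlg_hom_ext fun g => ?_
    change ch (n + 1) (incl n (elt g)) = ((n + 1 : ℕ) : ℂ)⁻¹ • (X 1 * ch n (elt g))
    rw [incl_elt, ch_elt, ch_elt, mul_smul_comm, smul_smul, Nat.factorial_succ, Nat.cast_mul,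
      mul_inv]
    congr 1
    change powProd (g.viaEmbedding Fin.castSuccEmb).partition.parts =
      _ * powProd g.partition.parts
    rw [parts_viaEmbedding, powProd_cons]
    rfl
  exact LinearMap.congr_fun this x

end Inclusion

end TwistedCL

end

noncomputable section

namespace TwistedCL

open MvPolynomial

/-! ### Jucys–Murphy evaluations act on Schur functions by contents -/

theorem wt_of_coeff_hDet_ne_zero {N n : ℕ} {l v : Fin N → ℤ} (h : ∑ p, l p + ∑ p, v p = n)
    {d : ℕ+ →₀ ℕ} (hd : coeff d (hDet l v) ≠ 0) : wt d = n := by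
  have key : IsWeightedHomogeneous (fun i : ℕ+ => (i : ℕ)) (hDet l v) n := by
    unfold hDet
    rw [Matrix.det_apply]
    refine IsWeightedHomogeneous.sum _ _ _ fun s _ => ?_
    rw [Units.smul_def, zsmul_eq_mul]
    rw [← zero_add n]
    refine IsWeightedHomogeneous.mul ?_ ?_
    · rw [← map_intCast (C : ℂ →+* Lam)]
      exact isWeightedHomogeneous_C _ _
    · by_cases hneg : ∃ i, l (s i) + v i < 0
      · obtain ⟨i, hi⟩ := hneg
        rw [Finset.prod_eq_zero (Finset.mem_univ i)]
        · exact isWeightedHomogeneous_zero _ _ _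
        · exact hInt_neg hi
      · push Not at hneg
        have h1 : n = ∑ i, (l (s i) + v i).toNat := by
          zify
          rw [Finset.sum_congr rfl fun i _ => Int.toNat_of_nonneg (hneg i), Finset.sum_add_distrib,
            Equiv.sum_comp s l, h]
        rw [h1]
        refine IsWeightedHomogeneous.prod _ _ _ fun i _ e he => ?_
        rw [Matrix.of_apply, coeff_hInt] at he
        have h2 : ((wt e : ℕ) : ℤ) = l (s i) + v i := by
          by_contra hc
          exact he (if_neg hc)
        change wt e = _
        omega
  exact key hd

theorem exists_corner {N n : ℕ} {l : Fin N → ℤ} (hl : l ∈ rowSet N (n + 1)) :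
    ∃ p, l + Pi.single p (-1) ∈ rowSet N n := by
  obtain ⟨h1, h2, h3⟩ := mem_rowSet.1 hl
  have hne : (Finset.univ.filter fun p : Fin N => 0 < l p + p).Nonempty := by
    by_contra hc
    rw [Finset.not_nonempty_iff_eq_empty, Finset.filter_eq_empty_iff] at hc
    have h4 : ∑ p, l p + ∑ p, idv N p ≤ 0 := by
      rw [← Finset.sum_add_distrib]
      exact Finset.sum_nonpos fun p _ => not_lt.1 (hc (Finset.mem_univ p))
    rw [h3] at h4
    push_cast at h4
    omega
  -- The last nonempty row always ends in a removable box.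
  obtain ⟨p, hp, hmax⟩ := Finset.exists_max_image _ (fun p : Fin N => p) hne
  have hp0 : 0 < l p + p := (Finset.mem_filter.1 hp).2
  refine ⟨p, mem_rowSet.2 ⟨fun a b hab => ?_, fun q => ?_, ?_⟩⟩
  · have h4 := h1 hab
    have h5 := h2 b
    simp only [Pi.add_apply, Pi.single_apply]
    have hab' := Fin.lt_def.1 hab
    by_cases ha : a = p
    · subst ha
      rw [if_pos rfl, if_neg hab.ne']
      have h6 : ¬ 0 < l b + b := fun hc =>
        absurd (hmax b (Finset.mem_filter.2 ⟨Finset.mem_univ _, hc⟩)) (not_le.2 hab)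
      omega
    · rw [if_neg ha]
      split_ifs <;> omega
  · have h4 := h2 q
    simp only [Pi.add_apply, Pi.single_apply]
    split_ifs with h
    · subst h
      omega
    · omega
  · rw [sum_add_single_id]
    push_cast at h3
    omega

theorem exists_rowSet_center {N n : ℕ} {l : Fin N → ℤ} (hl : l ∈ rowSet N n) :
    ∃ x ∈ Subalgebra.center ℂ (GAlg n), ch n x = hDet l (idv N) :=
  exists_center_ch_eq fun _ hd => wt_of_coeff_hDet_ne_zero (mem_rowSet.1 hl).2.2 hd

theorem jmPow_one_mul_of_ch_eq {N n : ℕ} {l : Fin N → ℤ} (hl : l ∈ rowSet N n) {x : GAlg n}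
    (hx : x ∈ Subalgebra.center ℂ (GAlg n)) (h : ch n x = hDet l (idv N)) :
    jmPow n 1 * x = contSum l • x := by
  refine eq_of_ch_eq (mul_mem (jmPow_mem_center n 1) hx) (Subalgebra.smul_mem _ hx _) ?_
  obtain ⟨M, hM⟩ : ∃ M : ℕ+, (M : ℕ) = n + N + 1 := ⟨_, coe_toPNat' (Nat.succ_pos _)⟩
  rw [ch_jmPow_one_mul (M := M) (by omega) x, h, cutJoin_hDet, map_smul, h]
  · intro p
    have := le_of_mem_rowSet hl p
    rw [hM]
    push_cast
    omega
  · rw [(mem_rowSet.1 hl).2.2, hM]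
    push_cast
    omega

/-- Pieri's rule splits ch(y) into eigenvectors of the cut-and-join operator. Adding a box to row p
raises the content sum by m_p, so a polynomial R in the sum of transpositions acts there by
R(`contSum m` + m_p). -/
theorem ch_aeval_mul {N n : ℕ} (hn : n ≤ N) {m : Fin (N + 1) → ℤ} (hm : m ∈ rowSet (N + 1) n)
    {y : GAlg (n + 1)} (hy : ch (n + 1) y = ((n + 1 : ℕ) : ℂ)⁻¹ • (X 1 * hDet m (idv (N + 1))))
    (R : Polynomial ℂ) :
    ch (n + 1) (Polynomial.aeval (jmPow (n + 1) 1) R * y) =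
      ∑ p, (((n + 1 : ℕ) : ℂ)⁻¹ * R.eval (contSum m + m p)) •
        hDet (m + Pi.single p 1) (idv (N + 1)) := by
  obtain ⟨M, hM⟩ : ∃ M : ℕ+, (M : ℕ) = n + N + 3 := ⟨_, coe_toPNat' (Nat.succ_pos _)⟩
  have key : ∀ k : ℕ, ch (n + 1) (jmPow (n + 1) 1 ^ k * y) =
      ∑ p, (((n + 1 : ℕ) : ℂ)⁻¹ * (contSum m + m p) ^ k) •
        hDet (m + Pi.single p 1) (idv (N + 1)) := by
    intro k
    induction k with
    | zero =>
      rw [pow_zero, one_mul, hy, X_one_mul_hDet (last_of_mem_rowSet hm hn), Finset.smul_sum]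
      simp only [pow_zero, mul_one]
    | succ k ih =>
      rw [pow_succ', mul_assoc,
        ch_jmPow_one_mul (M := M) (by omega), ih, map_sum]
      refine Finset.sum_congr rfl fun p _ => ?_
      rw [map_smul, cutJoin_hDet, contSum_add_single, smul_smul]
      · congr 1
        push_cast
        ring
      · intro q
        have := le_of_mem_rowSet hm q
        simp only [hM, Pi.add_apply, Pi.single_apply]
        push_cast
        split_ifs <;> omega
      · rw [sum_add_single_id]
        have := (mem_rowSet.1 hm).2.2
        rw [hM]
        push_cast
        omega
  induction R using Polynomial.induction_on' with
  | add p q hp hq =>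
    rw [map_add, add_mul, map_add, hp, hq, ← Finset.sum_add_distrib]
    refine Finset.sum_congr rfl fun p _ => ?_
    rw [Polynomial.eval_add, mul_add, add_smul]
  | monomial k a =>
    rw [Polynomial.aeval_monomial, ← Algebra.smul_def, smul_mul_assoc, map_smul, key,
      Finset.smul_sum]
    refine Finset.sum_congr rfl fun p _ => ?_
    rw [Polynomial.eval_monomial, smul_smul]
    congr 1
    ring

theorem aeval_mem_center {n : ℕ} {z : GAlg n} (hz : z ∈ Subalgebra.center ℂ (GAlg n))
    (R : Polynomial ℂ) : Polynomial.aeval z R ∈ Subalgebra.center ℂ (GAlg n) :=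
  Algebra.adjoin_le (Set.singleton_subset_iff.2 hz) (Polynomial.aeval_mem_adjoin_singleton ℂ z)

/-- Induction on n by removing a box of l. An element over the smaller Schur function is included in
the larger group algebra, where P_k(𝒥) acts on it as a polynomial in the central sum T of all
transpositions; interpolation in T then isolates the component of l. -/
theorem ch_jmPow_mul {N : ℕ} {n : ℕ} (hn : n ≤ N) {l : Fin (N + 1) → ℤ}
    (hl : l ∈ rowSet (N + 1) n) (k : ℕ) {x : GAlg n} {c : ℂ}
    (hx : ch n x = c • hDet l (idv (N + 1))) :
    ch n (jmPow n k * x) = (contPow k l * c) • hDet l (idv (N + 1)) := by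
  -- One representative q of the Schur function is enough, and it need not be chosen central,
  -- because P_k(𝒥) is.
  suffices h : ∃ q, ch n q = hDet l (idv (N + 1)) ∧
      ch n (jmPow n k * q) = contPow k l • hDet l (idv (N + 1)) by
    obtain ⟨q, h1, h2⟩ := h
    rw [ch_center_mul_congr (y := c • q) (jmPow_mem_center n k) (by rw [hx, map_smul, h1]),
      mul_smul_comm, map_smul, h2, smul_smul, mul_comm]
  clear hx x c
  induction n generalizing l with
  | zero =>
    refine ⟨1, ?_, ?_⟩
    · rw [rowSet_zero, Finset.mem_singleton] at hl
      rw [hl, hDet_neg_idv]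
      rw [← elt_one, ch_elt, pPart]
      have h1 : (prt (1 : Equiv.Perm (Fin 0))).parts = 0 :=
        Multiset.eq_zero_of_forall_notMem fun a ha => by
          have h2 := Multiset.le_sum_of_mem ha
          have h3 := (prt (1 : Equiv.Perm (Fin 0))).parts_pos ha
          rw [(prt (1 : Equiv.Perm (Fin 0))).parts_sum] at h2
          omega
      rw [h1]
      simp [powProd]
    · rw [rowSet_zero, Finset.mem_singleton] at hl
      subst hl
      simp [jmPow, contPow, idv]
  | succ n ih =>
    obtain ⟨p, hp⟩ := exists_corner hl
    set m := l + Pi.single p (-1) with hm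
    have hlm : m + Pi.single p 1 = l := by
      rw [hm, add_assoc, ← Pi.single_add]
      simp
    obtain ⟨x, hxc, hx⟩ := exists_rowSet_center hp
    obtain ⟨q, hq1, hq2⟩ := ih (by omega) hp
    set T := jmPow (n + 1) 1 with hT
    have hTc : T ∈ Subalgebra.center ℂ (GAlg (n + 1)) := jmPow_mem_center _ _
    have hkx : jmPow n k * x = contPow k m • x := by
      refine eq_of_ch_eq (mul_mem (jmPow_mem_center n k) hxc) (Subalgebra.smul_mem _ hxc _) ?_
      rw [ch_center_mul_congr (y := q) (jmPow_mem_center n k) (by rw [hx, hq1]), hq2, map_smul, hx]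
    set y := incl n x with hy
    have hchy : ch (n + 1) y = ((n + 1 : ℕ) : ℂ)⁻¹ • (X 1 * hDet m (idv (N + 1))) := by
      rw [hy, ch_incl, hx]
    set J := jm (Fin.last n) with hJ
    -- J is T minus the sum of transpositions of the smaller group, and the latter acts on y by the
    -- scalar `contSum m`.
    have hJy : J * y = Polynomial.aeval T (Polynomial.X - Polynomial.C (contSum m)) * y := by
      have h1 : T = incl n (jmPow n 1) + J := by
        rw [hT, jmPow_succ, pow_one]
      rw [map_sub, Polynomial.aeval_X, Polynomial.aeval_C, sub_mul, ← Algebra.smul_def, h1, add_mul,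
        hy, ← map_mul, jmPow_one_mul_of_ch_eq hp hxc hx, map_smul, add_sub_cancel_left]
    have hJk : ∀ k : ℕ, J ^ k * y =
        Polynomial.aeval T ((Polynomial.X - Polynomial.C (contSum m)) ^ k) * y := by
      intro k
      induction k with
      | zero => simp
      | succ k ihk =>
        have h1 := Subalgebra.mem_center_iff.1
          (aeval_mem_center hTc ((Polynomial.X - Polynomial.C (contSum m)) ^ k)) J
        rw [pow_succ', mul_assoc, ihk, ← mul_assoc, h1, mul_assoc, hJy, ← mul_assoc, ← map_mul,
          pow_succ]
    have hky : jmPow (n + 1) k * y = Polynomial.aeval T (Polynomial.C (contPow k m) +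
        (Polynomial.X - Polynomial.C (contSum m)) ^ k) * y := by
      rw [jmPow_succ, add_mul, hJk, map_add, add_mul, Polynomial.aeval_C, ← Algebra.smul_def, hy,
        ← map_mul, hkx, map_smul]
    -- Q vanishes at the eigenvalues of T belonging to the other rows, so Q(T) keeps only the
    -- component of l.
    set Q : Polynomial ℂ := ∏ p' ∈ Finset.univ.erase p,
      (Polynomial.X - Polynomial.C (contSum m + m p')) with hQ
    set κ : ℂ := ((n + 1 : ℕ) : ℂ)⁻¹ * Q.eval (contSum m + m p) with hκ
    have hκ0 : κ ≠ 0 := by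
      refine mul_ne_zero (inv_ne_zero (Nat.cast_ne_zero.2 (Nat.succ_ne_zero n))) ?_
      -- Boxes added to different rows have different contents since m is strictly decreasing.
      rw [hQ, Polynomial.eval_prod, Finset.prod_ne_zero_iff]
      intro p' hp'
      rw [Polynomial.eval_sub, Polynomial.eval_X, Polynomial.eval_C, add_sub_add_left_eq_sub,
        sub_ne_zero, Ne, Int.cast_inj]
      exact fun h => (Finset.mem_erase.1 hp').1 ((mem_rowSet.1 hp).1.injective h).symm
    have hR : ∀ R : Polynomial ℂ, ch (n + 1) (Polynomial.aeval T (R * Q) * y) =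
        (R.eval (contSum m + m p) * κ) • hDet l (idv (N + 1)) := by
      intro R
      rw [ch_aeval_mul (by omega) hp hchy, Finset.sum_eq_single p]
      · rw [hlm, Polynomial.eval_mul, hκ]
        congr 1
        ring
      · intro p' _ hp'
        rw [Polynomial.eval_mul, hQ, Polynomial.eval_prod, Finset.prod_eq_zero
          (Finset.mem_erase.2 ⟨hp', Finset.mem_univ p'⟩) (by simp), mul_zero, mul_zero, zero_smul]
      · exact fun h => absurd (Finset.mem_univ _) h
    refine ⟨κ⁻¹ • (Polynomial.aeval T Q * y), ?_, ?_⟩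
    · have h1 := hR 1
      rw [one_mul, Polynomial.eval_one, one_mul] at h1
      rw [map_smul, h1, smul_smul, inv_mul_cancel₀ hκ0, one_smul]
    · have h1 := Subalgebra.mem_center_iff.1 (aeval_mem_center hTc Q) (jmPow (n + 1) k)
      rw [mul_smul_comm, ← mul_assoc, h1, mul_assoc, hky, ← mul_assoc, ← map_mul, mul_comm Q,
        map_smul, hR, smul_smul]
      congr 1
      rw [← hlm, contPow_add_single k m p ((mem_rowSet.1 hp).2.1 p)]
      simp only [Polynomial.eval_add, Polynomial.eval_C, Polynomial.eval_pow, Polynomial.eval_sub,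
        Polynomial.eval_X, add_sub_cancel_left]
      field_simp

theorem ch_jmEval_mul {N n : ℕ} (hn : n ≤ N) {l : Fin (N + 1) → ℤ} (hl : l ∈ rowSet (N + 1) n)
    (G : LamP0) {x : GAlg n} {c : ℂ} (hx : ch n x = c • hDet l (idv (N + 1))) :
    ch n (jmEval n G * x) = (eval (fun k => contPow k l) G * c) • hDet l (idv (N + 1)) := by
  induction G using MvPolynomial.induction_on generalizing x c with
  | C a => rw [jmEval_C, smul_mul_assoc, one_mul, map_smul, hx, smul_smul, eval_C]
  | add p q hp hq =>
    rw [jmEval_add, add_mul, map_add, hp hx, hq hx, ← add_smul, map_add, add_mul]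
  | mul_X p k hp =>
    rw [jmEval_mul, jmEval_X, mul_assoc, hp (ch_jmPow_mul hn hl k hx), map_mul, eval_X, mul_assoc]

theorem contEval_eq {n N : ℕ} (lam : n.Partition) (h : (rows lam).length ≤ N) (G : LamP0) :
    contEval lam G = eval (fun k => contPow k (toRows N lam)) G := by
  have h1 : (fun k => contPow k (toRows N lam)) = fun k => contEval lam (X k) :=
    funext fun k => (contEval_X lam h k).symm
  rw [h1]
  unfold contEval
  simp only [eval_X]

/-! ### The twisted diagonal element -/

section Twisted

variable {n : ℕ}

theorem coeff_schur_sum (lam : n.Partition) :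
    schur lam = ∑ mu : n.Partition, coeff (exps mu) (schur lam) • pPart mu := by
  rw [schur_eq_hDet lam le_rfl]
  exact eq_sum_pPart fun d hd =>
    wt_of_coeff_hDet_ne_zero (mem_rowSet.1 (toRows_mem_rowSet lam le_rfl)).2.2 hd

/-- Completeness expands ch(C_μ) in Schur functions; the factor Z_μ of the Hall pairing cancels the
one in ch(C_μ) and leaves the coefficient of P_μ in S_λ. On each Schur function G(𝒥) acts by its
value at the contents. -/
theorem ch_jmEval_classSum (G : LamP0) (mu : n.Partition) :
    ch n (jmEval n G * classSum mu) =
      ∑ lam : n.Partition, (coeff (exps mu) (schur lam) * contEval lam G) • schur lam := by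
  have hlen : ∀ lam : n.Partition, (rows lam).length ≤ n + 1 := fun lam =>
    (rows_length_le lam).trans (Nat.le_succ n)
  have h0 : ∀ lam : n.Partition, ∃ x : GAlg n, ch n x = schur lam := by
    intro lam
    obtain ⟨x, -, hx⟩ := exists_rowSet_center (toRows_mem_rowSet lam (hlen lam))
    exact ⟨x, hx.trans (schur_eq_hDet lam (hlen lam)).symm⟩
  choose x hx using h0
  have h1 : ch n (classSum mu) =
      ch n (∑ lam : n.Partition, coeff (exps mu) (schur lam) • x lam) := by
    have h2 := schurSum_monomial n le_rfl (wt_exps mu)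
    rw [schurSum_apply, ← sum_partition_eq_sum_rowSet (Nat.le_succ n) (fun l =>
      hall (hDet l (idv (n + 1))) (monomial (exps mu) 1) • hDet l (idv (n + 1)))] at h2
    rw [ch_classSum, pPart_eq_monomial, ← h2, map_sum, Finset.smul_sum]
    refine Finset.sum_congr rfl fun lam _ => ?_
    rw [← schur_eq_hDet lam (hlen lam), hall_monomial, map_smul, hx, smul_smul, ← zee_eq_zFin,
      inv_mul_cancel_left₀ (zee_ne_zero mu)]
  rw [ch_center_mul_congr (jmEval_mem_center G) h1, Finset.mul_sum, map_sum]
  refine Finset.sum_congr rfl fun lam _ => ?_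
  rw [mul_smul_comm, map_smul, ch_jmEval_mul le_rfl (toRows_mem_rowSet lam (hlen lam)) G (c := 1)
    (by rw [hx, one_smul, schur_eq_hDet lam (hlen lam)]), mul_one, smul_smul,
    contEval_eq lam (hlen lam), ← schur_eq_hDet lam (hlen lam)]

/-- The factor n! cancels the normalisation of ch(g), leaving P_{cyc(g)}(x); summing over a
conjugacy class turns g in the second factor into the class sum. -/
theorem chch_twistedElt (G : LamP0) :
    chch n (twistedElt n G) =
      ∑ lam : n.Partition, inX (pPart lam) * inY (ch n (jmEval n G * classSum lam)) := by
  have h1 : ∀ g : Equiv.Perm (Fin n), chch n ((n ! : ℂ) • (elt g ⊗ₜ[ℂ] (jmEval n G * elt g))) =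
      inX (pPart (prt g)) * inY (ch n (jmEval n G * elt g)) := by
    intro g
    rw [map_smul]
    change (n ! : ℂ) • (inX (ch n (elt g)) * inY (ch n (jmEval n G * elt g))) = _
    rw [ch_elt, map_smul, smul_mul_assoc, smul_smul,
      mul_inv_cancel₀ (Nat.cast_ne_zero.2 (Nat.factorial_ne_zero n)), one_smul]
  unfold twistedElt
  rw [map_sum, Finset.sum_congr rfl fun g _ => h1 g,
    ← Finset.sum_fiberwise_of_maps_to (g := prt) (t := Finset.univ) fun _ _ => Finset.mem_univ _]
  refine Finset.sum_congr rfl fun lam _ => ?_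
  rw [classSum_eq, Finset.mul_sum, map_sum, map_sum, Finset.mul_sum]
  exact Finset.sum_congr rfl fun g hg => by rw [(Finset.mem_filter.1 hg).2]

theorem chch_twistedElt_eq_sum_schur (G : LamP0) :
    chch n (twistedElt n G) =
      ∑ lam : n.Partition, contEval lam G • (inX (schur lam) * inY (schur lam)) := by
  simp only [chch_twistedElt, ch_jmEval_classSum, map_sum, Finset.mul_sum]
  rw [Finset.sum_comm]
  refine Finset.sum_congr rfl fun lam _ => ?_
  conv_rhs => rw [coeff_schur_sum lam, map_sum, Finset.sum_mul, ← coeff_schur_sum lam,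
    Finset.smul_sum]
  refine Finset.sum_congr rfl fun mu _ => ?_
  rw [map_smul, map_smul, mul_smul_comm, smul_mul_assoc, smul_smul, mul_comm (contEval lam G)]

theorem existsUnique_classMatrix (n : ℕ) (G : LamP0) :
    ∃! M : n.Partition → n.Partition → ℂ, IsClassMatrix n G M := by
  have h1 : ∀ lam : n.Partition, ∃ a : n.Partition → ℂ,
      jmEval n G * classSum lam = ∑ mu, a mu • classSum mu := fun lam =>
    center_eq_sum_classSum (mul_mem (jmEval_mem_center G) (classSum_mem_center lam))
  choose M hM using h1
  refine ⟨M, hM, fun M' hM' => ?_⟩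
  funext lam mu
  refine sub_eq_zero.1 (sum_classSum_eq_zero (a := fun mu => M' lam mu - M lam mu) ?_ mu)
  simp only [sub_smul, Finset.sum_sub_distrib]
  rw [← hM, ← hM', sub_self]

theorem chch_twistedElt_eq_sum_pPart {G : LamP0} {M : n.Partition → n.Partition → ℂ}
    (hM : IsClassMatrix n G M) :
    chch n (twistedElt n G) = ∑ lam : n.Partition, ∑ mu : n.Partition,
      ((zee mu)⁻¹ * M lam mu) • (inX (pPart lam) * inY (pPart mu)) := by
  rw [chch_twistedElt]
  refine Finset.sum_congr rfl fun lam _ => ?_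
  rw [hM lam, map_sum, map_sum, Finset.mul_sum]
  refine Finset.sum_congr rfl fun mu _ => ?_
  rw [map_smul, ch_classSum, map_smul, map_smul, smul_smul, mul_smul_comm, mul_comm]

end Twisted

end TwistedCL

end

noncomputable section

namespace TwistedCL

/-! ### Fermion operators -/

namespace Maya

theorem ext_mem {S T : Maya} (h : ∀ j, j ∈ S.1 ↔ j ∈ T.1) : S = T := Subtype.ext (Set.ext h)

theorem mem_insert {i j : ℤ} {S : Maya} : i ∈ (S.insert j).1 ↔ i = j ∨ i ∈ S.1 := Iff.rfl

theorem mem_erase {i j : ℤ} {S : Maya} : i ∈ (S.erase j).1 ↔ i ∈ S.1 ∧ i ≠ j := Iff.rfl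

theorem erase_insert {j : ℤ} {S : Maya} (h : j ∉ S.1) : (S.insert j).erase j = S :=
  ext_mem fun i => by
    rw [mem_erase, mem_insert]
    constructor
    · rintro ⟨h1 | h1, h2⟩
      exacts [absurd h1 h2, h1]
    · exact fun h1 => ⟨Or.inr h1, fun h2 => h (h2 ▸ h1)⟩

theorem insert_erase {j : ℤ} {S : Maya} (h : j ∈ S.1) : (S.erase j).insert j = S :=
  ext_mem fun i => by
    rw [mem_insert, mem_erase]
    constructor
    · rintro (h1 | h1)
      exacts [h1 ▸ h, h1.1]
    · intro h1
      by_cases h2 : i = j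
      exacts [Or.inl h2, Or.inr ⟨h1, h2⟩]

theorem erase_comm (i j : ℤ) (S : Maya) : (S.erase i).erase j = (S.erase j).erase i :=
  ext_mem fun k => by
    simp only [mem_erase]
    tauto

theorem insert_erase_comm {i j : ℤ} (h : i ≠ j) (S : Maya) :
    (S.insert i).erase j = (S.erase j).insert i :=
  ext_mem fun k => by
    simp only [mem_erase, mem_insert]
    constructor
    · tauto
    · rintro (h1 | h1)
      · exact ⟨Or.inl h1, h1 ▸ h⟩
      · tauto

theorem finite_above (j : ℤ) (S : Maya) : {k | k ∈ S.1 ∧ j < k}.Finite :=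
  (S.2.1.union (Set.finite_Ioo j 0)).subset fun k hk => by
    rcases lt_or_ge k 0 with h | h
    · exact Or.inr ⟨hk.2, h⟩
    · exact Or.inl ⟨hk.1, h⟩

theorem above_insert (j : ℤ) {m : ℤ} {S : Maya} (h : m ∉ S.1) :
    (S.insert m).above j = S.above j + if j < m then 1 else 0 := by
  unfold above
  split_ifs with hj
  · rw [← Set.ncard_insert_of_notMem (fun h' => h h'.1) (finite_above j S)]
    congr 1
    ext k
    simp only [Set.mem_ofPred_eq, mem_insert, Set.mem_insert_iff]
    constructor
    · tauto
    · rintro (rfl | h1)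
      · exact ⟨Or.inl rfl, hj⟩
      · tauto
  · congr 1
    ext k
    simp only [Set.mem_ofPred_eq, mem_insert]
    constructor
    · rintro ⟨rfl | h1, h2⟩
      · exact absurd h2 hj
      · exact ⟨h1, h2⟩
    · tauto

theorem above_erase (j : ℤ) {m : ℤ} {S : Maya} (h : m ∈ S.1) :
    S.above j = (S.erase m).above j + if j < m then 1 else 0 := by
  conv_lhs => rw [← insert_erase h]
  exact above_insert j fun h' => h'.2 rfl

end Maya

section Fermions

variable {R : Type*} [CommRing R]

open Classical in
theorem psi_single (j : ℤ) (S : Maya) (a : R) :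
    psi R j (Finsupp.single S a) =
      if j ∈ S.1 then 0 else Finsupp.single (S.insert j) (a * (-1) ^ S.above j) := by
  unfold psi
  rw [Finsupp.linearCombination_single]
  split_ifs <;> simp

open Classical in
theorem psiDag_single (j : ℤ) (S : Maya) (a : R) :
    psiDag R j (Finsupp.single S a) =
      if j ∈ S.1 then Finsupp.single (S.erase j) (a * (-1) ^ S.above j) else 0 := by
  unfold psiDag
  rw [Finsupp.linearCombination_single]
  split_ifs <;> simp

open Classical in
-- The coefficient of the image at a given state. In this form the anticommutation relations become
-- pointwise sign checks.
theorem psi_apply (j : ℤ) (w : Fock R) (S : Maya) :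
    psi R j w S = if j ∈ S.1 then (-1) ^ S.above j * w (S.erase j) else 0 := by
  induction w using Finsupp.induction_linear with
  | zero => simp
  | add v w hv hw =>
    rw [map_add, Finsupp.add_apply, hv, hw]
    split_ifs
    · rw [Finsupp.add_apply, mul_add]
    · rw [add_zero]
  | single T a =>
    rw [psi_single]
    by_cases hT : j ∈ T.1
    · rw [if_pos hT]
      split_ifs with hS
      · rw [Finsupp.single_apply, if_neg, mul_zero, Finsupp.zero_apply]
        rintro rfl
        exact hT.2 rfl
      · rfl
    · rw [if_neg hT, Finsupp.single_apply]
      by_cases h : T.insert j = S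
      · subst h
        have hj : j ∈ (T.insert j).1 := Or.inl rfl
        rw [if_pos rfl, if_pos hj, Maya.erase_insert hT, Finsupp.single_eq_same,
          Maya.above_insert j hT, if_neg (lt_irrefl j), add_zero, mul_comm]
      · rw [if_neg h]
        split_ifs with hS
        · rw [Finsupp.single_apply, if_neg, mul_zero]
          rintro rfl
          exact h (Maya.insert_erase hS)
        · rfl

open Classical in
theorem psiDag_apply (j : ℤ) (w : Fock R) (S : Maya) :
    psiDag R j w S = if j ∈ S.1 then 0 else (-1) ^ S.above j * w (S.insert j) := by
  induction w using Finsupp.induction_linear with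
  | zero => simp
  | add v w hv hw =>
    rw [map_add, Finsupp.add_apply, hv, hw]
    split_ifs
    · rw [add_zero]
    · rw [Finsupp.add_apply, mul_add]
  | single T a =>
    rw [psiDag_single]
    by_cases hT : j ∈ T.1
    · rw [if_pos hT, Finsupp.single_apply]
      by_cases h : T.erase j = S
      · subst h
        have hj : j ∉ (T.erase j).1 := fun h => h.2 rfl
        rw [if_pos rfl, if_neg hj, Maya.insert_erase hT, Finsupp.single_eq_same,
          Maya.above_erase j hT, if_neg (lt_irrefl j), add_zero, mul_comm]
      · rw [if_neg h]
        split_ifs with hS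
        · rfl
        · rw [Finsupp.single_apply, if_neg, mul_zero]
          rintro rfl
          exact h (Maya.erase_insert hS)
    · rw [if_neg hT]
      split_ifs with hS
      · rfl
      · rw [Finsupp.single_apply, if_neg, mul_zero, Finsupp.zero_apply]
        rintro rfl
        exact hT (Or.inl rfl)

theorem psi_psi (i j : ℤ) (w : Fock R) : psi R i (psi R j w) = -psi R j (psi R i w) := by
  classical
  ext S
  rw [Finsupp.neg_apply, psi_apply, psi_apply, psi_apply, psi_apply]
  rcases eq_or_ne i j with rfl | hij
  · have h : i ∉ (S.erase i).1 := fun h => h.2 rfl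
    rw [if_neg h]
    simp
  · by_cases hi : i ∈ S.1
    · by_cases hj : j ∈ S.1
      · rw [if_pos hi, if_pos hj, if_pos (Maya.mem_erase.2 ⟨hj, hij.symm⟩),
          if_pos (Maya.mem_erase.2 ⟨hi, hij⟩), Maya.erase_comm, Maya.above_erase i hj,
          Maya.above_erase j hi]
        rcases lt_or_gt_of_ne hij with h | h
        · rw [if_pos h, if_neg h.asymm, pow_succ]
          ring
        · rw [if_pos h, if_neg h.asymm, pow_succ]
          ring
      · rw [if_neg hj, if_pos hi, if_neg fun h => hj h.1, mul_zero, neg_zero]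
    · rw [if_neg hi]
      by_cases hj : j ∈ S.1
      · rw [if_pos hj, if_neg fun h => hi h.1, mul_zero, neg_zero]
      · rw [if_neg hj, neg_zero]

theorem psiDag_psi (m l : ℤ) (w : Fock R) :
    psiDag R m (psi R l w) = (if m = l then w else 0) - psi R l (psiDag R m w) := by
  classical
  ext S
  rw [Finsupp.sub_apply, psi_apply, psiDag_apply, psiDag_apply, psi_apply]
  rcases eq_or_ne m l with rfl | hml
  · rw [if_pos rfl]
    by_cases hm : m ∈ S.1
    · have h : m ∉ (S.erase m).1 := fun h => h.2 rfl
      rw [if_pos hm, if_pos hm, if_neg h, Maya.insert_erase hm, ← mul_assoc,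
        Maya.above_erase m hm, if_neg (lt_irrefl m), add_zero, ← mul_pow]
      simp
    · have h : m ∈ (S.insert m).1 := Or.inl rfl
      rw [if_neg hm, if_neg hm, if_pos h, Maya.erase_insert hm, ← mul_assoc,
        Maya.above_insert m hm, if_neg (lt_irrefl m), add_zero, ← mul_pow]
      simp
  · rw [if_neg hml, Finsupp.zero_apply, zero_sub]
    by_cases hm : m ∈ S.1
    · rw [if_pos hm, if_pos (Maya.mem_erase.2 ⟨hm, hml⟩), mul_zero]
      simp
    · by_cases hl : l ∈ S.1
      · rw [if_neg hm, if_pos hl, if_pos (Maya.mem_insert.2 (Or.inr hl)),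
          if_neg fun h => hm (Maya.mem_erase.1 h).1, Maya.insert_erase_comm hml,
          Maya.above_insert l hm, Maya.above_erase m hl]
        rcases lt_or_gt_of_ne hml with h | h
        · rw [if_pos h, if_neg h.asymm, pow_succ]
          ring
        · rw [if_pos h, if_neg h.asymm, pow_succ]
          ring
      · rw [if_neg hl, if_neg hm, if_neg, mul_zero, neg_zero]
        rintro (h | h)
        exacts [hml h.symm, hl h]

/-! ### Currents. -/

theorem finite_hops {i : ℤ} (S : Maya) : {j : ℤ | j + i ∈ S.1 ∧ j ∉ S.1}.Finite := by
  refine (((S.2.1.image fun j => j - i).union S.2.2).union (Set.finite_Ico 0 (-i))).subset ?_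
  rintro j ⟨h1, h2⟩
  by_cases h3 : 0 ≤ j + i
  · exact Or.inl (Or.inl ⟨j + i, ⟨h1, h3⟩, by simp⟩)
  · by_cases h4 : j < 0
    · exact Or.inl (Or.inr ⟨h2, h4⟩)
    · exact Or.inr ⟨by omega, by omega⟩

theorem psi_psiDag_single_eq_zero {i j : ℤ} (hi : i ≠ 0) {S : Maya} (a : R)
    (h : ¬ (j + i ∈ S.1 ∧ j ∉ S.1)) : psi R j (psiDag R (j + i) (Finsupp.single S a)) = 0 := by
  classical
  rw [psiDag_single]
  split_ifs with h1
  · rw [psi_single, if_pos]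
    refine Maya.mem_erase.2 ⟨?_, by omega⟩
    by_contra h2
    exact h ⟨h1, h2⟩
  · rw [map_zero]

theorem finite_support_hops {i : ℤ} (hi : i ≠ 0) (w : Fock R) :
    (Function.support fun j => psi R j (psiDag R (j + i) w)).Finite := by
  induction w using Finsupp.induction_linear with
  | zero => simp
  | add v w hv hw =>
    refine (hv.union hw).subset fun j hj => ?_
    by_contra hc
    simp only [Set.mem_union, Function.mem_support, not_or, not_not] at hc
    simp only [Function.mem_support, map_add, hc.1, hc.2, add_zero] at hj
    exact hj rfl
  | single S a =>
    refine (finite_hops (i := i) S).subset fun j hj => ?_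
    by_contra hc
    exact hj (psi_psiDag_single_eq_zero hi a hc)

theorem current_apply {i : ℤ} (hi : i ≠ 0) (w : Fock R) :
    current R i w = ∑ᶠ j : ℤ, psi R j (psiDag R (j + i) w) := by
  induction w using Finsupp.induction_linear with
  | zero => simp
  | add v w hv hw =>
    rw [map_add, hv, hw, ← finsum_add_distrib (finite_support_hops hi v) (finite_support_hops hi w)]
    simp only [map_add]
  | single S a =>
    unfold current
    rw [Finsupp.linearCombination_single, smul_finsum' _ (finite_support_hops hi _)]
    refine finsum_congr fun j => ?_
    rw [← map_smul, ← map_smul, Finsupp.smul_single, smul_eq_mul, mul_one]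

/-- The relation [J_i, ψ_l] = ψ_{l-i}: in the sum over j only the contraction of ψ†_{j+i} with ψ_l,
at j = l - i, fails to commute. -/
theorem current_psi {i : ℤ} (hi : i ≠ 0) (l : ℤ) (w : Fock R) :
    current R i (psi R l w) = psi R l (current R i w) + psi R (l - i) w := by
  have h1 : ∀ j, psi R j (psiDag R (j + i) (psi R l w)) =
      psi R l (psi R j (psiDag R (j + i) w)) + if j = l - i then psi R (l - i) w else 0 := by
    intro j
    rw [psiDag_psi, map_sub, psi_psi j l, sub_neg_eq_add, add_comm]
    congr 1
    by_cases h : j = l - i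
    · rw [if_pos h, if_pos (by omega), h]
    · rw [if_neg h, if_neg (by omega), map_zero]
  rw [current_apply hi, current_apply hi, finsum_congr h1, finsum_add_distrib]
  · congr 1
    · exact ((psi R l).toAddMonoidHom.map_finsum (finite_support_hops hi w)).symm
    · rw [finsum_eq_single _ (l - i) fun j hj => if_neg hj, if_pos rfl]
  · refine (finite_support_hops hi w).subset fun j hj hc => hj ?_
    simp only [hc, map_zero]
  · exact (Set.finite_singleton (l - i)).subset fun j hj => by
      by_contra hc
      exact hj (if_neg hc)

theorem current_vac {i : ℤ} (hi : 0 < i) (M : ℤ) :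
    current R i (Finsupp.single (Maya.vac M) 1) = 0 := by
  rw [current_apply hi.ne']
  refine finsum_eq_zero_of_forall_eq_zero fun j => psi_psiDag_single_eq_zero hi.ne' _ ?_
  rintro ⟨h1, h2⟩
  change j + i < M at h1
  exact h2 (by change j < M; omega)

/-! ### Transposes in the occupation basis. -/

theorem psi_transpose (j : ℤ) (S T : Maya) :
    psi R j (Finsupp.single T 1) S = psiDag R j (Finsupp.single S 1) T := by
  classical
  rw [psi_apply, psiDag_single]
  by_cases h : j ∈ S.1
  · rw [if_pos h, if_pos h, one_mul, Finsupp.single_apply, Finsupp.single_apply]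
    by_cases h1 : T = S.erase j
    · rw [if_pos h1, if_pos h1.symm, mul_one]
    · rw [if_neg h1, if_neg (Ne.symm h1), mul_zero]
  · rw [if_neg h, if_neg h, Finsupp.zero_apply]

/-- The operators `P` and `Q` are transposes of each other in the occupation basis. -/
def IsTranspose (P Q : Module.End R (Fock R)) : Prop :=
  ∀ S T : Maya, P (Finsupp.single T 1) S = Q (Finsupp.single S 1) T

theorem IsTranspose.symm {P Q : Module.End R (Fock R)} (h : IsTranspose P Q) : IsTranspose Q P :=
  fun S T => (h T S).symm

theorem IsTranspose.one : IsTranspose (1 : Module.End R (Fock R)) 1 := by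
  classical
  intro S T
  simp only [Module.End.one_apply, Finsupp.single_apply, eq_comm]

theorem IsTranspose.smul {P Q : Module.End R (Fock R)} (h : IsTranspose P Q) (c : R) :
    IsTranspose (c • P) (c • Q) := fun S T => by
  rw [LinearMap.smul_apply, LinearMap.smul_apply, Finsupp.smul_apply, Finsupp.smul_apply, h]

theorem apply_eq_sum (P : Module.End R (Fock R)) (w : Fock R) (S : Maya) :
    P w S = w.sum fun T a => a * P (Finsupp.single T 1) S := by
  conv_lhs => rw [← Finsupp.sum_single w]
  rw [Finsupp.sum, map_sum, Finsupp.finsetSum_apply]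
  refine Finset.sum_congr rfl fun T _ => ?_
  rw [← mul_one (w T), ← smul_eq_mul, ← Finsupp.smul_single, map_smul, Finsupp.smul_apply]
  simp

theorem IsTranspose.mul {P Q P' Q' : Module.End R (Fock R)} (h : IsTranspose P Q)
    (h' : IsTranspose P' Q') : IsTranspose (P * P') (Q' * Q) := by
  classical
  intro S T
  rw [Module.End.mul_apply, Module.End.mul_apply, apply_eq_sum P, apply_eq_sum Q',
    Finsupp.sum_of_support_subset _ (Finset.subset_union_left (s₂ := (Q (Finsupp.single S 1)).support))
      _ (by simp),
    Finsupp.sum_of_support_subset _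
      (Finset.subset_union_right (s₁ := (P' (Finsupp.single T 1)).support)) _ (by simp)]
  exact Finset.sum_congr rfl fun U _ => by rw [h S U, h' U T, mul_comm]

theorem IsTranspose.pow {P Q : Module.End R (Fock R)} (h : IsTranspose P Q) (k : ℕ) :
    IsTranspose (P ^ k) (Q ^ k) := by
  induction k with
  | zero => exact IsTranspose.one
  | succ k ih =>
    rw [pow_succ, pow_succ']
    exact ih.mul h

theorem isTranspose_current {i : ℤ} (hi : i ≠ 0) :
    IsTranspose (current R i : Module.End R (Fock R)) (current R (-i)) := by
  intro S T
  -- Transposing ψ_j ψ†_{j+i} gives ψ_{j+i} ψ†_j, a term of J_{-i} with summation index j + i.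
  have h1 : ∀ j, psi R j (psiDag R (j + i) (Finsupp.single T 1)) S =
      psi R (j + i) (psiDag R ((j + i) + -i) (Finsupp.single S 1)) T := by
    intro j
    rw [add_neg_cancel_right]
    have h2 : IsTranspose (psi R j : Module.End R (Fock R)) (psiDag R j) := psi_transpose j
    have h3 : IsTranspose (psi R (j + i) : Module.End R (Fock R)) (psiDag R (j + i)) :=
      psi_transpose (j + i)
    exact h2.mul h3.symm S T
  rw [current_apply hi, current_apply (neg_ne_zero.2 hi)]
  have h2 := (Finsupp.applyAddHom S : Fock R →+ R).map_finsum
    (finite_support_hops hi (Finsupp.single T (1 : R)))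
  have h3 := (Finsupp.applyAddHom T : Fock R →+ R).map_finsum
    (finite_support_hops (neg_ne_zero.2 hi) (Finsupp.single S (1 : R)))
  refine h2.trans (Eq.trans ?_ h3.symm)
  refine (finsum_congr h1).trans ?_
  exact finsum_comp_equiv (Equiv.addRight i) (f := fun x =>
    psi R x (psiDag R (x + -i) (Finsupp.single S 1)) T)

end Fermions

end TwistedCL

end

noncomputable section

namespace TwistedCL

/-! ### Semi-infinite wedge vectors -/

/-- The state with occupied levels `j < M` and `t 0, t 1, …`. -/
def Maya.ofTuple (M : ℤ) {n : ℕ} (t : Fin n → ℤ) : Maya :=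
  ⟨{j | j < M} ∪ Set.range t,
    ((Maya.vac M).2.1.union (Set.finite_range t)).subset (by
      rintro k ⟨h | h, hk⟩
      exacts [Or.inl ⟨h, hk⟩, Or.inr h]),
    (Maya.vac M).2.2.subset (by
      rintro k ⟨h, hk⟩
      exact ⟨fun h' => h (Or.inl h'), hk⟩)⟩

theorem Maya.mem_ofTuple {M : ℤ} {n : ℕ} {t : Fin n → ℤ} {j : ℤ} :
    j ∈ (Maya.ofTuple M t).1 ↔ j < M ∨ ∃ p, t p = j := Iff.rfl

theorem Maya.ofTuple_zero (M : ℤ) (t : Fin 0 → ℤ) : Maya.ofTuple M t = Maya.vac M :=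
  Maya.ext_mem fun j => by
    rw [Maya.mem_ofTuple]
    simp [Maya.vac]

theorem Maya.ofTuple_erase {M : ℤ} {n : ℕ} {t : Fin (n + 1) → ℤ} (ht : Function.Injective t)
    (hM : ∀ p, M ≤ t p) (q : Fin (n + 1)) :
    (Maya.ofTuple M t).erase (t q) = Maya.ofTuple M fun p => t (q.succAbove p) :=
  Maya.ext_mem fun j => by
    rw [Maya.mem_erase, Maya.mem_ofTuple, Maya.mem_ofTuple]
    constructor
    · rintro ⟨h | ⟨p, rfl⟩, h2⟩
      · exact Or.inl h
      · obtain ⟨p', hp'⟩ := Fin.exists_succAbove_eq (fun hpq => h2 (by rw [hpq]) : p ≠ q)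
        exact Or.inr ⟨p', by rw [hp']⟩
    · rintro (h | ⟨p, rfl⟩)
      · exact ⟨Or.inl h, fun h' => by have := hM q; omega⟩
      · exact ⟨Or.inr ⟨_, rfl⟩, fun h' => Fin.succAbove_ne q p (ht h')⟩

theorem Maya.above_ofTuple {M : ℤ} {n : ℕ} {t : Fin n → ℤ} (ht : StrictAnti t)
    (hM : ∀ p, M ≤ t p) (q : Fin n) : (Maya.ofTuple M t).above (t q) = q := by
  unfold Maya.above
  have h1 : {k | k ∈ (Maya.ofTuple M t).1 ∧ t q < k} = t '' (Finset.Iio q : Set (Fin n)) := by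
    ext k
    rw [Set.mem_ofPred_eq, Maya.mem_ofTuple]
    constructor
    · rintro ⟨h | ⟨p, rfl⟩, h2⟩
      · have := hM q
        omega
      · exact ⟨p, by simpa using ht.lt_iff_gt.1 h2, rfl⟩
    · rintro ⟨p, hp, rfl⟩
      exact ⟨Or.inr ⟨p, rfl⟩, ht (by simpa using hp)⟩
  rw [h1, Set.ncard_image_of_injective _ ht.injective, Set.ncard_coe_finset, Fin.card_Iio]

section Ket

variable (R : Type*) [CommRing R]

/-- The vector `ψ_{s 0} ψ_{s 1} ⋯ |M⟩`. -/
def ket (M : ℤ) : {n : ℕ} → (Fin n → ℤ) → Fock R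
  | 0, _ => Finsupp.single (Maya.vac M) 1
  | _ + 1, s => psi R (s 0) (ket M fun p => s p.succ)

variable {R}

theorem ket_succ (M : ℤ) {n : ℕ} (s : Fin (n + 1) → ℤ) :
    ket R M s = psi R (s 0) (ket R M fun p => s p.succ) := rfl

/-- J_k is commuted through the creation operators, lowering one index each time, until it
annihilates the vacuum. This is the fermionic counterpart of `dP_hDet`. -/
theorem current_ket {k : ℤ} (hk : 0 < k) (M : ℤ) {n : ℕ} (s : Fin n → ℤ) :
    current R k (ket R M s) = ∑ p, ket R M (s + Pi.single p (-k)) := by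
  induction n with
  | zero =>
    rw [Fin.sum_univ_zero]
    exact current_vac hk M
  | succ n ih =>
    rw [ket_succ, current_psi hk.ne', ih, map_sum, Fin.sum_univ_succ, add_comm]
    congr 1
    · rw [ket_succ]
      have h1 : (fun p : Fin n => s p.succ) =
          fun p => (s + Pi.single 0 (-k) : Fin (n + 1) → ℤ) p.succ := by
        funext p
        simp
      rw [← h1, Pi.add_apply, Pi.single_eq_same, sub_eq_add_neg]
    · refine Finset.sum_congr rfl fun p _ => ?_
      rw [ket_succ]
      congr 1
      · simp
      · congr 1
        funext q
        simp [Pi.single_apply, Fin.succ_inj]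

theorem ket_apply_of_notMem {M x : ℤ} (hx : x < M) {n : ℕ} (s : Fin n → ℤ) {S : Maya}
    (hS : x ∉ S.1) : ket R M s S = 0 := by
  classical
  induction n generalizing S with
  | zero =>
    refine Finsupp.single_eq_of_ne ?_
    rintro rfl
    exact hS hx
  | succ n ih =>
    rw [ket_succ, psi_apply]
    split_ifs with h
    · rw [ih (S := S.erase (s 0)) _ fun h' => hS (Maya.mem_erase.1 h').1, mul_zero]
    · rfl

theorem ket_succ_apply_ofTuple {M : ℤ} {n m : ℕ} (s : Fin (n + 1) → ℤ) {t : Fin m → ℤ}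
    (h : ∀ q, t q ≠ s 0) : ket R M s (Maya.ofTuple M t) = 0 := by
  classical
  rw [ket_succ, psi_apply]
  split_ifs with h1
  · rw [ket_apply_of_notMem (x := s 0), mul_zero]
    · rcases h1 with h1 | ⟨q, hq⟩
      · exact h1
      · exact absurd hq (h q)
    · exact fun h' => h'.2 rfl
  · rfl

/-- Conservation of charge: the two sides have n and m particles above the level M. -/
theorem ket_apply_ofTuple_of_ne {M : ℤ} {n m : ℕ} (hnm : n ≠ m) (s : Fin n → ℤ) {t : Fin m → ℤ}
    (ht : StrictAnti t) (hM : ∀ p, M ≤ t p) : ket R M s (Maya.ofTuple M t) = 0 := by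
  classical
  induction n generalizing m with
  | zero =>
    refine Finsupp.single_eq_of_ne fun h => ?_
    obtain ⟨m, rfl⟩ := Nat.exists_eq_succ_of_ne_zero hnm.symm
    have h1 : t 0 ∈ (Maya.vac M).1 := by
      rw [← h]
      exact Or.inr ⟨0, rfl⟩
    exact absurd h1 (not_lt.2 (hM 0))
  | succ n ih =>
    by_cases h : ∀ q, t q ≠ s 0
    · exact ket_succ_apply_ofTuple s h
    · push Not at h
      obtain ⟨q, hq⟩ := h
      have hs : s 0 ∈ (Maya.ofTuple M t).1 := Maya.mem_ofTuple.2 (Or.inr ⟨q, hq⟩)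
      obtain ⟨m, rfl⟩ : ∃ m', m = m' + 1 := ⟨m - 1, by have := q.isLt; omega⟩
      rw [ket_succ, psi_apply, if_pos hs, ← hq, Maya.ofTuple_erase ht.injective hM,
        ih (by omega) _ (fun a b hab => ht (Fin.strictMono_succAbove q hab)) fun p => hM _, mul_zero]

/-- Cofactor expansion along the first row. If s_0 = t_q, the fermionic sign counts the q occupied
levels above t_q, which is the cofactor sign; the indices s may be in any order or repeat. -/
theorem ket_apply_ofTuple {M : ℤ} {n : ℕ} (s : Fin n → ℤ) {t : Fin n → ℤ}
    (ht : StrictAnti t) (hM : ∀ p, M ≤ t p) :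
    ket R M s (Maya.ofTuple M t) =
      (Matrix.of fun i j => if s i = t j then (1 : R) else 0).det := by
  classical
  induction n with
  | zero =>
    rw [Maya.ofTuple_zero, Matrix.det_isEmpty]
    exact Finsupp.single_eq_same
  | succ n ih =>
    rw [Matrix.det_succ_row_zero]
    by_cases h : ∀ q, t q ≠ s 0
    · rw [ket_succ_apply_ofTuple s h, Finset.sum_eq_zero]
      intro q _
      rw [Matrix.of_apply, if_neg (h q).symm, mul_zero, zero_mul]
    · push Not at h
      obtain ⟨q, hq⟩ := h
      have hs : s 0 ∈ (Maya.ofTuple M t).1 := Maya.mem_ofTuple.2 (Or.inr ⟨q, hq⟩)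
      rw [Finset.sum_eq_single q]
      · rw [Matrix.of_apply, if_pos hq.symm, mul_one, ket_succ, psi_apply,
          if_pos hs, ← hq, Maya.ofTuple_erase ht.injective hM,
          Maya.above_ofTuple ht hM,
          ih _ (fun a b hab => ht (Fin.strictMono_succAbove q hab)) fun p => hM _]
        rfl
      · intro q' _ hq'
        rw [Matrix.of_apply, if_neg fun h' => hq' (ht.injective (h'.symm.trans hq.symm)), mul_zero,
          zero_mul]
      · exact fun h => absurd (Finset.mem_univ _) h

theorem ket_eq_single {M : ℤ} {n : ℕ} {t : Fin n → ℤ} (ht : StrictAnti t) (hM : ∀ p, M ≤ t p) :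
    ket R M t = Finsupp.single (Maya.ofTuple M t) 1 := by
  classical
  induction n with
  | zero =>
    rw [Maya.ofTuple_zero]
    rfl
  | succ n ih =>
    have h1 := Maya.ofTuple_erase ht.injective hM 0
    have h0 : t 0 ∈ (Maya.ofTuple M t).1 := Or.inr ⟨0, rfl⟩
    have h2 := Maya.above_ofTuple ht hM 0
    rw [Maya.above_erase _ h0, if_neg (lt_irrefl _), add_zero, h1] at h2
    have h3 := Maya.insert_erase h0
    rw [h1] at h3
    rw [ket_succ, ih (fun a b hab => ht (Fin.succ_lt_succ_iff.2 hab)) fun p => hM _, psi_single,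
      if_neg]
    · simp only [Fin.succAbove_zero] at h2 h3
      rw [h3, h2]
      simp
    · have h4 : t 0 ∉ ((Maya.ofTuple M t).erase (t 0)).1 := fun h => h.2 rfl
      rw [h1] at h4
      simpa only [Fin.succAbove_zero] using h4

theorem Maya.exists_eq_ofTuple (S : Maya) (B : ℕ) :
    ∃ N n : ℕ, B ≤ N ∧ ∃ t : Fin n → ℤ, StrictAnti t ∧ (∀ p, -(N : ℤ) ≤ t p) ∧
      S = Maya.ofTuple (-(N : ℤ)) t := by
  obtain ⟨b, hb⟩ := S.2.2.bddBelow
  -- Below -N there are no empty levels.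
  set N : ℕ := max B (-b).toNat with hN
  have hNS : ∀ j : ℤ, j < -(N : ℤ) → j ∈ S.1 := by
    intro j hj
    by_contra hc
    have h1 := hb (show j ∈ S.1ᶜ ∩ {j | j < 0} from ⟨hc, by change j < 0; omega⟩)
    omega
  have hfin : {j | j ∈ S.1 ∧ -(N : ℤ) ≤ j}.Finite := by
    refine (S.2.1.union (Set.finite_Ico (-(N : ℤ)) 0)).subset fun j hj => ?_
    rcases lt_or_ge j 0 with h | h
    · exact Or.inr ⟨hj.2, h⟩
    · exact Or.inl ⟨hj.1, h⟩
  set F := hfin.toFinset with hF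
  have hmem : ∀ j, j ∈ F ↔ j ∈ S.1 ∧ -(N : ℤ) ≤ j := fun j => hfin.mem_toFinset
  refine ⟨N, F.card, le_max_left _ _, fun p => F.orderEmbOfFin rfl p.rev, ?_, ?_, ?_⟩
  · intro a b hab
    exact (F.orderEmbOfFin rfl).strictMono (Fin.rev_lt_rev.2 hab)
  · exact fun p => ((hmem _).1 (F.orderEmbOfFin_mem rfl _)).2
  · refine Maya.ext_mem fun j => ?_
    rw [Maya.mem_ofTuple]
    constructor
    · intro hj
      rcases lt_or_ge j (-(N : ℤ)) with h | h
      · exact Or.inl h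
      · have h1 : j ∈ Set.range (F.orderEmbOfFin rfl) := by
          rw [Finset.range_orderEmbOfFin]
          exact (hmem j).2 ⟨hj, h⟩
        obtain ⟨p, hp⟩ := h1
        exact Or.inr ⟨p.rev, by rw [Fin.rev_rev, hp]⟩
    · rintro (h | ⟨p, rfl⟩)
      · exact hNS j h
      · exact ((hmem _).1 (F.orderEmbOfFin_mem rfl _)).1

end Ket

end TwistedCL

end

noncomputable section

namespace TwistedCL

open MvPolynomial

/-! ### Vacuum expectations and constant terms -/

section Correspondence

variable {R : Type*} [CommRing R]

theorem vac_eq_ofTuple (N : ℕ) :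
    Maya.vac 0 = Maya.ofTuple (-(N : ℤ)) fun q : Fin N => -(q : ℤ) - 1 :=
  Maya.ext_mem fun j => by
    rw [Maya.mem_ofTuple]
    change j < 0 ↔ _
    constructor
    · intro h
      by_cases h1 : j < -(N : ℤ)
      · exact Or.inl h1
      · refine Or.inr ⟨⟨(-j - 1).toNat, by omega⟩, ?_⟩
        simp only
        omega
    · rintro (h | ⟨p, rfl⟩) <;> omega

/-- All the matrix coefficients of `P` between wedge vectors of a given shape and the vacuum
vanish. -/
def Annihilates (M : ℤ) (n : ℕ) (P : Module.End R (Fock R)) : Prop :=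
  ∀ s : Fin n → ℤ, P (ket R M s) (Maya.vac 0) = 0

/-- The wedge has charge M + n, and the vacuum coefficient is zero unless this charge is 0. -/
theorem Annihilates.one {M : ℤ} {n : ℕ} (hM : M ≤ 0) (h : (n : ℤ) ≠ -M) :
    Annihilates M n (1 : Module.End R (Fock R)) := by
  intro s
  obtain ⟨N, rfl⟩ : ∃ N : ℕ, M = -(N : ℤ) := ⟨(-M).toNat, by omega⟩
  rw [Module.End.one_apply, vac_eq_ofTuple N]
  refine ket_apply_ofTuple_of_ne (by omega) s ?_ ?_
  · intro a b hab
    have := Fin.lt_def.1 hab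
    simp only
    omega
  · intro p
    have := p.isLt
    omega

theorem Annihilates.mul_current_pow {M : ℤ} {n : ℕ} {P : Module.End R (Fock R)}
    (h : Annihilates M n P) (k : ℕ+) (m : ℕ) :
    Annihilates M n (P * (current R (k : ℤ) : Module.End R (Fock R)) ^ m) := by
  induction m with
  | zero => simpa using h
  | succ m ih =>
    intro s
    rw [pow_succ, ← mul_assoc, Module.End.mul_apply, current_ket (by exact_mod_cast k.pos), map_sum,
      Finsupp.finsetSum_apply]
    exact Finset.sum_eq_zero fun q _ => ih _

theorem Annihilates.smul {M : ℤ} {n : ℕ} {P : Module.End R (Fock R)}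
    (h : Annihilates M n P) (c : R) : Annihilates M n (c • P) := by
  intro s
  rw [LinearMap.smul_apply, Finsupp.smul_apply, h, smul_zero]

variable [Algebra ℂ R]

/-- The operator `P` on the Fock space and the operator `D` on symmetric functions have the same
matrix coefficients between the wedge vectors and the vacuum. -/
def Corresponds (N : ℕ) (P : Module.End R (Fock R)) (D : Module.End ℂ Lam) : Prop :=
  ∀ l : Fin N → ℤ, P (ket R (-(N : ℤ)) fun p => l p - 1) (Maya.vac 0) =
    algebraMap ℂ R (coeff 0 (D (hDet l (idv N))))

/-- The constant term of h_m is 1 for m = 0 and 0 otherwise, so the constant term of the determinant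
is the determinant of deltas that gives the overlap of the wedge with the vacuum. -/
theorem Corresponds.one (N : ℕ) : Corresponds N (1 : Module.End R (Fock R)) 1 := by
  intro l
  rw [Module.End.one_apply, Module.End.one_apply, vac_eq_ofTuple N, ket_apply_ofTuple]
  · have h1 : coeff 0 (hDet l (idv N)) = (constantCoeff : Lam →+* ℂ) (hDet l (idv N)) := rfl
    rw [h1, hDet, RingHom.map_det, RingHom.map_det]
    congr 1
    ext i j
    rw [RingHom.mapMatrix_apply, RingHom.mapMatrix_apply, Matrix.map_apply, Matrix.map_apply,
      Matrix.of_apply, Matrix.of_apply, constantCoeff_eq, coeff_hInt, map_zero]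
    by_cases h : l i - 1 = -(j : ℤ) - 1
    · rw [if_pos h, if_pos (by simp only [idv]; omega)]
      simp [zFin]
    · rw [if_neg h, if_neg (by simp only [idv]; omega), map_zero]
  · intro a b hab
    have := Fin.lt_def.1 hab
    simp only
    omega
  · intro p
    have := p.isLt
    omega

theorem Corresponds.mul_current {N : ℕ} {P : Module.End R (Fock R)} {D : Module.End ℂ Lam}
    (h : Corresponds N P D) (k : ℕ+) :
    Corresponds N (P * current R (k : ℤ)) (D * (dP k).toLinearMap) := by
  intro l
  rw [Module.End.mul_apply, Module.End.mul_apply, current_ket (by exact_mod_cast k.pos), map_sum,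
    Finsupp.finsetSum_apply]
  change _ = algebraMap ℂ R (coeff 0 (D (dP k (hDet l (idv N)))))
  rw [dP_hDet, map_sum, coeff_sum, map_sum]
  refine Finset.sum_congr rfl fun q _ => ?_
  rw [← h]
  congr 3
  funext p
  simp only [Pi.add_apply]
  ring

theorem Corresponds.smul {N : ℕ} {P : Module.End R (Fock R)} {D : Module.End ℂ Lam}
    (h : Corresponds N P D) (c : ℂ) : Corresponds N (algebraMap ℂ R c • P) (c • D) := by
  intro l
  rw [LinearMap.smul_apply, LinearMap.smul_apply, Finsupp.smul_apply, h, coeff_smul, smul_eq_mul,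
    smul_eq_mul, map_mul]

theorem Corresponds.mul_current_pow {N : ℕ} {P : Module.End R (Fock R)} {D : Module.End ℂ Lam}
    (h : Corresponds N P D) (k : ℕ+) (m : ℕ) :
    Corresponds N (P * (current R (k : ℤ) : Module.End R (Fock R)) ^ m)
      (D * (dP k).toLinearMap ^ m) := by
  induction m with
  | zero => simpa using h
  | succ m ih =>
    rw [pow_succ, pow_succ, ← mul_assoc, ← mul_assoc]
    exact ih.mul_current k

variable (R) in
/-- A divided power of the current `J_i`. -/
def currentFactor (e : ℤ) (a : ℕ+ →₀ ℕ) (i : ℕ+) : Module.End R (Fock R) :=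
  algebraMap ℂ R (((a i)! : ℂ)⁻¹) • (current R (e * (i : ℤ)) : Module.End R (Fock R)) ^ a i

/-- A divided power of the derivation `i ∂/∂P_i`. -/
def derFactor (a : ℕ+ →₀ ℕ) (i : ℕ+) : Module.End ℂ Lam :=
  ((a i)! : ℂ)⁻¹ • (dP i).toLinearMap ^ a i

theorem Corresponds.mul_list {N : ℕ} (a : ℕ+ →₀ ℕ) (L : List ℕ+) {P : Module.End R (Fock R)}
    {D : Module.End ℂ Lam} (h : Corresponds N P D) :
    Corresponds N (P * (L.map (currentFactor R 1 a)).prod) (D * (L.map (derFactor a)).prod) := by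
  induction L generalizing P D with
  | nil => simpa using h
  | cons i L ih =>
    rw [List.map_cons, List.map_cons, List.prod_cons, List.prod_cons, ← mul_assoc, ← mul_assoc]
    refine ih ?_
    unfold currentFactor derFactor
    rw [mul_smul_comm, mul_smul_comm, one_mul]
    exact (h.mul_current_pow i (a i)).smul _

theorem Annihilates.mul_list {M : ℤ} {n : ℕ} (a : ℕ+ →₀ ℕ) (L : List ℕ+)
    {P : Module.End R (Fock R)} (h : Annihilates M n P) :
    Annihilates M n (P * (L.map (currentFactor R 1 a)).prod) := by
  induction L generalizing P with
  | nil => simpa using h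
  | cons i L ih =>
    rw [List.map_cons, List.prod_cons, ← mul_assoc]
    refine ih ?_
    unfold currentFactor
    rw [mul_smul_comm, one_mul]
    exact (h.mul_current_pow i (a i)).smul _

/-- Transposition reverses the product. For this reason the matrix elements below are computed for
any duplicate-free list with the right support, so that commutation of the currents is not needed.
-/
theorem isTranspose_list (a : ℕ+ →₀ ℕ) (L : List ℕ+) :
    IsTranspose ((L.map (currentFactor R (-1) a)).prod)
      ((L.reverse.map (currentFactor R 1 a)).prod) := by
  induction L with
  | nil => exact IsTranspose.one
  | cons i L ih =>
    rw [List.map_cons, List.prod_cons, List.reverse_cons, List.map_append, List.prod_append,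
      List.map_singleton, List.prod_singleton]
    refine IsTranspose.mul ?_ ih
    unfold currentFactor
    rw [one_mul, neg_one_mul]
    have h1 := isTranspose_current (R := R) (i := -(i : ℤ)) (by simp)
    rw [neg_neg] at h1
    exact (h1.pow _).smul _

/-- Multiplying by e_i! turns the falling product of exponents into a quotient of factorials without
division. -/
theorem coeff_dP_pow (i : ℕ+) (m : ℕ) (f : Lam) (e : ℕ+ →₀ ℕ) :
    coeff e (((dP i).toLinearMap ^ m : Module.End ℂ Lam) f) * ((e i)! : ℂ) =
      (i : ℂ) ^ m * ((e i + m)! : ℂ) * coeff (e + Finsupp.single i m) f := by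
  induction m generalizing e with
  | zero => simp [mul_comm]
  | succ m ih =>
    rw [pow_succ', Module.End.mul_apply]
    change coeff e (dP i _) * _ = _
    have h1 := ih (e + Finsupp.single i 1)
    rw [Finsupp.add_apply, Finsupp.single_eq_same, add_assoc e, ← Finsupp.single_add, add_comm 1 m,
      Nat.factorial_succ, show e i + 1 + m = e i + (m + 1) by ring] at h1
    rw [coeff_dP, pow_succ]
    push_cast at h1
    linear_combination (i : ℂ) * h1

theorem coeff_derFactor {a : ℕ+ →₀ ℕ} {i : ℕ+} (f : Lam) {e : ℕ+ →₀ ℕ} (he : e i = 0) :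
    coeff e (derFactor a i f) = (i : ℂ) ^ a i * coeff (e + Finsupp.single i (a i)) f := by
  have h1 := coeff_dP_pow i (a i) f e
  rw [he, Nat.factorial_zero, zero_add, Nat.cast_one, mul_one] at h1
  unfold derFactor
  rw [LinearMap.smul_apply, coeff_smul, h1, smul_eq_mul]
  have h2 : ((a i)! : ℂ) ≠ 0 := Nat.cast_ne_zero.2 (Nat.factorial_ne_zero _)
  field_simp

theorem coeff_derFactor_list (a : ℕ+ →₀ ℕ) {L : List ℕ+} (hL : L.Nodup) (f : Lam)
    {e : ℕ+ →₀ ℕ} (he : ∀ i ∈ L, e i = 0) :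
    coeff e ((L.map (derFactor a)).prod f) =
      (L.map fun i : ℕ+ => (i : ℂ) ^ a i).prod * coeff (e + (L.map fun i : ℕ+ => Finsupp.single i (a i)).sum) f := by
  induction L generalizing e with
  | nil => simp
  | cons i L ih =>
    obtain ⟨h1, h2⟩ := List.nodup_cons.1 hL
    rw [List.map_cons, List.prod_cons, Module.End.mul_apply,
      coeff_derFactor _ (he i List.mem_cons_self), ih h2]
    · rw [List.map_cons, List.prod_cons, List.map_cons, List.sum_cons, add_assoc, mul_assoc]
    · intro j hj
      rw [Finsupp.add_apply, he j (List.mem_cons_of_mem _ hj), Finsupp.single_apply,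
        if_neg fun hij : i = j => h1 (hij ▸ hj), add_zero]

/-- The product `∏ i ^ a_i`. -/
def powCoeff (a : ℕ+ →₀ ℕ) : ℂ := a.prod fun i m => (i : ℂ) ^ m

theorem powCoeff_ne_zero (a : ℕ+ →₀ ℕ) : powCoeff a ≠ 0 :=
  Finset.prod_ne_zero_iff.2 fun i _ => pow_ne_zero _ (Nat.cast_ne_zero.2 i.ne_zero)

/-- Taylor's formula: divided derivatives at 0 extract a coefficient. The factor ∏ i ^ a_i comes
from using i ∂/∂P_i. -/
theorem constantCoeff_derFactor_list (a : ℕ+ →₀ ℕ) {L : List ℕ+} (hL : L.Nodup)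
    (h : L.toFinset = a.support) (f : Lam) :
    coeff 0 ((L.map (derFactor a)).prod f) = powCoeff a * coeff a f := by
  rw [coeff_derFactor_list a hL f fun _ _ => rfl, zero_add, ← List.prod_toFinset _ hL,
    ← List.sum_toFinset _ hL, h]
  congr 2
  exact Finsupp.sum_single a

end Correspondence

/-! ### Matrix elements of the vertex operators -/

section Matrix

variable (R : Type*) [CommRing R]

/-- Pigeonhole: the N - p distinct values at positions from p on lie between -N and t_p. This makes
all row lengths of the corresponding diagram nonnegative. -/
theorem le_of_strictAnti {N : ℕ} {t : Fin N → ℤ} (ht : StrictAnti t) (hM : ∀ p, -(N : ℤ) ≤ t p)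
    (p : Fin N) : -(p : ℤ) - 1 ≤ t p := by
  have h1 : (Finset.Ici p).card ≤ (Finset.Icc (-(N : ℤ)) (t p)).card := by
    refine Finset.card_le_card_of_injOn t (fun q hq => ?_) ht.injective.injOn
    exact Finset.mem_coe.2 (Finset.mem_Icc.2 ⟨hM q, ht.antitone (Finset.mem_Ici.1 hq)⟩)
  rw [Fin.card_Ici, Int.card_Icc] at h1
  have := p.isLt
  have := hM p
  omega

/-- The Maya diagram of a partition. -/
def mayaOf {n : ℕ} (lam : n.Partition) : Maya :=
  Maya.ofTuple (-(n : ℤ)) fun p => toRows n lam p - 1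

/-- The right side does not involve N: empty rows reproduce the filled levels below -N. -/
theorem mem_ofTuple_toRows {n N : ℕ} (lam : n.Partition) (h : (rows lam).length ≤ N) {x : ℤ} :
    x ∈ (Maya.ofTuple (-(N : ℤ)) fun p => toRows N lam p - 1).1 ↔
      ∃ p : ℕ, ((rows lam).getD p 0 : ℤ) - p - 1 = x := by
  rw [Maya.mem_ofTuple]
  constructor
  · rintro (hx | ⟨p, rfl⟩)
    · refine ⟨(-x - 1).toNat, ?_⟩
      rw [List.getD_eq_default _ _ (by omega)]
      push_cast
      omega
    · exact ⟨p, rfl⟩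
  · rintro ⟨p, rfl⟩
    by_cases hp : p < N
    · exact Or.inr ⟨⟨p, hp⟩, rfl⟩
    · rw [List.getD_eq_default _ _ (by omega)]
      push_cast
      omega

theorem mayaOf_eq {n N : ℕ} (lam : n.Partition) (h : (rows lam).length ≤ N) :
    mayaOf lam = Maya.ofTuple (-(N : ℤ)) fun p => toRows N lam p - 1 :=
  Maya.ext_mem fun _ =>
    (mem_ofTuple_toRows lam (rows_length_le lam)).trans (mem_ofTuple_toRows lam h).symm

theorem toRows_sub_one_strictAnti {n N : ℕ} (lam : n.Partition) (h : (rows lam).length ≤ N) :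
    StrictAnti fun p => toRows N lam p - 1 := fun _ _ hab =>
  sub_lt_sub_right ((mem_rowSet.1 (toRows_mem_rowSet lam h)).1 hab) 1

theorem le_toRows_sub_one {n N : ℕ} (lam : n.Partition) (h : (rows lam).length ≤ N) (p : Fin N) :
    -(N : ℤ) ≤ toRows N lam p - 1 := by
  have h1 := (mem_rowSet.1 (toRows_mem_rowSet lam h)).2.1 p
  have h2 := p.isLt
  omega

theorem mayaOf_injective (n : ℕ) : Function.Injective (mayaOf : n.Partition → Maya) := by
  intro lam mu h
  have hl := le_toRows_sub_one lam (rows_length_le lam)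
  have hm := le_toRows_sub_one mu (rows_length_le mu)
  have h1 : (fun p => toRows n lam p - 1) = fun p => toRows n mu p - 1 := by
    refine ((toRows_sub_one_strictAnti lam (rows_length_le lam)).range_inj
      (toRows_sub_one_strictAnti mu (rows_length_le mu))).1 ?_
    have key : ∀ nu : n.Partition, (∀ p, -(n : ℤ) ≤ toRows n nu p - 1) →
        Set.range (fun p => toRows n nu p - 1) = (mayaOf nu).1 ∩ {j | -(n : ℤ) ≤ j} := by
      intro nu hnu
      ext j
      constructor
      · rintro ⟨p, rfl⟩
        exact ⟨Or.inr ⟨p, rfl⟩, hnu p⟩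
      · rintro ⟨h1 | h1, h2⟩
        · exact absurd (show j < -(n : ℤ) from h1) (not_lt.2 h2)
        · exact h1
    rw [key lam hl, key mu hm, h]
  refine toRows_injective le_rfl (funext fun p => ?_)
  exact sub_left_injective (congrFun h1 p)

theorem single_mayaOf {n : ℕ} (lam : n.Partition) :
    (Finsupp.single (mayaOf lam) 1 : Fock R) = ket R (-(n : ℤ)) fun p => toRows n lam p - 1 :=
  (ket_eq_single (toRows_sub_one_strictAnti lam (rows_length_le lam))
    (le_toRows_sub_one lam (rows_length_le lam))).symm

variable [Algebra ℂ R]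

theorem list_apply_mayaOf (a : ℕ+ →₀ ℕ) {L : List ℕ+} (hL : L.Nodup) (h : L.toFinset = a.support)
    {n : ℕ} (lam : n.Partition) :
    (L.map (currentFactor R 1 a)).prod (Finsupp.single (mayaOf lam) 1) (Maya.vac 0) =
      algebraMap ℂ R (powCoeff a * coeff a (schur lam)) := by
  have h1 := (Corresponds.one (R := R) n).mul_list a L (toRows n lam)
  rw [one_mul, one_mul, ← single_mayaOf, constantCoeff_derFactor_list a hL h,
    ← schur_eq_hDet lam (rows_length_le lam)] at h1
  exact h1

/-- Charge conservation forces as many particles as rows, so the matrix element is a coefficient of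
some `hDet`; by homogeneity its degree is the weight of a, and its rows form a partition of that
number. -/
theorem exists_mayaOf_of_list_apply_ne_zero (a : ℕ+ →₀ ℕ) {L : List ℕ+} (hL : L.Nodup)
    (h : L.toFinset = a.support) {S : Maya}
    (hS : (L.map (currentFactor R 1 a)).prod (Finsupp.single S 1) (Maya.vac 0) ≠ 0) :
    ∃ lam : (wt a).Partition, mayaOf lam = S := by
  obtain ⟨N, n, -, t, ht, hM, rfl⟩ := Maya.exists_eq_ofTuple S 0
  rw [← ket_eq_single ht hM] at hS
  have hnN : n = N := by
    by_contra hc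
    have h1 := (Annihilates.one (R := R) (M := -(N : ℤ)) (n := n) (by omega)
      (by omega)).mul_list a L t
    rw [one_mul] at h1
    exact hS h1
  subst hnN
  have h1 := (Corresponds.one (R := R) n).mul_list a L fun p => t p + 1
  simp only [add_sub_cancel_right] at h1
  rw [one_mul, one_mul, constantCoeff_derFactor_list a hL h] at h1
  rw [h1] at hS
  have h2 : coeff a (hDet (fun p => t p + 1) (idv n)) ≠ 0 := fun h0 => hS (by
    rw [h0, mul_zero, map_zero])
  have h3 : 0 ≤ ∑ p, (t p + 1) + ∑ p, idv n p := by
    by_contra hc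
    rw [hDet_eq_zero_of_sum_neg (not_le.1 hc), coeff_zero] at h2
    exact h2 rfl
  have h4 : wt a = (∑ p, (t p + 1) + ∑ p, idv n p).toNat :=
    wt_of_coeff_hDet_ne_zero (by omega) h2
  have h5 : (fun p => t p + 1) ∈ rowSet n (wt a) := by
    refine mem_rowSet.2 ⟨fun x y hxy => by simpa using ht hxy, fun p => ?_, by omega⟩
    have := le_of_strictAnti ht hM p
    omega
  obtain ⟨lam, h6, h7⟩ := exists_toRows_eq h5
  refine ⟨lam, ?_⟩
  rw [mayaOf_eq lam h7, h6]
  simp only [add_sub_cancel_right]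

theorem gammaCoeff_eq (e : ℤ) (a : ℕ+ →₀ ℕ) :
    gammaCoeff R e a = ((a.support.sort (· ≤ ·)).map (currentFactor R e a)).prod := rfl

theorem gammaCoeff_apply_vac (a : ℕ+ →₀ ℕ) {n : ℕ} (lam : n.Partition) :
    gammaCoeff R 1 a (Finsupp.single (mayaOf lam) 1) (Maya.vac 0) =
      algebraMap ℂ R (powCoeff a * coeff a (schur lam)) :=
  list_apply_mayaOf R a (Finset.sort_nodup _ _) (Finset.sort_toFinset _ _) lam

theorem gammaCoeff_neg_vac_apply (b : ℕ+ →₀ ℕ) {n : ℕ} (lam : n.Partition) :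
    gammaCoeff R (-1) b (Finsupp.single (Maya.vac 0) 1) (mayaOf lam) =
      algebraMap ℂ R (powCoeff b * coeff b (schur lam)) := by
  rw [gammaCoeff_eq, isTranspose_list]
  exact list_apply_mayaOf R b (List.nodup_reverse.2 (Finset.sort_nodup _ _))
    (by rw [List.toFinset_reverse, Finset.sort_toFinset]) lam

theorem exists_mayaOf_of_gammaCoeff_neg_ne_zero (b : ℕ+ →₀ ℕ) {S : Maya}
    (hS : gammaCoeff R (-1) b (Finsupp.single (Maya.vac 0) 1) S ≠ 0) :
    ∃ lam : (wt b).Partition, mayaOf lam = S := by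
  rw [gammaCoeff_eq, isTranspose_list] at hS
  exact exists_mayaOf_of_list_apply_ne_zero R b (List.nodup_reverse.2 (Finset.sort_nodup _ _))
    (by rw [List.toFinset_reverse, Finset.sort_toFinset]) hS

end Matrix

end TwistedCL

end

noncomputable section

namespace TwistedCL

open MvPolynomial

/-! ### The tau function and the twisted series -/

section Tau

variable {R : Type*} [CommRing R]

/-- The eigenvalue of the convolution symmetry on a basis state. -/
def convEigen (rho : ℤ → Rˣ) (S : Maya) : Rˣ :=
  (∏ᶠ j ∈ S.1 ∩ {j | 0 ≤ j}, rho j) * (∏ᶠ j ∈ S.1ᶜ ∩ {j | j < 0}, (rho j)⁻¹)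

theorem convSymm_single (rho : ℤ → Rˣ) (S : Maya) (a : R) :
    convSymm rho (Finsupp.single S a) = (a * convEigen rho S) • Finsupp.single S 1 := by
  unfold convSymm
  rw [Finsupp.linearCombination_single, Finsupp.smul_single, Finsupp.smul_single, smul_eq_mul,
    smul_eq_mul, mul_one]
  rfl

/-- The content product along one row telescopes. -/
theorem prod_row {A : Type*} [CommGroup A] {r rho : ℤ → A} (hr : ∀ j, r j = rho j / rho (j - 1))
    (a : ℤ) (m : ℕ) : ∏ j ∈ Finset.range m, r (j - a) = rho (m - a - 1) / rho (-a - 1) := by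
  induction m with
  | zero => simp
  | succ m ih =>
    rw [Finset.prod_range_succ, ih, hr]
    push_cast
    rw [show (m : ℤ) + 1 - a - 1 = m - a by ring, mul_comm, div_mul_div_cancel]

/-- Let A be the particles above level -N and B the levels from -N to -1 filled in the vacuum. The
eigenvalue is the product of ρ over A \ B divided by that over B \ A; restoring A ∩ B on both sides
changes nothing. -/
theorem convEigen_ofTuple (rho : ℤ → Rˣ) {N : ℕ} {t : Fin N → ℤ} (ht : Function.Injective t)
    (hM : ∀ p, -(N : ℤ) ≤ t p) :
    convEigen rho (Maya.ofTuple (-(N : ℤ)) t) =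
      (∏ p, rho (t p)) / ∏ j ∈ Finset.Ico (-(N : ℤ)) 0, rho j := by
  classical
  set A : Finset ℤ := Finset.univ.image t with hA
  set B : Finset ℤ := Finset.Ico (-(N : ℤ)) 0 with hB
  have hmemA : ∀ j, j ∈ A ↔ ∃ p, t p = j := fun j => by simp [hA]
  have h1 : (Maya.ofTuple (-(N : ℤ)) t).1 ∩ {j | 0 ≤ j} = ((A \ B : Finset ℤ) : Set ℤ) := by
    ext j
    rw [Finset.mem_coe, Finset.mem_sdiff, hmemA, hB, Finset.mem_Ico]
    constructor
    · rintro ⟨h | h, h0⟩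
      · change j < _ at h
        change 0 ≤ j at h0
        omega
      · change 0 ≤ j at h0
        exact ⟨h, by omega⟩
    · rintro ⟨⟨p, rfl⟩, h2⟩
      have := hM p
      exact ⟨Or.inr ⟨p, rfl⟩, by change 0 ≤ t p; omega⟩
  have h2 : (Maya.ofTuple (-(N : ℤ)) t).1ᶜ ∩ {j | j < 0} = ((B \ A : Finset ℤ) : Set ℤ) := by
    ext j
    rw [Finset.mem_coe, Finset.mem_sdiff, hmemA, hB, Finset.mem_Ico]
    constructor
    · rintro ⟨h, h0⟩
      change j < 0 at h0
      have h3 : ¬ j < -(N : ℤ) := fun h' => h (Or.inl h')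
      exact ⟨⟨by omega, h0⟩, fun h' => h (Or.inr h')⟩
    · rintro ⟨⟨h3, h4⟩, h5⟩
      refine ⟨?_, h4⟩
      rintro (h6 | h6)
      · exact absurd (show j < -(N : ℤ) from h6) (not_lt.2 h3)
      · exact h5 h6
  have h3 : ∏ p, rho (t p) = ∏ j ∈ A, rho j :=
    (Finset.prod_image fun _ _ _ _ h => ht h).symm
  unfold convEigen
  rw [h1, h2, finprod_mem_coe_finset, finprod_mem_coe_finset, h3, Finset.prod_inv_distrib,
    ← div_eq_mul_inv, Finset.prod_sdiff_div_prod_sdiff]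

theorem convEigen_mayaOf {r rho : ℤ → Rˣ} (hr : ∀ j, r j = rho j / rho (j - 1)) {n : ℕ}
    (lam : n.Partition) :
    convEigen rho (mayaOf lam) =
      ∏ c ∈ (diagram lam).cells, r ((c.2 : ℤ) - (c.1 : ℤ)) := by
  have hlen := rows_length_le lam
  rw [mayaOf, convEigen_ofTuple rho (toRows_sub_one_strictAnti lam hlen).injective
    (le_toRows_sub_one lam hlen), prod_diagram lam hlen]
  have h1 : ∏ j ∈ Finset.Ico (-(n : ℤ)) 0, rho j = ∏ p : Fin n, rho (-(p : ℤ) - 1) := by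
    symm
    refine Finset.prod_bij (fun p _ => -((p : ℕ) : ℤ) - 1) ?_ ?_ ?_ fun _ _ => rfl
    · intro p _
      have := p.isLt
      rw [Finset.mem_Ico]
      omega
    · intro p _ q _ h
      have h' : -((p : ℕ) : ℤ) - 1 = -((q : ℕ) : ℤ) - 1 := h
      exact Fin.ext (by omega)
    · intro j hj
      rw [Finset.mem_Ico] at hj
      exact ⟨⟨(-j - 1).toNat, by omega⟩, Finset.mem_univ _, by simp only; omega⟩
  rw [h1, ← Finset.prod_div_distrib]
  refine Finset.prod_congr rfl fun p _ => ?_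
  have h2 := (mem_rowSet.1 (toRows_mem_rowSet lam hlen)).2.1 p
  rw [prod_row hr (p : ℤ), Int.toNat_of_nonneg (by omega), add_sub_cancel_right]

variable [Algebra ℂ R]

/-- Since the convolution symmetry is diagonal, a sum over intermediate basis states suffices, and
only Maya diagrams of partitions of the weight of b are reached from the vacuum. -/
theorem tau_convSymm_coeff (rho : ℤ → Rˣ) (a b : ℕ+ →₀ ℕ) :
    gammaCoeff R 1 a (convSymm rho (gammaCoeff R (-1) b (Finsupp.single (Maya.vac 0) 1)))
      (Maya.vac 0) =
    ∑ lam : (wt b).Partition, algebraMap ℂ R (powCoeff a * coeff a (schur lam)) *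
      algebraMap ℂ R (powCoeff b * coeff b (schur lam)) * convEigen rho (mayaOf lam) := by
  classical
  set w := gammaCoeff R (-1) b (Finsupp.single (Maya.vac 0) 1) with hw
  have h1 : gammaCoeff R 1 a (convSymm rho w) (Maya.vac 0) =
      ∑ S ∈ w.support, w S * convEigen rho S *
        gammaCoeff R 1 a (Finsupp.single S 1) (Maya.vac 0) := by
    conv_lhs => rw [← Finsupp.sum_single w]
    rw [Finsupp.sum, map_sum, map_sum, Finsupp.finsetSum_apply]
    refine Finset.sum_congr rfl fun S _ => ?_
    rw [convSymm_single, map_smul, Finsupp.smul_apply, smul_eq_mul]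
  have h2 : w.support ⊆ Finset.univ.image (mayaOf : (wt b).Partition → Maya) := by
    intro S hS
    obtain ⟨lam, rfl⟩ := exists_mayaOf_of_gammaCoeff_neg_ne_zero R b (Finsupp.mem_support_iff.1 hS)
    exact Finset.mem_image_of_mem _ (Finset.mem_univ _)
  rw [h1, Finset.sum_subset h2, Finset.sum_image fun _ _ _ _ h => mayaOf_injective _ h]
  · refine Finset.sum_congr rfl fun lam _ => ?_
    rw [gammaCoeff_apply_vac, hw, gammaCoeff_neg_vac_apply]
    ring
  · intro S _ hS
    rw [Finsupp.notMem_support_iff.1 hS, zero_mul, zero_mul]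

end Tau

theorem coeff_inX_mul_inY (f g : Lam) (d : ℕ+ ⊕ ℕ+ →₀ ℕ) :
    coeff d (inX f * inY g) =
      coeff (d.comapDomain Sum.inl Sum.inl_injective.injOn) f *
        coeff (d.comapDomain Sum.inr Sum.inr_injective.injOn) g := by
  classical
  induction f using MvPolynomial.induction_on' with
  | add p q hp hq => rw [map_add, add_mul, coeff_add, coeff_add, hp, hq, add_mul]
  | monomial e c =>
    induction g using MvPolynomial.induction_on' with
    | add p q hp hq => rw [map_add, mul_add, coeff_add, coeff_add, hp, hq, mul_add]
    | monomial e' c' =>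
      have h1 : e.mapDomain Sum.inl + e'.mapDomain Sum.inr = d ↔
          e = d.comapDomain Sum.inl Sum.inl_injective.injOn ∧
            e' = d.comapDomain Sum.inr Sum.inr_injective.injOn := by
        rw [Finsupp.ext_iff, Sum.forall, Finsupp.ext_iff, Finsupp.ext_iff]
        refine and_congr (forall_congr' fun i => ?_) (forall_congr' fun i => ?_)
        · rw [Finsupp.add_apply, Finsupp.mapDomain_apply Sum.inl_injective,
            Finsupp.mapDomain_of_notMem_range _ _ (by simp), add_zero, Finsupp.comapDomain_apply]
        · rw [Finsupp.add_apply, Finsupp.mapDomain_apply Sum.inr_injective,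
            Finsupp.mapDomain_of_notMem_range _ _ (by simp), zero_add, Finsupp.comapDomain_apply]
      unfold inX inY
      rw [rename_monomial, rename_monomial, monomial_mul, coeff_monomial, coeff_monomial,
        coeff_monomial]
      simp only [h1]
      split_ifs <;> simp_all

theorem coeff_chch_twistedElt (n : ℕ) (G : LamP0) (d : ℕ+ ⊕ ℕ+ →₀ ℕ) :
    coeff d (chch n (twistedElt n G)) = ∑ lam : n.Partition, contEval lam G *
      (coeff (d.comapDomain Sum.inl Sum.inl_injective.injOn) (schur lam) *
        coeff (d.comapDomain Sum.inr Sum.inr_injective.injOn) (schur lam)) := by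
  rw [chch_twistedElt_eq_sum_schur, coeff_sum]
  refine Finset.sum_congr rfl fun lam _ => ?_
  rw [coeff_smul, smul_eq_mul, coeff_inX_mul_inY]

theorem wt_of_coeff_schur_ne_zero {n : ℕ} (lam : n.Partition) {d : ℕ+ →₀ ℕ}
    (h : coeff d (schur lam) ≠ 0) : wt d = n := by
  rw [schur_eq_hDet lam le_rfl] at h
  exact wt_of_coeff_hDet_ne_zero (mem_rowSet.1 (toRows_mem_rowSet lam le_rfl)).2.2 h

theorem twistedSeries_eq {σ : Type*} (G : MvPowerSeries σ LamP0) (r rho : ℤ → (MvPowerSeries σ ℂ)ˣ)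
    (hr : ∀ j : ℤ, r j = rho j / rho (j - 1))
    (hG : ∀ (n : ℕ) (lam : n.Partition), MvPowerSeries.map (contEval lam) G =
      ∏ c ∈ (diagram lam).cells, (r ((c.2 : ℤ) - (c.1 : ℤ)) : MvPowerSeries σ ℂ)) :
    twistedSeries G = restrictToPowerSums (tau (convSymm rho) 0) := by
  classical
  funext d
  set a := d.comapDomain Sum.inl Sum.inl_injective.injOn with ha
  set b := d.comapDomain Sum.inr Sum.inr_injective.injOn with hb
  -- The rescaling t_i = P_i / i produces exactly the inverses of the factors ∏ i ^ a_i and ∏ i ^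
  -- b_i in the vertex operator matrix elements.
  have hdab : d.prod (fun k m => (Sum.elim (fun i : ℕ+ => ((i : ℕ) : ℂ)⁻¹)
      (fun i : ℕ+ => ((i : ℕ) : ℂ)⁻¹) k) ^ m) = (powCoeff a)⁻¹ * (powCoeff b)⁻¹ := by
    have h1 : d.support = a.support.disjSum b.support := by
      ext k
      rcases k with i | i <;> simp [ha, hb]
    unfold Finsupp.prod powCoeff
    rw [h1, Finset.prod_disjSum]
    simp only [Sum.elim_inl, Sum.elim_inr, inv_pow, Finset.prod_inv_distrib]
    rfl
  have htau : restrictToPowerSums (tau (convSymm rho) 0) d =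
      ∑ lam : (wt b).Partition, algebraMap ℂ (MvPowerSeries σ ℂ)
        (coeff a (schur lam) * coeff b (schur lam)) * MvPowerSeries.map (contEval lam) G := by
    have h1 := MvPowerSeries.coeff_rescale (tau (convSymm rho) 0) (fun k =>
      algebraMap ℂ (MvPowerSeries σ ℂ) (Sum.elim (fun i : ℕ+ => ((i : ℕ) : ℂ)⁻¹)
        (fun i : ℕ+ => ((i : ℕ) : ℂ)⁻¹) k)) d
    have h2 : (MvPowerSeries.coeff d) (tau (convSymm rho) 0) = _ := tau_convSymm_coeff rho a b
    refine h1.trans ?_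
    have h3 : (d.prod fun s m => algebraMap ℂ (MvPowerSeries σ ℂ)
        (Sum.elim (fun i : ℕ+ => ((i : ℕ) : ℂ)⁻¹) (fun i : ℕ+ => ((i : ℕ) : ℂ)⁻¹) s) ^ m) =
        algebraMap ℂ (MvPowerSeries σ ℂ) ((powCoeff a)⁻¹ * (powCoeff b)⁻¹) := by
      rw [← hdab, Finsupp.prod, Finsupp.prod, map_prod]
      simp only [map_pow]
    rw [h2, h3, Finset.mul_sum]
    refine Finset.sum_congr rfl fun lam _ => ?_
    rw [hG, convEigen_mayaOf hr, Units.coe_prod, ← mul_assoc, ← map_mul, ← map_mul]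
    congr 2
    have h4 := powCoeff_ne_zero a
    have h5 := powCoeff_ne_zero b
    field_simp
  rw [htau]
  funext k
  change ∑ᶠ n : ℕ, coeff d (chch n (twistedElt n (MvPowerSeries.coeff k G))) =
    MvPowerSeries.coeff k (∑ lam : (wt b).Partition, algebraMap ℂ (MvPowerSeries σ ℂ)
        (coeff a (schur lam) * coeff b (schur lam)) * MvPowerSeries.map (contEval lam) G)
  -- By homogeneity of the Schur functions in y, only n equal to the weight of b contributes to this
  -- monomial.
  rw [finsum_eq_single _ (wt b), coeff_chch_twistedElt, map_sum]
  · refine Finset.sum_congr rfl fun lam _ => ?_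
    rw [← Algebra.smul_def, MvPowerSeries.coeff_smul, MvPowerSeries.coeff_map, mul_comm]
  · intro n hn
    rw [coeff_chch_twistedElt, Finset.sum_eq_zero]
    intro lam _
    have h1 : coeff b (schur lam) = 0 := by
      by_contra hc
      exact hn (wt_of_coeff_schur_ne_zero lam hc).symm
    rw [h1, mul_zero, mul_zero]

end TwistedCL

end

/-! ### The theorem. -/

theorem mainTheorem2 {σ : Type*} :
    (∀ (n : ℕ) (G : TwistedCL.LamP0),
      (∃! M : n.Partition → n.Partition → ℂ, TwistedCL.IsClassMatrix n G M) ∧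
      ∀ M : n.Partition → n.Partition → ℂ, TwistedCL.IsClassMatrix n G M →
        TwistedCL.chch n (TwistedCL.twistedElt n G) =
            ∑ lam : n.Partition, ∑ mu : n.Partition,
              ((TwistedCL.zee mu)⁻¹ * M lam mu) •
                (TwistedCL.inX (TwistedCL.pPart lam) * TwistedCL.inY (TwistedCL.pPart mu)) ∧
        TwistedCL.chch n (TwistedCL.twistedElt n G) =
            ∑ lam : n.Partition, TwistedCL.contEval lam G •
              (TwistedCL.inX (TwistedCL.schur lam) * TwistedCL.inY (TwistedCL.schur lam))) ∧
    (∀ (G : MvPowerSeries σ TwistedCL.LamP0) (r rho : ℤ → (MvPowerSeries σ ℂ)ˣ),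
      (∀ j : ℤ, r j = rho j / rho (j - 1)) →
      (∀ (n : ℕ) (lam : n.Partition),
        MvPowerSeries.map (TwistedCL.contEval lam) G =
          ∏ c ∈ (TwistedCL.diagram lam).cells,
            (r ((c.2 : ℤ) - (c.1 : ℤ)) : MvPowerSeries σ ℂ)) →
      TwistedCL.twistedSeries G =
        TwistedCL.restrictToPowerSums (TwistedCL.tau (TwistedCL.convSymm rho) 0)) := by
  refine ⟨fun n G => ⟨TwistedCL.existsUnique_classMatrix n G, fun M hM =>
    ⟨TwistedCL.chch_twistedElt_eq_sum_pPart hM, TwistedCL.chch_twistedElt_eq_sum_schur G⟩⟩,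
    fun G r rho hr hG => TwistedCL.twistedSeries_eq G r rho hr hG⟩
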